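/- Let $P_c=\{(\xi,\tau)\in\mathbb R^2\times\mathbb R:\tau-|\xi|^2=c\}$, $P=P_0$, $\bar P=\{(\xi,\tau):\tau+|\xi|^2=0\}$, let $\delta_P,\delta_{\bar P},\delta_{P_c}$ be the surface measures, i.e. $\sqrt{1+4|\xi|^2}\,d\xi$ in the coordinate $\xi$, and let $L^2(P),L^2(\bar P),L^2(P_c)$ be taken with respect to them. Let $\mathcal R=\xi_1\partial_{\xi_2}-\xi_2\partial_{\xi_1}$, understood weakly, and for $P^1\in\{P,\bar P\}$ let $\mathcal RL^2(P^1)=\{f\in L^2(P^1):\mathcal Rf\in L^2(P^1)\}$ with $\|f\|_{\mathcal RL^2(P^1)}=\|f\|_{L^2(P^1)}+\|\mathcal Rf\|_{L^2(P^1)}$. Fix a nonnegative smooth $\varphi_0:[0,\infty)\to\mathbb R$ with $\varphi_0=1$ on $[0,1]$ and $\varphi_0=0$ on $[2,\infty)$, put $\varphi_k(x)=\varphi_0(2^{-k}x)-\varphi_0(2^{-k+1}x)$ for $k\ge1$, and $S^\xi_k l(\xi,\tau)=\varphi_k(|\xi|)\,l(\xi,\tau)$. Say that $f$ is localized at $|\xi|\approx2^i$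 if $2^{i-1}\le|\xi|\le2^{i+1}$ for almost every point $(\xi,\tau)$ at which $f\neq0$. Let $i,j\ge0$ be integers and let $P^1,P^2\in\{P,\bar P\}$, not both equal to $\bar P$. Let $f\in L^2(P^1)$ be localized at $|\xi|\approx2^i$ and $g\in L^2(P^2)$ at $|\xi|\approx2^j$. Then the convolution of measures $f\delta_{P^1}*g\delta_{P^2}$ is absolutely continuous with respect to Lebesgue measure on $\mathbb R^3$ (and is identified with its density), and the following hold. (a) If moreover $f\in\mathcal RL^2(P^1)$ and $\min(i,j)\ge1$, then for every $c\in\mathbb R$ with $|c|\le2^{i+j-2}$ the function $S^\xi_{\max(i,j)}(f\delta_{P^1}*g\delta_{P^2})$ has a restriction to $P_c$ (the weak limit, as $\epsilon\to0^+$, of its averages in $\tau$ over the slabs $|\tau-|\xi|^2-c|<\epsilon$), and $$\|S^\xi_{\max(i,j)}(f\delta_{P^1}*g\delta_{P^2})\|_{L^2(P_c)}\le C\,2^{\min(i,j)/2}\,\|f\|_{\mathcal RL^2(P^1)}\,\|g\|_{L^2(P^2)} .$$ (b) $$\|f\delta_{P^1}*g\delta_{P^2}\|_{L^2(\mathbb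 R^3)}\le C\,2^{\min(i,j)}\,\|f\|_{L^2(P^1)}\,\|g\|_{L^2(P^2)} .$$ The constant $C$ in (a) depends only on $\varphi_0$, and the constant $C$ in (b) is absolute. -/

import Mathlib

open MeasureTheory Filter Topology
open scoped ContDiff

noncomputable section

/-- The space variable `ξ ∈ ℝ²`, with the Euclidean norm. -/
abbrev Plane : Type := EuclideanSpace ℝ (Fin 2)

/-- Frequency space `ℝ² × ℝ`, with points `(ξ, τ)` and Lebesgue measure `volume`. -/
abbrev Freq : Type := Plane × ℝ

/-- The point of the paraboloid `τ = s |ξ|² + c` above `ξ`. For `s = 1` this is the paraboloid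
`P_c`, for `s = -1` it is the conjugate paraboloid `P̄_c`. -/
def parabPoint (s c : ℝ) (ξ : Plane) : Freq := (ξ, s * ‖ξ‖ ^ 2 + c)

/-- The surface measure of the paraboloid `τ = s |ξ|² + c` (for `s = ±1`), as a measure on
`ℝ² × ℝ`: the image of `√(1 + 4|ξ|²) dξ` under the graph map. -/
def parabMeasure (s c : ℝ) : Measure Freq :=
  ((volume : Measure Plane).withDensity
    (fun ξ => ENNReal.ofReal (Real.sqrt (1 + 4 * ‖ξ‖ ^ 2)))).map (parabPoint s c)

/-- `f`, as a function on the support of `μ`, is localized at `|ξ| ≈ 2 ^ i`. -/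
def LocalizedAt (μ : Measure Freq) (i : ℕ) (f : Freq → ℂ) : Prop :=
  ∀ᵐ x ∂μ, f x ≠ 0 → (2 : ℝ) ^ i / 2 ≤ ‖x.1‖ ∧ ‖x.1‖ ≤ 2 * (2 : ℝ) ^ i

/-- The rotation vector field `ξ₁ ∂_{ξ₂} - ξ₂ ∂_{ξ₁}` applied to a smooth function. -/
def rot (ψ : Freq → ℂ) (x : Freq) : ℂ :=
  fderiv ℝ ψ x ((!₂[-(x.1 1), x.1 0] : Plane), (0 : ℝ))

/-- `Rf` is the weak derivative of `f` along the rotation field, with respect to a measure `μ`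
that is invariant under rotations of `ξ`. -/
def IsWeakRot (μ : Measure Freq) (f Rf : Freq → ℂ) : Prop :=
  ∀ ψ : Freq → ℂ, ContDiff ℝ ∞ ψ → HasCompactSupport ψ →
    ∫ x, f x * rot ψ x ∂μ = - ∫ x, Rf x * ψ x ∂μ

/-- The convolution `(f μ) * (g ν)` of the complex measures `f μ` and `g ν` on `ℝ² × ℝ`,
tested against `h`. -/
def convPairing (μ ν : Measure Freq) (f g h : Freq → ℂ) : ℂ :=
  ∫ p : Freq × Freq, f p.1 * g p.2 * h (p.1 + p.2) ∂(μ.prod ν)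

/-- The convolution `(f μ) * (g ν)` is absolutely continuous with respect to Lebesgue measure
on `ℝ² × ℝ`, with locally integrable density `l`. -/
def IsConvDensity (μ ν : Measure Freq) (f g l : Freq → ℂ) : Prop :=
  LocallyIntegrable l volume ∧
    ∀ h : Freq → ℂ, Continuous h → HasCompactSupport h →
      convPairing μ ν f g h = ∫ x, l x * h x

/-- `G` is the restriction (trace) to the paraboloid `P_c = {τ - |ξ|² = c}` of the locally
integrable function `l`, which is only given almost everywhere: the averages of `l` over the
slabs `|τ - |ξ|² - c| < ε` converge to `G` on `P_c`, weakly, as `ε → 0+`. This determines `G`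
almost everywhere on `P_c`, and `G = l` on `P_c` when `l` is continuous. -/
def IsRestriction (c : ℝ) (l G : Freq → ℂ) : Prop :=
  ∀ h : Freq → ℂ, Continuous h → HasCompactSupport h →
    Tendsto
      (fun ε : ℝ => (((2 * ε)⁻¹ : ℝ) : ℂ) *
        ∫ x in {x : Freq | |x.2 - ‖x.1‖ ^ 2 - c| < ε}, l x * h x)
      (𝓝[>] (0 : ℝ))
      (𝓝 (∫ ξ : Plane, G (parabPoint 1 c ξ) * h (parabPoint 1 c ξ)))

/-- The generating cutoff: a nonnegative smooth function on `[0, ∞)` which is `1` on `[0, 1]`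
and `0` on `[2, ∞)`. -/
structure IsCutoff (φ : ℝ → ℝ) : Prop where
  smooth : ContDiffOn ℝ ∞ φ (Set.Ici 0)
  nonneg : ∀ x, 0 ≤ x → 0 ≤ φ x
  eq_one : ∀ x, 0 ≤ x → x ≤ 1 → φ x = 1
  eq_zero : ∀ x, 2 ≤ x → φ x = 0

/-- The dyadic functions `φ₀ = φ` and `φ_k(x) = φ(2^{-k} x) - φ(2^{-k+1} x)` for `k ≥ 1`. -/
def dyadicCutoff (φ : ℝ → ℝ) : ℕ → ℝ → ℝ
  | 0, x => φ x
  | k + 1, x => φ (x / 2 ^ (k + 1)) - φ (x / 2 ^ k)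

/-- The localization operator `S_k^ξ`, acting on functions on frequency space. -/
def freqLocalize (φ : ℝ → ℝ) (k : ℕ) (l : Freq → ℂ) (x : Freq) : ℂ :=
  (dyadicCutoff φ k ‖x.1‖ : ℂ) * l x

end

/-! ### Integration over the line and the plane -/

/-! Write X = 2^i, Y = 2^j. In the coordinate ξ the two densities become plane functions F, G (f and
g times the surface weight), and the convolution tested against h is ∫∫ F(η) G(ζ) h(η + ζ, s₁|η|² +
s₂|ζ|²) dη dζ. A bound of this form by ‖h‖₂ gives absolute continuity and an L² density at once, by
Riesz duality (`exists_L2_density_of_lintegral_bound`).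

For (b), Cauchy–Schwarz reduces most cases to bounding the image of Lebesgue measure on a fibre η +
ζ = ξ under the phase. If one frequency dominates, the phase gradient 2(s₁η - s₂ζ) has size about
max(X, Y) while the small variable stays in a disc of radius about min(X, Y), which gives the factor
min/max (`lintegral_conv_sq_le_separated`). If the frequencies are comparable a bounded factor
suffices: equal signs allow completing the square (`lintegral_conv_sq_le_same`); for opposite signs
the phase depends only on the component of η along ξ, its gradient degenerates as ξ → 0, and
Cauchy–Schwarz along the lines orthogonal to ξ replaces the fibre bound
(`lintegral_conv_sq_le_opposite`). The surface weights cost √X √Y, and √(min/max) √(XY) = min.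

For (a), restricting to P_c forces the pair (η, ζ) near the set where `phaseGap` vanishes. Since |c|
≤ XY/4 and |η + ζ| ≥ max(X, Y)/2, the pair is transverse there: |η × ζ| ≳ XY (`le_abs_planeCross`).
Up to a factor 2, η × ζ is also the derivative of the gap when η is rotated, and the angular
derivative bounds |F| by a circular average of |F| + |RF| (`enorm_le_angBound`). So for each fixed ζ
the F²-mass of a slab of width ε is O(ε/(XY)), while for each fixed η + ζ the slab has area O(ε
min²/(XY)). The geometric mean divided by ε is of order 1/max (`enorm_slabMean_le_of_angBound`), and
the three surface weights √max √X √Y turn this into √min.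

Existence of the limit as ε → 0 is a separate point, since the density is only defined almost
everywhere. In a variable lying on P the gap is affine, so for continuous data the slab means
converge to line integrals fibre by fibre; a bound uniform in ε which needs no angular regularity
(`enorm_slabMean_le_of_bound`) carries this to L² data (`exists_tendsto_slabMean`). The angular
bound then makes the limit an L²-bounded functional, whose density is the trace (`exists_trace`). -/

theorem lintegral_mul_sq_le {α : Type*} [MeasurableSpace α] (μ : Measure α) {f g : α → ENNReal}
    (hf : Measurable f) (hg : Measurable g) :
    (∫⁻ a, f a * g a ∂μ) ^ 2 ≤ (∫⁻ a, f a ^ 2 ∂μ) * ∫⁻ a, g a ^ 2 ∂μ := by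
  have h := ENNReal.lintegral_mul_le_Lp_mul_Lq μ Real.HolderConjugate.two_two
    hf.aemeasurable hg.aemeasurable
  simp only [Pi.mul_apply, ENNReal.rpow_two] at h
  calc (∫⁻ a, f a * g a ∂μ) ^ 2
      ≤ ((∫⁻ a, f a ^ 2 ∂μ) ^ (1 / (2 : ℝ)) * (∫⁻ a, g a ^ 2 ∂μ) ^ (1 / (2 : ℝ))) ^ 2 := by
        gcongr
    _ = _ := by
        rw [mul_pow, ← ENNReal.rpow_two, ← ENNReal.rpow_two, ← ENNReal.rpow_mul,
          ← ENNReal.rpow_mul]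
        norm_num

theorem lintegral_plane {f : Plane → ENNReal} (hf : Measurable f) :
    ∫⁻ z, f z = ∫⁻ x : ℝ, ∫⁻ y : ℝ, f !₂[x, y] := by
  have h1 := (PiLp.volume_preserving_toLp (Fin 2)).lintegral_comp hf
  have h2 := (volume_preserving_finTwoArrow ℝ).symm.lintegral_comp
    (hf.comp (PiLp.volume_preserving_toLp (Fin 2)).measurable)
  rw [← h1]
  simp only [Function.comp_apply] at h2
  rw [← h2, Measure.volume_eq_prod, lintegral_prod _ (by
    refine Measurable.aemeasurable ?_
    exact (hf.comp (PiLp.volume_preserving_toLp (Fin 2)).measurable).comp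
      (MeasurableEquiv.measurable _))]
  rfl

theorem measurable_toPlane : Measurable fun p : ℝ × ℝ => (!₂[p.1, p.2] : Plane) := by
  have : Continuous fun p : ℝ × ℝ => (!₂[p.1, p.2] : Plane) := by
    refine (PiLp.continuous_toLp 2 _).comp ?_
    refine continuous_pi fun i => ?_
    fin_cases i <;> simp <;> fun_prop
  exact this.measurable

theorem lintegral_plane' {f : Plane → ENNReal} (hf : Measurable f) :
    ∫⁻ z, f z = ∫⁻ y : ℝ, ∫⁻ x : ℝ, f !₂[x, y] := by
  rw [lintegral_plane hf, lintegral_lintegral_swap]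
  exact (hf.comp measurable_toPlane).aemeasurable

theorem lintegral_comp_mul_add {a : ℝ} (ha : a ≠ 0) (b : ℝ) (f : ℝ → ENNReal) :
    ∫⁻ x, f (a * x + b) = ENNReal.ofReal |a⁻¹| * ∫⁻ x, f x := by
  have h1 : ∫⁻ x, f (a * x + b) = ∫⁻ y, f (y + b) ∂(Measure.map (a * ·) volume) := by
    exact ((Homeomorph.mulLeft₀ a ha).measurableEmbedding.lintegral_map (μ := volume)
      (fun y => f (y + b))).symm
  rw [h1, Real.map_volume_mul_left ha, lintegral_smul_measure,
    lintegral_add_right_eq_self (μ := volume) f b]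
  rfl

/-- For a quadratic p, p(x) - p(y) = (x - y)(p'(x) + p'(y))/2, so p is injective where p' has a
fixed sign and the change of variables applies there; the factor 2 counts the two branches. -/
theorem lintegral_abs_deriv_quadratic_le (a b c : ℝ) (H : ℝ → ENNReal) :
    ∫⁻ x, ENNReal.ofReal |2 * a * x + b| * H (a * x ^ 2 + b * x + c) ≤ 2 * ∫⁻ t, H t := by
  set p : ℝ → ℝ := fun x => a * x ^ 2 + b * x + c
  set p' : ℝ → ℝ := fun x => 2 * a * x + b
  have hp' : Continuous p' := by fun_prop
  have hder : ∀ x, HasDerivAt p (p' x) x := fun x => by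
    have := ((((hasDerivAt_id x).pow 2).const_mul a).add ((hasDerivAt_id x).const_mul b)).add_const c
    refine this.congr_deriv ?_
    simp [p']; ring
  have hmem : ∀ S : Set ℝ, MeasurableSet S → (∀ x ∈ S, ∀ y ∈ S, p' x + p' y ≠ 0) →
      ∫⁻ x in S, ENNReal.ofReal |p' x| * H (p x) ≤ ∫⁻ t, H t := by
    intro S hS hne
    have hinj : Set.InjOn p S := by
      intro x hx y hy hxy
      have h0 : (x - y) * (p' x + p' y) = 0 := by
        simp only [p, p'] at hxy ⊢
        linear_combination 2 * hxy
      rcases mul_eq_zero.1 h0 with h | h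
      · linarith
      · exact absurd h (hne x hx y hy)
    rw [← lintegral_image_eq_lintegral_abs_deriv_mul hS
      (fun x _ => (hder x).hasDerivWithinAt) hinj]
    exact setLIntegral_le_lintegral _ _
  have hpos : MeasurableSet {x | 0 < p' x} := measurableSet_lt measurable_const hp'.measurable
  have hneg : MeasurableSet {x | p' x < 0} := measurableSet_lt hp'.measurable measurable_const
  calc ∫⁻ x, ENNReal.ofReal |p' x| * H (p x)
      ≤ (∫⁻ x in {x | 0 < p' x}, ENNReal.ofReal |p' x| * H (p x))
        + ∫⁻ x in {x | 0 < p' x}ᶜ, ENNReal.ofReal |p' x| * H (p x) := by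
        rw [lintegral_add_compl _ hpos]
    _ ≤ (∫⁻ t, H t) + ∫⁻ x in {x | p' x < 0}, ENNReal.ofReal |p' x| * H (p x) := by
        refine add_le_add ?_ ?_
        · exact hmem _ hpos fun x hx y hy => (add_pos hx hy).ne'
        · rw [← lintegral_indicator hpos.compl, ← lintegral_indicator hneg]
          refine lintegral_mono fun x => ?_
          rcases lt_trichotomy (p' x) 0 with h | h | h
          · rw [Set.indicator_of_mem (by simpa using h.le), Set.indicator_of_mem (by exact h)]
          · rw [Set.indicator_of_mem (by simp [h])]
            simp [h]
          · rw [Set.indicator_of_notMem (by simpa using h)]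
            simp
    _ ≤ (∫⁻ t, H t) + ∫⁻ t, H t := by
        refine add_le_add le_rfl ?_
        exact hmem _ hneg fun x hx y hy => (add_neg hx hy).ne
    _ = _ := (two_mul _).symm

theorem lintegral_comp_quadratic_le (a b c : ℝ) {m : ℝ} (hm : 0 < m) (H : ℝ → ENNReal) :
    ∫⁻ x in {x : ℝ | m ≤ |2 * a * x + b|}, H (a * x ^ 2 + b * x + c)
      ≤ ENNReal.ofReal (2 / m) * ∫⁻ t, H t := by
  have hS : MeasurableSet {x : ℝ | m ≤ |2 * a * x + b|} :=
    measurableSet_le measurable_const (by fun_prop)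
  calc ∫⁻ x in {x : ℝ | m ≤ |2 * a * x + b|}, H (a * x ^ 2 + b * x + c)
      ≤ ∫⁻ x, ENNReal.ofReal (1 / m) *
          (ENNReal.ofReal |2 * a * x + b| * H (a * x ^ 2 + b * x + c)) := by
        rw [← lintegral_indicator hS]
        refine lintegral_mono fun x => ?_
        by_cases hx : m ≤ |2 * a * x + b|
        · rw [Set.indicator_of_mem (by exact hx), ← mul_assoc, ← ENNReal.ofReal_mul (by positivity)]
          refine le_mul_of_one_le_left' ?_
          rw [ENNReal.one_le_ofReal, one_div_mul_eq_div, one_le_div hm]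
          exact hx
        · rw [Set.indicator_of_notMem (by exact hx)]
          simp
    _ = ENNReal.ofReal (1 / m) *
          ∫⁻ x, ENNReal.ofReal |2 * a * x + b| * H (a * x ^ 2 + b * x + c) :=
        lintegral_const_mul' _ _ ENNReal.ofReal_ne_top
    _ ≤ ENNReal.ofReal (1 / m) * (2 * ∫⁻ t, H t) := by
        gcongr
        exact lintegral_abs_deriv_quadratic_le a b c H
    _ = _ := by
        rw [← mul_assoc, show (2 : ENNReal) = ENNReal.ofReal 2 by simp,
          ← ENNReal.ofReal_mul (by positivity)]
        congr 2
        ring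

/-- At each point of `S` one partial derivative of the quadratic is at least m/2. Integrating first
in that variable costs 2/(m/2) by the one-dimensional bound, and the other variable ranges over an
interval of length 2R; the two possibilities give 2 · 8R/m. -/
theorem lintegral_comp_quadratic_plane_le (a b₀ b₁ c : ℝ) {m R : ℝ} (hm : 0 < m) (hR : 0 ≤ R)
    {H : ℝ → ENNReal} (hH : Measurable H) {S : Set Plane} (hS : MeasurableSet S)
    (hSR : ∀ z ∈ S, ‖z‖ ≤ R)
    (hSm : ∀ z ∈ S, m ^ 2 ≤ (2 * a * z 0 + b₀) ^ 2 + (2 * a * z 1 + b₁) ^ 2) :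
    ∫⁻ z in S, H (a * ‖z‖ ^ 2 + (b₀ * z 0 + b₁ * z 1) + c)
      ≤ ENNReal.ofReal (16 * R / m) * ∫⁻ t, H t := by
  have hn : ∀ x y : ℝ, ‖(!₂[x, y] : Plane)‖ ^ 2 = x ^ 2 + y ^ 2 := fun x y => by
    rw [EuclideanSpace.norm_sq_eq]; simp
  have hcoord : ∀ z ∈ S, |z 0| ≤ R ∧ |z 1| ≤ R := fun z hz =>
    ⟨(PiLp.norm_apply_le z 0).trans (hSR z hz), (PiLp.norm_apply_le z 1).trans (hSR z hz)⟩
  have hm2 : 0 < m / 2 := by positivity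
  set K : Plane → ENNReal := fun z => H (a * ‖z‖ ^ 2 + (b₀ * z 0 + b₁ * z 1) + c)
  have hK : Measurable K := hH.comp (by fun_prop)
  set I : Set ℝ := Set.Icc (-R) R
  have hI : MeasurableSet I := measurableSet_Icc
  set T : ℝ → Set ℝ := fun b => {x : ℝ | m / 2 ≤ |2 * a * x + b|}
  have hT : ∀ b, MeasurableSet (T b) := fun b => measurableSet_le measurable_const (by fun_prop)
  set A : Plane → ENNReal := fun z => I.indicator 1 (z 1) * (T b₀).indicator 1 (z 0) * K z
  set B : Plane → ENNReal := fun z => I.indicator 1 (z 0) * (T b₁).indicator 1 (z 1) * K z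
  have hz0 : Measurable fun z : Plane => z 0 := by fun_prop
  have hz1 : Measurable fun z : Plane => z 1 := by fun_prop
  have hA : Measurable A := (((measurable_one.indicator hI).comp hz1).mul
    ((measurable_one.indicator (hT _)).comp hz0)).mul hK
  have hB : Measurable B := (((measurable_one.indicator hI).comp hz0).mul
    ((measurable_one.indicator (hT _)).comp hz1)).mul hK
  have hvol : ∫⁻ y, I.indicator (1 : ℝ → ENNReal) y = ENNReal.ofReal (2 * R) := by
    rw [lintegral_indicator_one hI, Real.volume_Icc]
    congr 1; ring
  have hfin : ENNReal.ofReal (2 * R) * (ENNReal.ofReal (2 / (m / 2)) * ∫⁻ t, H t)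
      = ENNReal.ofReal (8 * R / m) * ∫⁻ t, H t := by
    rw [← mul_assoc, ← ENNReal.ofReal_mul (by positivity)]
    congr 2; field_simp; ring
  have hIA : ∫⁻ z, A z ≤ ENNReal.ofReal (8 * R / m) * ∫⁻ t, H t := by
    rw [lintegral_plane' hA, ← hfin, ← hvol, ← lintegral_mul_const _ (measurable_one.indicator hI)]
    refine lintegral_mono fun y => ?_
    simp only [A, K, hn, Matrix.cons_val_zero, Matrix.cons_val_one, mul_assoc]
    rw [lintegral_const_mul']
    · refine mul_le_mul_right ?_ _
      refine le_trans (le_of_eq ?_) (lintegral_comp_quadratic_le a b₀ (a * y ^ 2 + b₁ * y + c) hm2 H)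
      rw [← lintegral_indicator (hT b₀)]
      refine lintegral_congr fun x => ?_
      by_cases hx : x ∈ T b₀
      · rw [Set.indicator_of_mem hx, Set.indicator_of_mem hx]
        simp only [Pi.one_apply, one_mul]
        congr 1; ring
      · rw [Set.indicator_of_notMem hx, Set.indicator_of_notMem hx, zero_mul]
    · by_cases hy : y ∈ I <;> simp [hy]
  have hIB : ∫⁻ z, B z ≤ ENNReal.ofReal (8 * R / m) * ∫⁻ t, H t := by
    rw [lintegral_plane hB, ← hfin, ← hvol, ← lintegral_mul_const _ (measurable_one.indicator hI)]
    refine lintegral_mono fun y => ?_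
    simp only [B, K, hn, Matrix.cons_val_zero, Matrix.cons_val_one, mul_assoc]
    rw [lintegral_const_mul']
    · refine mul_le_mul_right ?_ _
      refine le_trans (le_of_eq ?_) (lintegral_comp_quadratic_le a b₁ (a * y ^ 2 + b₀ * y + c) hm2 H)
      rw [← lintegral_indicator (hT b₁)]
      refine lintegral_congr fun x => ?_
      by_cases hx : x ∈ T b₁
      · rw [Set.indicator_of_mem hx, Set.indicator_of_mem hx]
        simp only [Pi.one_apply, one_mul]
        congr 1; ring
      · rw [Set.indicator_of_notMem hx, Set.indicator_of_notMem hx, zero_mul]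
    · by_cases hy : y ∈ I <;> simp [hy]
  calc ∫⁻ z in S, K z ≤ ∫⁻ z, (A z + B z) := by
        rw [← lintegral_indicator hS]
        refine lintegral_mono fun z => ?_
        by_cases hz : z ∈ S
        · rw [Set.indicator_of_mem hz]
          have h0 : z 0 ∈ I := abs_le.1 (hcoord z hz).1
          have h1 : z 1 ∈ I := abs_le.1 (hcoord z hz).2
          by_cases hx : z 0 ∈ T b₀
          · refine le_trans ?_ le_self_add
            simp [A, h1, hx]
          · refine le_trans ?_ le_add_self
            have hx1 : z 1 ∈ T b₁ := by
              by_contra hx1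
              have e0 : |2 * a * z 0 + b₀| < m / 2 := not_le.1 hx
              have e1 : |2 * a * z 1 + b₁| < m / 2 := not_le.1 hx1
              have := hSm z hz
              rw [← sq_abs (2 * a * z 0 + b₀), ← sq_abs (2 * a * z 1 + b₁)] at this
              nlinarith [abs_nonneg (2 * a * z 0 + b₀), abs_nonneg (2 * a * z 1 + b₁)]
            simp [B, h0, hx1]
        · rw [Set.indicator_of_notMem hz]
          exact zero_le
    _ = (∫⁻ z, A z) + ∫⁻ z, B z := lintegral_add_left hA _
    _ ≤ _ := add_le_add hIA hIB
    _ = _ := by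
        rw [← add_mul, ← ENNReal.ofReal_add (by positivity) (by positivity)]
        congr 2; ring

/-- Coordinates by abscissa and slope, with Jacobian |x|; they serve as a substitute for polar
coordinates. -/
theorem lintegral_shear {f : ℝ × ℝ → ENNReal} (hf : Measurable f) :
    ∫⁻ x, ∫⁻ y, f (x, y) = ∫⁻ σ : ℝ, ∫⁻ x, ENNReal.ofReal |x| * f (x, σ * x) := by
  rw [lintegral_lintegral_swap (f := fun σ x => ENNReal.ofReal |x| * f (x, σ * x))]
  · have h0 : ∀ᵐ x : ℝ, x ≠ 0 := by
      rw [ae_iff]; simp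
    refine lintegral_congr_ae (h0.mono fun x hx => ?_)
    simp only
    rw [lintegral_const_mul' _ _ ENNReal.ofReal_ne_top]
    have := lintegral_comp_mul_add hx 0 (fun y => f (x, y))
    simp only [add_zero, mul_comm x] at this
    rw [this, ← mul_assoc, ← ENNReal.ofReal_mul (abs_nonneg _), ← abs_mul, mul_inv_cancel₀ hx]
    simp
  · refine Measurable.aemeasurable ?_
    simp only [Function.uncurry_def]
    fun_prop

theorem lintegral_inv_one_add_sq :
    ∫⁻ σ : ℝ, ENNReal.ofReal ((1 + σ ^ 2)⁻¹) = ENNReal.ofReal Real.pi := by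
  rw [← integral_univ_inv_one_add_sq,
    ofReal_integral_eq_lintegral_ofReal integrable_inv_one_add_sq]
  exact ae_of_all _ fun x => by positivity

/-- No lower bound on the gradient is needed: on the line of slope σ the Jacobian |x| is the
derivative of 2(1 + σ²)x² + a up to the factor 1/(4(1 + σ²)), so it vanishes together with that
derivative. The remaining integral of 1/(1 + σ²) over slopes is π. -/
theorem lintegral_comp_norm_sq_le {k : ℝ → ENNReal} (hk : Measurable k) (a : ℝ) :
    ∫⁻ z : Plane, k (2 * ‖z‖ ^ 2 + a) ≤ ENNReal.ofReal (Real.pi / 2) * ∫⁻ t, k t := by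
  have hn : ∀ x y : ℝ, ‖(!₂[x, y] : Plane)‖ ^ 2 = x ^ 2 + y ^ 2 := fun x y => by
    rw [EuclideanSpace.norm_sq_eq]; simp
  rw [lintegral_plane (f := fun z => k (2 * ‖z‖ ^ 2 + a)) (by fun_prop)]
  simp only [hn]
  rw [lintegral_shear (f := fun p => k (2 * (p.1 ^ 2 + p.2 ^ 2) + a)) (by fun_prop)]
  have hpi : ENNReal.ofReal (Real.pi / 2) = ENNReal.ofReal (1 / 2) * ENNReal.ofReal Real.pi := by
    rw [← ENNReal.ofReal_mul (by norm_num)]; congr 1; ring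
  rw [hpi, ← lintegral_inv_one_add_sq,
    ← lintegral_const_mul _ (f := fun σ : ℝ => ENNReal.ofReal (1 + σ ^ 2)⁻¹) (by fun_prop),
    ← lintegral_mul_const _ (by fun_prop)]
  refine lintegral_mono fun σ => ?_
  have hw : 0 < 1 + σ ^ 2 := by positivity
  have h := lintegral_abs_deriv_quadratic_le (2 * (1 + σ ^ 2)) 0 a k
  calc ∫⁻ x, ENNReal.ofReal |x| * k (2 * (x ^ 2 + (σ * x) ^ 2) + a)
      = ∫⁻ x, ENNReal.ofReal (1 / (4 * (1 + σ ^ 2))) * (ENNReal.ofReal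
          |2 * (2 * (1 + σ ^ 2)) * x + 0| * k (2 * (1 + σ ^ 2) * x ^ 2 + 0 * x + a)) := by
        refine lintegral_congr fun x => ?_
        rw [← mul_assoc, ← ENNReal.ofReal_mul (by positivity)]
        congr 2
        · rw [add_zero, abs_mul, abs_of_pos (by positivity : 0 < 2 * (2 * (1 + σ ^ 2)))]
          field_simp; ring
        · ring
    _ ≤ ENNReal.ofReal (1 / (4 * (1 + σ ^ 2))) * (2 * ∫⁻ t, k t) := by
        rw [lintegral_const_mul' _ _ ENNReal.ofReal_ne_top]
        gcongr
    _ = _ := by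
        rw [← mul_assoc, show (2 : ENNReal) = ENNReal.ofReal 2 by simp,
          ← ENNReal.ofReal_mul (by positivity), ← ENNReal.ofReal_mul (by positivity)]
        congr 2
        field_simp; ring

/-! ### Bilinear estimates for convolutions on paraboloids -/

/-- The sum of the points of the paraboloids `τ = s₁ |ξ|²` and `τ = s₂ |ξ|²` above `p.1`, `p.2`. -/
noncomputable def convPoint (s₁ s₂ : ℝ) (p : Plane × Plane) : Freq := parabPoint s₁ 0 p.1 + parabPoint s₂ 0 p.2

theorem convPoint_eq (s₁ s₂ : ℝ) (p : Plane × Plane) :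
    convPoint s₁ s₂ p = (p.1 + p.2, s₁ * ‖p.1‖ ^ 2 + s₂ * ‖p.2‖ ^ 2) := by
  simp [convPoint, parabPoint]

theorem continuous_parabPoint (s c : ℝ) : Continuous (parabPoint s c) := by
  unfold parabPoint; fun_prop

theorem continuous_convPoint (s₁ s₂ : ℝ) : Continuous (convPoint s₁ s₂) := by
  have h := fun s : ℝ => continuous_parabPoint s 0
  unfold convPoint
  exact ((h s₁).comp continuous_fst).add ((h s₂).comp continuous_snd)

theorem convPoint_swap (s₁ s₂ : ℝ) (p : Plane × Plane) :
    convPoint s₁ s₂ p.swap = convPoint s₂ s₁ p := add_comm _ _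

theorem lintegral_conv_swap (s₁ s₂ : ℝ) (F G : Plane → ENNReal) (h : Freq → ENNReal) :
    ∫⁻ p : Plane × Plane, F p.1 * G p.2 * h (convPoint s₁ s₂ p)
      = ∫⁻ p : Plane × Plane, G p.1 * F p.2 * h (convPoint s₂ s₁ p) := by
  rw [Measure.volume_eq_prod, ← lintegral_prod_swap]
  simp only [convPoint_swap, Prod.fst_swap, Prod.snd_swap, mul_comm (F _) (G _)]

theorem lintegral_prod_sum {f : Plane × Plane → ENNReal} (hf : Measurable f) :
    ∫⁻ p, f p = ∫⁻ ξ, ∫⁻ η, f (η, ξ - η) := by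
  rw [Measure.volume_eq_prod, lintegral_prod _ hf.aemeasurable, lintegral_lintegral_swap
    (f := fun ξ η => f (η, ξ - η)) (by
      refine Measurable.aemeasurable ?_
      simp only [Function.uncurry_def]; fun_prop)]
  refine lintegral_congr fun η => ?_
  exact (lintegral_sub_right_eq_self (μ := volume) (fun ζ => f (η, ζ)) η).symm

theorem lintegral_mul_prod_sq {F G : Plane → ENNReal} (hF : Measurable F) (hG : Measurable G) :
    ∫⁻ p : Plane × Plane, (F p.1 * G p.2) ^ 2 = (∫⁻ η, F η ^ 2) * ∫⁻ ζ, G ζ ^ 2 := by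
  simp only [mul_pow]
  rw [Measure.volume_eq_prod]
  exact lintegral_prod_mul (hF.pow_const 2).aemeasurable (hG.pow_const 2).aemeasurable

/-- Cauchy–Schwarz on pairs separates F ⊗ G from h. The h-factor is then computed over the fibres of
the sum map, where `hK` says that the phase pushes Lebesgue measure to a measure of density at most
`K`. -/
theorem lintegral_conv_sq_le_of_fiber {s₁ s₂ : ℝ} {F G : Plane → ENNReal} {h : Freq → ENNReal}
    (hF : Measurable F) (hG : Measurable G) (hh : Measurable h) {S : Set (Plane × Plane)}
    (hS : MeasurableSet S) {K : ENNReal}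
    (hK : ∀ (ξ : Plane) (k : ℝ → ENNReal), Measurable k →
      ∫⁻ η in {η | (η, ξ - η) ∈ S}, k (s₁ * ‖η‖ ^ 2 + s₂ * ‖ξ - η‖ ^ 2) ≤ K * ∫⁻ t, k t) :
    (∫⁻ p in S, F p.1 * G p.2 * h (convPoint s₁ s₂ p)) ^ 2
      ≤ K * ((∫⁻ η, F η ^ 2) * (∫⁻ ζ, G ζ ^ 2) * ∫⁻ x, h x ^ 2) := by
  have hc := (continuous_convPoint s₁ s₂).measurable
  refine (lintegral_mul_sq_le _ (f := fun p : Plane × Plane => F p.1 * G p.2)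
    (g := fun p => h (convPoint s₁ s₂ p)) (by fun_prop) (hh.comp hc)).trans ?_
  rw [mul_left_comm]
  refine mul_le_mul' ((setLIntegral_le_lintegral _ _).trans
    (lintegral_mul_prod_sq hF hG).le) ?_
  have hm : Measurable fun p : Plane × Plane => h (convPoint s₁ s₂ p) ^ 2 :=
    (hh.comp hc).pow_const 2
  rw [← lintegral_indicator hS, lintegral_prod_sum (hm.indicator hS), Measure.volume_eq_prod,
    lintegral_prod _ (hh.pow_const 2).aemeasurable, ← lintegral_const_mul]
  · refine lintegral_mono fun ξ => ?_
    refine le_trans (le_of_eq ?_) (hK ξ (fun t => h (ξ, t) ^ 2) (by fun_prop))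
    have hS' : MeasurableSet {η : Plane | (η, ξ - η) ∈ S} := by
      have hm' : Measurable fun η : Plane => (η, ξ - η) := by fun_prop
      exact hm' hS
    rw [← lintegral_indicator hS']
    refine lintegral_congr fun η => ?_
    by_cases hη : (η, ξ - η) ∈ S
    · rw [Set.indicator_of_mem hη, Set.indicator_of_mem (by exact hη), convPoint_eq]
      simp
    · rw [Set.indicator_of_notMem hη, Set.indicator_of_notMem (by exact hη)]
  · exact Measurable.lintegral_prod_right' (f := fun x : Freq => h x ^ 2) (by fun_prop)

/-- Completing the square, |η|² + |ξ - η|² = 2|η - ξ/2|² + |ξ|²/2, so a translation reduces each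
fibre to the radial bound `lintegral_comp_norm_sq_le`. -/
theorem lintegral_conv_sq_le_same {F G : Plane → ENNReal} {h : Freq → ENNReal}
    (hF : Measurable F) (hG : Measurable G) (hh : Measurable h) :
    (∫⁻ p : Plane × Plane, F p.1 * G p.2 * h (convPoint 1 1 p)) ^ 2
      ≤ ENNReal.ofReal (Real.pi / 2) *
        ((∫⁻ η, F η ^ 2) * (∫⁻ ζ, G ζ ^ 2) * ∫⁻ x, h x ^ 2) := by
  have := lintegral_conv_sq_le_of_fiber (s₁ := 1) (s₂ := 1) hF hG hh MeasurableSet.univ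
    (K := ENNReal.ofReal (Real.pi / 2)) ?_
  · simpa using this
  · intro ξ k hk
    simp only [Set.mem_univ, Set.ofPred_true, Measure.restrict_univ, one_mul]
    rw [← lintegral_add_right_eq_self (μ := volume) _ ((1 / 2 : ℝ) • ξ)]
    refine le_trans (le_of_eq ?_) (lintegral_comp_norm_sq_le hk (‖ξ‖ ^ 2 / 2))
    refine lintegral_congr fun z => ?_
    congr 1
    have e1 : ‖z + (1 / 2 : ℝ) • ξ‖ ^ 2 = ‖z‖ ^ 2 + inner ℝ z ξ + ‖ξ‖ ^ 2 / 4 := by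
      rw [norm_add_sq_real, inner_smul_right, norm_smul]
      norm_num; ring
    have e2 : ‖ξ - (z + (1 / 2 : ℝ) • ξ)‖ ^ 2 = ‖z‖ ^ 2 - inner ℝ z ξ + ‖ξ‖ ^ 2 / 4 := by
      rw [show ξ - (z + (1 / 2 : ℝ) • ξ) = (1 / 2 : ℝ) • ξ - z by module, norm_sub_sq_real,
        inner_smul_left, norm_smul, real_inner_comm]
      norm_num; ring
    rw [e1, e2]; ring

theorem norm_sq_plane (z : Plane) : ‖z‖ ^ 2 = z 0 ^ 2 + z 1 ^ 2 := by
  rw [EuclideanSpace.norm_sq_eq]; simp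

theorem inner_plane (z w : Plane) : inner ℝ z w = z 0 * w 0 + z 1 * w 1 := by
  rw [PiLp.inner_apply]; simp [mul_comm]

theorem conv_phase_eq (s₁ s₂ : ℝ) (ξ η : Plane) :
    s₁ * ‖η‖ ^ 2 + s₂ * ‖ξ - η‖ ^ 2 = (s₁ + s₂) * ‖η‖ ^ 2
      + ((-2 * s₂ * ξ 0) * η 0 + (-2 * s₂ * ξ 1) * η 1) + s₂ * ‖ξ‖ ^ 2 := by
  simp only [norm_sq_plane, PiLp.sub_apply]; ring

theorem conv_phase_grad_eq (s₁ s₂ : ℝ) (ξ η : Plane) :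
    (2 * (s₁ + s₂) * η 0 + (-2 * s₂ * ξ 0)) ^ 2 + (2 * (s₁ + s₂) * η 1 + (-2 * s₂ * ξ 1)) ^ 2
      = 4 * ‖s₁ • η - s₂ • (ξ - η)‖ ^ 2 := by
  simp only [norm_sq_plane, PiLp.sub_apply, PiLp.smul_apply, smul_eq_mul]; ring

theorem setLIntegral_conv_fiber_le {s₁ s₂ R m : ℝ} (hR : 0 ≤ R) (hm : 0 < m) (ξ : Plane)
    {k : ℝ → ENNReal} (hk : Measurable k) {T : Set Plane} (hT : MeasurableSet T)
    (hTR : ∀ η ∈ T, ‖η‖ ≤ R) (hTm : ∀ η ∈ T, m ≤ ‖s₁ • η - s₂ • (ξ - η)‖) :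
    ∫⁻ η in T, k (s₁ * ‖η‖ ^ 2 + s₂ * ‖ξ - η‖ ^ 2) ≤ ENNReal.ofReal (8 * R / m) * ∫⁻ t, k t := by
  simp only [conv_phase_eq]
  have h2m : 0 < 2 * m := by positivity
  refine (lintegral_comp_quadratic_plane_le _ _ _ _ h2m hR hk hT hTR ?_).trans (le_of_eq ?_)
  · intro z hz
    rw [conv_phase_grad_eq]
    nlinarith [hTm z hz]
  · congr 2
    field_simp; ring

theorem abs_eq_one_of_sign {s : ℝ} (hs : s = 1 ∨ s = -1) : |s| = 1 := by
  rcases hs with rfl | rfl <;> simp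

/-- On the support half the phase gradient has size at least |ζ| - |η| ≥ Y/2 - 2X ≥ Y/4, whatever
the signs. With radius 2X the fibre bound is 8 · 2X/(Y/4) = 64X/Y. -/
theorem lintegral_conv_sq_le_separated {s₁ s₂ X Y : ℝ} (h₁ : s₁ = 1 ∨ s₁ = -1)
    (h₂ : s₂ = 1 ∨ s₂ = -1) (hX : 0 < X) (hXY : 8 * X ≤ Y)
    {F G : Plane → ENNReal} {h : Freq → ENNReal}
    (hF : Measurable F) (hG : Measurable G) (hh : Measurable h)
    (hFs : ∀ η, F η ≠ 0 → ‖η‖ ≤ 2 * X) (hGs : ∀ ζ, G ζ ≠ 0 → Y / 2 ≤ ‖ζ‖) :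
    (∫⁻ p : Plane × Plane, F p.1 * G p.2 * h (convPoint s₁ s₂ p)) ^ 2
      ≤ ENNReal.ofReal (64 * X / Y) *
        ((∫⁻ η, F η ^ 2) * (∫⁻ ζ, G ζ ^ 2) * ∫⁻ x, h x ^ 2) := by
  set S : Set (Plane × Plane) := {p | ‖p.1‖ ≤ 2 * X ∧ Y / 2 ≤ ‖p.2‖}
  have hS : MeasurableSet S := by
    have a1 : MeasurableSet {p : Plane × Plane | ‖p.1‖ ≤ 2 * X} :=
      measurableSet_le (by fun_prop) measurable_const
    have a2 : MeasurableSet {p : Plane × Plane | Y / 2 ≤ ‖p.2‖} :=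
      measurableSet_le measurable_const (by fun_prop)
    exact a1.inter a2
  have e : ∫⁻ p : Plane × Plane, F p.1 * G p.2 * h (convPoint s₁ s₂ p)
      = ∫⁻ p in S, F p.1 * G p.2 * h (convPoint s₁ s₂ p) := by
    rw [setLIntegral_eq_of_support_subset]
    intro p hp
    have hp' : F p.1 * G p.2 ≠ 0 := left_ne_zero_of_mul hp
    exact ⟨hFs _ (left_ne_zero_of_mul hp'), hGs _ (right_ne_zero_of_mul hp')⟩
  rw [e]
  refine lintegral_conv_sq_le_of_fiber hF hG hh hS fun ξ k hk => ?_
  have hY : 0 < Y := by linarith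
  have := setLIntegral_conv_fiber_le (s₁ := s₁) (s₂ := s₂) (R := 2 * X) (m := Y / 4)
    (by positivity) (by positivity) ξ hk (T := {η | (η, ξ - η) ∈ S}) 
    ((by fun_prop : Measurable fun η : Plane => (η, ξ - η)) hS) (fun η hη => hη.1) ?_
  · refine this.trans (le_of_eq ?_)
    congr 2; field_simp; ring
  · intro η hη
    have e1 : ‖s₁ • η‖ = ‖η‖ := by rw [norm_smul, Real.norm_eq_abs, abs_eq_one_of_sign h₁, one_mul]
    have e2 : ‖s₂ • (ξ - η)‖ = ‖ξ - η‖ := by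
      rw [norm_smul, Real.norm_eq_abs, abs_eq_one_of_sign h₂, one_mul]
    have := norm_sub_norm_le (s₂ • (ξ - η)) (s₁ • η)
    rw [norm_sub_rev, e1, e2] at this
    have h3 : ‖η‖ ≤ 2 * X := hη.1
    have h4 : Y / 2 ≤ ‖ξ - η‖ := hη.2
    linarith

/-- The coordinate b runs along (1, σ) and y along the orthogonal direction (-σ, 1); the matrix has
determinant 1 + σ². -/
theorem lintegral_rotated_coordinates (σ : ℝ) {f : ℝ × ℝ → ENNReal} (hf : Measurable f) :
    ∫⁻ x, ∫⁻ y, f (x, y)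
      = ENNReal.ofReal (1 + σ ^ 2) * ∫⁻ b, ∫⁻ y, f (b - σ * y, σ * b + y) := by
  have hw : 0 < 1 + σ ^ 2 := by positivity
  rw [lintegral_lintegral_swap (f := fun x y => f (x, y)) hf.aemeasurable]
  have h1 : ∀ y, ∫⁻ x, f (x, y)
      = ENNReal.ofReal (1 + σ ^ 2) * ∫⁻ b, f ((1 + σ ^ 2) * b - σ * y, y) := fun y => by
    have := lintegral_comp_mul_add hw.ne' (-(σ * y)) (fun x => f (x, y))
    simp only [← sub_eq_add_neg] at this
    rw [this, ← mul_assoc, ← ENNReal.ofReal_mul hw.le, abs_of_pos (by positivity),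
      mul_inv_cancel₀ hw.ne']
    simp
  simp only [h1]
  rw [lintegral_const_mul' _ _ ENNReal.ofReal_ne_top, lintegral_lintegral_swap (by
    refine Measurable.aemeasurable ?_
    simp only [Function.uncurry_def]; fun_prop)]
  congr 1
  refine lintegral_congr fun b => ?_
  rw [← lintegral_add_right_eq_self (μ := volume) _ (σ * b)]
  refine lintegral_congr fun y => ?_
  congr 2 <;> ring

/-- For fixed slope σ, Cauchy–Schwarz in y bounds the square by φ(b + x) ψ(b), where φ and ψ are the
masses of f² and g² on the lines of direction (-σ, 1). Integrating in x and b decouples the product;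
each mass contributes 1/(1 + σ²) and the weight restores one factor 1 + σ², so the integral over σ
gives π. -/
theorem lintegral_conv_opposite_fiber_le {f g : ℝ × ℝ → ENNReal} (hf : Measurable f)
    (hg : Measurable g) :
    ∫⁻ q : ℝ × ℝ × ℝ, (ENNReal.ofReal √(1 + q.1 ^ 2) *
        ∫⁻ y, f (q.2.2 + q.2.1 - q.1 * y, q.1 * (q.2.2 + q.2.1) + y) *
          g (q.2.2 - q.1 * y, q.1 * q.2.2 + y)) ^ 2
      ≤ ENNReal.ofReal Real.pi * ((∫⁻ p, f p ^ 2) * ∫⁻ p, g p ^ 2) := by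
  have hmeas : Measurable fun q : ℝ × ℝ × ℝ => (ENNReal.ofReal √(1 + q.1 ^ 2) *
        ∫⁻ y, f (q.2.2 + q.2.1 - q.1 * y, q.1 * (q.2.2 + q.2.1) + y) *
          g (q.2.2 - q.1 * y, q.1 * q.2.2 + y)) ^ 2 := by
    refine Measurable.pow_const (Measurable.mul (by fun_prop) ?_) 2
    exact Measurable.lintegral_prod_right' (f := fun z : (ℝ × ℝ × ℝ) × ℝ =>
      f (z.1.2.2 + z.1.2.1 - z.1.1 * z.2, z.1.1 * (z.1.2.2 + z.1.2.1) + z.2) *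
          g (z.1.2.2 - z.1.1 * z.2, z.1.1 * z.1.2.2 + z.2)) (by fun_prop)
  rw [Measure.volume_eq_prod, lintegral_prod _ hmeas.aemeasurable, ← lintegral_inv_one_add_sq,
    ← lintegral_mul_const _ (f := fun σ : ℝ => ENNReal.ofReal (1 + σ ^ 2)⁻¹) (by fun_prop)]
  refine lintegral_mono fun σ => ?_
  simp only
  have hw : 0 < 1 + σ ^ 2 := by positivity
  set φ : ℝ → ENNReal := fun a => ∫⁻ y, f (a - σ * y, σ * a + y) ^ 2
  set ψ : ℝ → ENNReal := fun a => ∫⁻ y, g (a - σ * y, σ * a + y) ^ 2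
  have hφm : Measurable φ := Measurable.lintegral_prod_right'
    (f := fun z : ℝ × ℝ => f (z.1 - σ * z.2, σ * z.1 + z.2) ^ 2) (by fun_prop)
  have hψm : Measurable ψ := Measurable.lintegral_prod_right'
    (f := fun z : ℝ × ℝ => g (z.1 - σ * z.2, σ * z.1 + z.2) ^ 2) (by fun_prop)
  have hφ : ∫⁻ p, f p ^ 2 = ENNReal.ofReal (1 + σ ^ 2) * ∫⁻ a, φ a := by
    rw [Measure.volume_eq_prod, lintegral_prod _ (hf.pow_const 2).aemeasurable]
    exact lintegral_rotated_coordinates σ (hf.pow_const 2)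
  have hψ : ∫⁻ p, g p ^ 2 = ENNReal.ofReal (1 + σ ^ 2) * ∫⁻ a, ψ a := by
    rw [Measure.volume_eq_prod, lintegral_prod _ (hg.pow_const 2).aemeasurable]
    exact lintegral_rotated_coordinates σ (hg.pow_const 2)
  calc _ ≤ ∫⁻ a : ℝ × ℝ, ENNReal.ofReal (1 + σ ^ 2) * (φ (a.2 + a.1) * ψ a.2) := by
        refine lintegral_mono fun a => ?_
        simp only
        rw [mul_pow, ← ENNReal.ofReal_pow (Real.sqrt_nonneg _), Real.sq_sqrt hw.le]
        refine mul_le_mul_right ?_ _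
        exact lintegral_mul_sq_le volume
          (f := fun y => f (a.2 + a.1 - σ * y, σ * (a.2 + a.1) + y))
          (g := fun y => g (a.2 - σ * y, σ * a.2 + y)) (by fun_prop) (by fun_prop)
    _ = ENNReal.ofReal (1 + σ ^ 2) * ∫⁻ b, ∫⁻ x, φ (b + x) * ψ b := by
        rw [lintegral_const_mul' _ _ ENNReal.ofReal_ne_top, Measure.volume_eq_prod,
          lintegral_prod_symm _ (by refine Measurable.aemeasurable ?_; fun_prop)]
    _ = ENNReal.ofReal (1 + σ ^ 2) * ((∫⁻ a, φ a) * ∫⁻ b, ψ b) := by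
        congr 1
        rw [← lintegral_const_mul _ hψm]
        refine lintegral_congr fun b => ?_
        rw [lintegral_mul_const _ (by fun_prop)]
        congr 1
        exact lintegral_add_left_eq_self (μ := volume) φ b
    _ = _ := by
        rw [hφ, hψ]
        have : ENNReal.ofReal (1 + σ ^ 2)⁻¹ * ENNReal.ofReal (1 + σ ^ 2) = 1 := by
          rw [← ENNReal.ofReal_mul (by positivity), inv_mul_cancel₀ hw.ne', ENNReal.ofReal_one]
        calc _ = (ENNReal.ofReal (1 + σ ^ 2)⁻¹ * ENNReal.ofReal (1 + σ ^ 2)) *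
              (ENNReal.ofReal (1 + σ ^ 2) * ((∫⁻ a, φ a) * ∫⁻ b, ψ b)) := by rw [this, one_mul]
          _ = _ := by ring

/-- For fixed x and σ the third argument is affine in b with slope 2(1 + σ²)x. Against the weight (1
+ σ²)x² this leaves |x|/2, and |x| is exactly the Jacobian of the slope coordinates. -/
theorem lintegral_conv_opposite_weight_le {h : ℝ × ℝ × ℝ → ENNReal} (hh : Measurable h) :
    ∫⁻ q : ℝ × ℝ × ℝ, (ENNReal.ofReal √(1 + q.1 ^ 2) * (ENNReal.ofReal |q.2.1| *
        h (q.2.1, q.1 * q.2.1, (1 + q.1 ^ 2) * (q.2.1 ^ 2 + 2 * q.2.2 * q.2.1)))) ^ 2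
      ≤ ENNReal.ofReal (1 / 2) * ∫⁻ p, h p ^ 2 := by
  set k : ℝ × ℝ → ENNReal := fun p => ∫⁻ t, h (p.1, p.2, t) ^ 2
  have hk : Measurable k := Measurable.lintegral_prod_right'
    (f := fun z : (ℝ × ℝ) × ℝ => h (z.1.1, z.1.2, z.2) ^ 2) (by fun_prop)
  have h1 : ∫⁻ p, h p ^ 2 = ∫⁻ σ, ∫⁻ x, ENNReal.ofReal |x| * k (x, σ * x) := by
    rw [← lintegral_shear hk, Measure.volume_eq_prod,
      lintegral_prod _ (hh.pow_const 2).aemeasurable]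
    refine lintegral_congr fun x => ?_
    rw [Measure.volume_eq_prod, lintegral_prod _ (by refine Measurable.aemeasurable ?_; fun_prop)]
  have h0 : ∀ᵐ x : ℝ, x ≠ 0 := by
    rw [ae_iff]; simp
  rw [h1, Measure.volume_eq_prod, lintegral_prod _ (by refine Measurable.aemeasurable ?_; fun_prop),
    ← lintegral_const_mul' _ _ ENNReal.ofReal_ne_top]
  refine lintegral_mono fun σ => ?_
  have hw : 0 < 1 + σ ^ 2 := by positivity
  rw [Measure.volume_eq_prod, lintegral_prod _ (by refine Measurable.aemeasurable ?_; fun_prop),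
    ← lintegral_const_mul' _ _ ENNReal.ofReal_ne_top]
  refine (lintegral_congr_ae (h0.mono fun x hx => ?_)).le
  have hx' : 0 < |x| := abs_pos.2 hx
  have hne : 2 * (1 + σ ^ 2) * x ≠ 0 := by positivity
  have h2 := lintegral_comp_mul_add hne ((1 + σ ^ 2) * x ^ 2) (fun t => h (x, σ * x, t) ^ 2)
  simp only [mul_pow]
  rw [lintegral_const_mul' _ _ (by finiteness), lintegral_const_mul' _ _ (by finiteness)]
  have h3 : ∫⁻ b, h (x, σ * x, (1 + σ ^ 2) * (x ^ 2 + 2 * b * x)) ^ 2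
      = ENNReal.ofReal |(2 * (1 + σ ^ 2) * x)⁻¹| * k (x, σ * x) := by
    rw [← h2]
    refine lintegral_congr fun b => ?_
    congr 4; ring
  rw [h3, ← ENNReal.ofReal_pow (Real.sqrt_nonneg _), Real.sq_sqrt hw.le,
    ← ENNReal.ofReal_pow (abs_nonneg _), ← mul_assoc, ← mul_assoc, ← mul_assoc,
    ← ENNReal.ofReal_mul (by positivity), ← ENNReal.ofReal_mul (by positivity),
    ← ENNReal.ofReal_mul (by positivity)]
  congr 2
  rw [abs_inv, abs_mul, abs_of_pos (by positivity : 0 < 2 * (1 + σ ^ 2))]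
  field_simp

/-- After ζ ↦ -ζ and η = z + ζ the phase is |z + ζ|² - |ζ|² = |z|² + 2⟨z, ζ⟩, which does not see the
component of ζ orthogonal to z. In coordinates z = (x, σx), ζ = b(1, σ) + y(-σ, 1) the variable y is
free, and the Jacobian (1 + σ²)|x| is split between a factor `U` holding F, G and a factor `V`
holding h, to be separated by Cauchy–Schwarz. -/
theorem lintegral_conv_sq_le_opposite {F G : Plane → ENNReal} {h : Freq → ENNReal}
    (hF : Measurable F) (hG : Measurable G) (hh : Measurable h) :
    (∫⁻ p : Plane × Plane, F p.1 * G p.2 * h (convPoint 1 (-1) p)) ^ 2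
      ≤ ENNReal.ofReal (Real.pi / 2) *
        ((∫⁻ η, F η ^ 2) * (∫⁻ ζ, G ζ ^ 2) * ∫⁻ x, h x ^ 2) := by
  have hc := (continuous_convPoint 1 (-1)).measurable
  have hP := measurable_toPlane
  set f : ℝ × ℝ → ENNReal := fun p => F !₂[p.1, p.2]
  set g : ℝ × ℝ → ENNReal := fun p => G (-!₂[p.1, p.2])
  set k : ℝ × ℝ × ℝ → ENNReal := fun q => h (!₂[q.1, q.2.1], q.2.2)
  have hf : Measurable f := hF.comp hP
  have hg : Measurable g := hG.comp hP.neg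
  have hk : Measurable k := hh.comp
    ((hP.comp (measurable_fst.prodMk (measurable_fst.comp measurable_snd))).prodMk
      (measurable_snd.comp measurable_snd))
  have hf2 : ∫⁻ η, F η ^ 2 = ∫⁻ p, f p ^ 2 := by
    rw [lintegral_plane (hF.pow_const 2), Measure.volume_eq_prod,
      lintegral_prod _ (hf.pow_const 2).aemeasurable]
  have hg2 : ∫⁻ ζ, G ζ ^ 2 = ∫⁻ p, g p ^ 2 := by
    rw [← lintegral_neg_eq_self (fun ζ => G ζ ^ 2),
      lintegral_plane (f := fun z => G (-z) ^ 2) (by fun_prop), Measure.volume_eq_prod,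
      lintegral_prod _ (hg.pow_const 2).aemeasurable]
  have hh2 : ∫⁻ x, h x ^ 2 = ∫⁻ q, k q ^ 2 := by
    rw [Measure.volume_eq_prod, lintegral_prod _ (hh.pow_const 2).aemeasurable,
      lintegral_plane (Measurable.lintegral_prod_right' (hh.pow_const 2)),
      Measure.volume_eq_prod, lintegral_prod _ (hk.pow_const 2).aemeasurable]
    refine lintegral_congr fun x => ?_
    rw [Measure.volume_eq_prod, lintegral_prod _ (by refine Measurable.aemeasurable ?_; fun_prop)]
  set U : ℝ × ℝ × ℝ → ENNReal := fun q => ENNReal.ofReal √(1 + q.1 ^ 2) *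
        ∫⁻ y, f (q.2.2 + q.2.1 - q.1 * y, q.1 * (q.2.2 + q.2.1) + y) *
          g (q.2.2 - q.1 * y, q.1 * q.2.2 + y)
  set V : ℝ × ℝ × ℝ → ENNReal := fun q => ENNReal.ofReal √(1 + q.1 ^ 2) * (ENNReal.ofReal |q.2.1| *
        k (q.2.1, q.1 * q.2.1, (1 + q.1 ^ 2) * (q.2.1 ^ 2 + 2 * q.2.2 * q.2.1)))
  have hU : Measurable U := by
    refine Measurable.mul (by fun_prop) ?_
    exact Measurable.lintegral_prod_right' (f := fun z : (ℝ × ℝ × ℝ) × ℝ =>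
      f (z.1.2.2 + z.1.2.1 - z.1.1 * z.2, z.1.1 * (z.1.2.2 + z.1.2.1) + z.2) *
          g (z.1.2.2 - z.1.1 * z.2, z.1.1 * z.1.2.2 + z.2)) (by fun_prop)
  have hV : Measurable V := by fun_prop
  set J : Plane × Plane → ENNReal := fun p =>
    F (p.1 + p.2) * G (-p.2) * h (p.1, ‖p.1 + p.2‖ ^ 2 - ‖p.2‖ ^ 2)
  have hJ : Measurable J := by fun_prop
  have e1 : ∫⁻ p : Plane × Plane, F p.1 * G p.2 * h (convPoint 1 (-1) p)
      = ∫⁻ z, ∫⁻ ζ, J (z, ζ) := by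
    rw [Measure.volume_eq_prod, lintegral_prod_symm _
      (by refine Measurable.aemeasurable ?_; fun_prop), ← lintegral_neg_eq_self,
      lintegral_lintegral_swap (f := fun z ζ => J (z, ζ)) hJ.aemeasurable]
    refine lintegral_congr fun ζ => ?_
    rw [← lintegral_add_right_eq_self (μ := volume) _ ζ]
    refine lintegral_congr fun z => ?_
    simp only [J, convPoint_eq]
    congr 2
    ext1
    · simp
    · simp; ring
  have e2 : ∫⁻ z, ∫⁻ ζ, J (z, ζ) = ∫⁻ q, U q * V q := by
    rw [lintegral_plane (Measurable.lintegral_prod_right' hJ),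
      lintegral_shear (f := fun p : ℝ × ℝ => ∫⁻ ζ, J (!₂[p.1, p.2], ζ))
        ((Measurable.lintegral_prod_right' hJ).comp hP), Measure.volume_eq_prod,
      lintegral_prod (fun q => U q * V q) (hU.mul hV).aemeasurable]
    refine lintegral_congr fun σ => ?_
    rw [Measure.volume_eq_prod, lintegral_prod _ (by refine Measurable.aemeasurable ?_; fun_prop)]
    refine lintegral_congr fun x => ?_
    have hw : 0 < 1 + σ ^ 2 := by positivity
    rw [lintegral_plane (f := fun ζ => J (!₂[x, σ * x], ζ)) (by fun_prop),
      lintegral_rotated_coordinates σ (f := fun p => J (!₂[x, σ * x], !₂[p.1, p.2]))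
        (hJ.comp (measurable_const.prodMk hP)), ← mul_assoc,
      ← lintegral_const_mul' _ _ (by finiteness)]
    refine lintegral_congr fun b => ?_
    have e3 : ∀ y, J (!₂[x, σ * x], !₂[b - σ * y, σ * b + y])
        = k (x, σ * x, (1 + σ ^ 2) * (x ^ 2 + 2 * b * x)) *
          (f (b + x - σ * y, σ * (b + x) + y) * g (b - σ * y, σ * b + y)) := fun y => by
      have es : (!₂[x, σ * x] : Plane) + !₂[b - σ * y, σ * b + y]
          = !₂[b + x - σ * y, σ * (b + x) + y] := by
        ext i; fin_cases i <;> simp <;> ring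
      simp only [J, f, g, k]
      rw [es, mul_comm]
      congr 3
      simp only [norm_sq_plane, Matrix.cons_val_zero, Matrix.cons_val_one]
      ring
    simp only [e3, U, V]
    rw [lintegral_const_mul _ (f := fun y : ℝ =>
      f (b + x - σ * y, σ * (b + x) + y) * g (b - σ * y, σ * b + y)) (by fun_prop)]
    have : ENNReal.ofReal (1 + σ ^ 2)
        = ENNReal.ofReal √(1 + σ ^ 2) * ENNReal.ofReal √(1 + σ ^ 2) := by
      rw [← ENNReal.ofReal_mul (Real.sqrt_nonneg _), Real.mul_self_sqrt hw.le]
    rw [this]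
    ring
  rw [e1, e2, hf2, hg2, hh2]
  refine (lintegral_mul_sq_le volume hU hV).trans ?_
  refine (mul_le_mul' (lintegral_conv_opposite_fiber_le hf hg)
    (lintegral_conv_opposite_weight_le hk)).trans (le_of_eq ?_)
  rw [show Real.pi / 2 = Real.pi * (1 / 2) by ring, ENNReal.ofReal_mul Real.pi_pos.le]
  ring

theorem lintegral_conv_sq_le {s₁ s₂ X Y : ℝ} (h₁ : s₁ = 1 ∨ s₁ = -1) (h₂ : s₂ = 1 ∨ s₂ = -1)
    (h₁₂ : ¬ (s₁ = -1 ∧ s₂ = -1)) (hX : 0 < X) (hY : 0 < Y)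
    {F G : Plane → ENNReal} {h : Freq → ENNReal}
    (hF : Measurable F) (hG : Measurable G) (hh : Measurable h)
    (hFs : ∀ η, F η ≠ 0 → X / 2 ≤ ‖η‖ ∧ ‖η‖ ≤ 2 * X)
    (hGs : ∀ ζ, G ζ ≠ 0 → Y / 2 ≤ ‖ζ‖ ∧ ‖ζ‖ ≤ 2 * Y) :
    (∫⁻ p : Plane × Plane, F p.1 * G p.2 * h (convPoint s₁ s₂ p)) ^ 2
      ≤ ENNReal.ofReal (64 * (min X Y / max X Y)) *
        ((∫⁻ η, F η ^ 2) * (∫⁻ ζ, G ζ ^ 2) * ∫⁻ x, h x ^ 2) := by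
  rcases le_or_gt (8 * X) Y with hXY | hXY
  · rw [min_eq_left (by linarith), max_eq_right (by linarith), ← mul_div_assoc]
    exact lintegral_conv_sq_le_separated h₁ h₂ hX hXY hF hG hh (fun η hη => (hFs η hη).2)
      fun ζ hζ => (hGs ζ hζ).1
  rcases le_or_gt (8 * Y) X with hYX | hYX
  · rw [min_eq_right (by linarith), max_eq_left (by linarith), ← mul_div_assoc,
      lintegral_conv_swap, mul_comm (∫⁻ η, F η ^ 2)]
    exact lintegral_conv_sq_le_separated h₂ h₁ hY hYX hG hF hh (fun η hη => (hGs η hη).2)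
      fun ζ hζ => (hFs ζ hζ).1
  -- In the comparable regime min/max ≥ 1/8, so the constant 64 · min/max is at least 8 and absorbs
  -- π/2.
  have hmM : Real.pi / 2 ≤ 64 * (min X Y / max X Y) := by
    have : 1 / 8 ≤ min X Y / max X Y := by
      rw [div_le_div_iff₀ (by norm_num) (lt_max_of_lt_left hX)]
      rcases le_total X Y with h | h
      · rw [min_eq_left h, max_eq_right h]; linarith
      · rw [min_eq_right h, max_eq_left h]; linarith
    linarith [Real.pi_le_four]
  have key : (∫⁻ p : Plane × Plane, F p.1 * G p.2 * h (convPoint s₁ s₂ p)) ^ 2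
      ≤ ENNReal.ofReal (Real.pi / 2) *
        ((∫⁻ η, F η ^ 2) * (∫⁻ ζ, G ζ ^ 2) * ∫⁻ x, h x ^ 2) := by
    rcases h₁ with rfl | rfl <;> rcases h₂ with rfl | rfl
    · exact lintegral_conv_sq_le_same hF hG hh
    · exact lintegral_conv_sq_le_opposite hF hG hh
    · rw [lintegral_conv_swap, mul_comm (∫⁻ η, F η ^ 2)]
      exact lintegral_conv_sq_le_opposite hG hF hh
    · exact absurd ⟨rfl, rfl⟩ h₁₂
  refine key.trans ?_
  gcongr

/-! ### Densities in `L²` by duality -/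

theorem eLpNorm_two_sq {α E : Type*} [MeasurableSpace α] [NormedAddCommGroup E] (f : α → E)
    (μ : Measure α) : eLpNorm f 2 μ ^ 2 = ∫⁻ a, ‖f a‖ₑ ^ 2 ∂μ := by
  rw [eLpNorm_eq_lintegral_rpow_enorm_toReal (by norm_num) (by norm_num), ← ENNReal.rpow_two,
    ← ENNReal.rpow_mul]
  simp

/-- This is the Riesz representation; the representative is conjugated because the pairing ∫ l h is
bilinear rather than sesquilinear. -/
theorem exists_L2_density_of_linearMap {α : Type*} [MeasurableSpace α] {ν : Measure α}
    (T : Lp ℂ 2 ν →L[ℂ] ℂ) {K : ℝ} (hK : ‖T‖ ≤ K) :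
    ∃ l : α → ℂ, MemLp l 2 ν ∧ eLpNorm l 2 ν ≤ ENNReal.ofReal K ∧
      ∀ h : Lp ℂ 2 ν, T h = ∫ x, l x * h x ∂ν := by
  set g : Lp ℂ 2 ν := (InnerProductSpace.toDual ℂ (Lp ℂ 2 ν)).symm T
  have hg : ∀ h : Lp ℂ 2 ν, T h = inner ℂ g h := fun h => by
    simp [g, InnerProductSpace.toDual_symm_apply]
  have hgK : ‖g‖ ≤ K := by simpa [g] using hK
  refine ⟨fun x => (starRingEnd ℂ) (g x), ?_, ?_, fun h => ?_⟩
  · exact (memLp_congr_norm (by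
      exact Complex.continuous_conj.comp_aestronglyMeasurable (Lp.aestronglyMeasurable g))
      (Lp.aestronglyMeasurable g) (ae_of_all _ fun x => by simp)).2 (Lp.memLp g)
  · have : eLpNorm (fun x => (starRingEnd ℂ) (g x)) 2 ν = eLpNorm g 2 ν :=
      eLpNorm_congr_norm_ae (ae_of_all _ fun x => by simp)
    rw [this, ← ENNReal.ofReal_toReal (Lp.memLp g).eLpNorm_lt_top.ne, ← Lp.norm_def]
    exact ENNReal.ofReal_le_ofReal hgK
  · rw [hg, L2.inner_def]
    refine integral_congr_ae (ae_of_all _ fun x => ?_)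
    simp [mul_comm]

section Pushforward

variable {α Z : Type*} [MeasurableSpace α] [MeasurableSpace Z] {ν : Measure α} {κ : Measure Z}
  {W : Z → ℂ} {Φ : Z → α} {K : ℝ}

/-- Applied to the indicator of a ν-null set, the bound shows that the image of |W| κ under Φ does
not charge it. Hence the pairing is well defined on classes of functions modulo ν-null sets, which
is the absolute continuity of the convolution. -/
theorem ae_mul_comp_congr_of_lintegral_bound (hW : Measurable W) (hΦ : Measurable Φ)
    (hK : ∀ h : α → ENNReal, Measurable h →
      (∫⁻ z, ‖W z‖ₑ * h (Φ z) ∂κ) ^ 2 ≤ ENNReal.ofReal (K ^ 2) * ∫⁻ x, h x ^ 2 ∂ν)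
    {h h' : α → ℂ} (hh : h =ᵐ[ν] h') :
    (fun z => W z * h (Φ z)) =ᵐ[κ] fun z => W z * h' (Φ z) := by
  obtain ⟨N, hN, hNm, hN0⟩ := exists_measurable_superset_of_null (ae_iff.1 hh)
  have h0 : (∫⁻ z, ‖W z‖ₑ * N.indicator 1 (Φ z) ∂κ) = 0 := by
    have := hK (N.indicator 1) (measurable_one.indicator hNm)
    have e : ∫⁻ x, N.indicator (1 : α → ENNReal) x ^ 2 ∂ν = 0 := by
      have : ∀ x, N.indicator (1 : α → ENNReal) x ^ 2 = N.indicator 1 x := fun x => by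
        by_cases hx : x ∈ N <;> simp [hx]
      simp only [this]
      rw [lintegral_indicator_one hNm, hN0]
    rw [e, mul_zero] at this
    simpa using this
  have hm : Measurable fun z => ‖W z‖ₑ * N.indicator (1 : α → ENNReal) (Φ z) :=
    hW.enorm.mul ((measurable_one.indicator hNm).comp hΦ)
  rw [lintegral_eq_zero_iff hm] at h0
  filter_upwards [h0] with z hz
  by_cases hzN : Φ z ∈ N
  · have : W z = 0 := by simpa [hzN] using hz
    simp [this]
  · have : h (Φ z) = h' (Φ z) := by
      by_contra hne
      exact hzN (hN hne)
    rw [this]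

theorem integrable_mul_comp_of_lintegral_bound (hW : Measurable W) (hΦ : Measurable Φ)
    (hK0 : 0 ≤ K) (hK : ∀ h : α → ENNReal, Measurable h →
      (∫⁻ z, ‖W z‖ₑ * h (Φ z) ∂κ) ^ 2 ≤ ENNReal.ofReal (K ^ 2) * ∫⁻ x, h x ^ 2 ∂ν)
    {h : α → ℂ} (hh : MemLp h 2 ν) :
    Integrable (fun z => W z * h (Φ z)) κ ∧
      ‖∫ z, W z * h (Φ z) ∂κ‖ ≤ K * (eLpNorm h 2 ν).toReal := by
  set h' := hh.1.mk h
  have hh' : h =ᵐ[ν] h' := hh.1.ae_eq_mk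
  have hm' : Measurable h' := hh.1.measurable_mk
  have hae := ae_mul_comp_congr_of_lintegral_bound hW hΦ hK hh'
  have hb : ∫⁻ z, ‖W z * h' (Φ z)‖ₑ ∂κ ≤ ENNReal.ofReal K * eLpNorm h 2 ν := by
    have := hK (fun x => ‖h' x‖ₑ) hm'.enorm
    rw [← eLpNorm_two_sq, ENNReal.ofReal_pow hK0, ← mul_pow,
      ENNReal.pow_le_pow_left_iff two_ne_zero] at this
    simp only [enorm_mul]
    rwa [eLpNorm_congr_ae hh']
  have hfin : ENNReal.ofReal K * eLpNorm h 2 ν ≠ ⊤ :=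
    ENNReal.mul_ne_top ENNReal.ofReal_ne_top hh.eLpNorm_lt_top.ne
  have hint : Integrable (fun z => W z * h' (Φ z)) κ :=
    ⟨(hW.mul (hm'.comp hΦ)).aestronglyMeasurable, lt_of_le_of_lt hb hfin.lt_top⟩
  refine ⟨hint.congr hae.symm, ?_⟩
  rw [integral_congr_ae hae]
  refine (norm_integral_le_lintegral_norm _).trans ?_
  simp only [ofReal_norm]
  refine (ENNReal.toReal_mono hfin hb).trans (le_of_eq ?_)
  rw [ENNReal.toReal_mul, ENNReal.toReal_ofReal hK0]

theorem exists_L2_density_of_lintegral_bound (hW : Measurable W) (hΦ : Measurable Φ)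
    (hK0 : 0 ≤ K) (hK : ∀ h : α → ENNReal, Measurable h →
      (∫⁻ z, ‖W z‖ₑ * h (Φ z) ∂κ) ^ 2 ≤ ENNReal.ofReal (K ^ 2) * ∫⁻ x, h x ^ 2 ∂ν) :
    ∃ l : α → ℂ, MemLp l 2 ν ∧ eLpNorm l 2 ν ≤ ENNReal.ofReal K ∧
      ∀ h : α → ℂ, MemLp h 2 ν → ∫ z, W z * h (Φ z) ∂κ = ∫ x, l x * h x ∂ν := by
  have hint := fun (h : α → ℂ) (hh : MemLp h 2 ν) =>
    integrable_mul_comp_of_lintegral_bound hW hΦ hK0 hK hh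
  have hcongr := fun (h h' : α → ℂ) (hh : h =ᵐ[ν] h') =>
    integral_congr_ae (ae_mul_comp_congr_of_lintegral_bound hW hΦ hK hh)
  let T₀ : Lp ℂ 2 ν →ₗ[ℂ] ℂ :=
    { toFun := fun h => ∫ z, W z * h (Φ z) ∂κ
      map_add' := fun h₁ h₂ => by
        rw [hcongr _ _ (Lp.coeFn_add h₁ h₂), ← integral_add (hint _ (Lp.memLp h₁)).1
          (hint _ (Lp.memLp h₂)).1]
        simp only [Pi.add_apply, mul_add]
      map_smul' := fun c h => by
        rw [hcongr _ _ (Lp.coeFn_smul c h), RingHom.id_apply, smul_eq_mul, ← integral_const_mul]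
        refine integral_congr_ae (ae_of_all _ fun z => ?_)
        simp only [Pi.smul_apply, smul_eq_mul]; ring }
  have hT₀ : ∀ h, ‖T₀ h‖ ≤ K * ‖h‖ := fun h => by
    rw [Lp.norm_def]; exact (hint _ (Lp.memLp h)).2
  obtain ⟨l, hl, hlK, hT⟩ := exists_L2_density_of_linearMap (T₀.mkContinuous K hT₀)
    (T₀.mkContinuous_norm_le hK0 hT₀)
  refine ⟨l, hl, hlK, fun h hh => ?_⟩
  rw [hcongr _ _ (MemLp.coeFn_toLp hh).symm]
  refine (hT (hh.toLp h)).trans (integral_congr_ae ?_)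
  filter_upwards [MemLp.coeFn_toLp hh] with x hx
  rw [hx]

end Pushforward

/-! ### Measures on paraboloids in the coordinate `ξ` -/

/-- The density of the surface measure of the paraboloid in the coordinate `ξ`. -/
noncomputable def surfWeight (ξ : Plane) : ℝ := Real.sqrt (1 + 4 * ‖ξ‖ ^ 2)

theorem surfWeight_pos (ξ : Plane) : 0 < surfWeight ξ := Real.sqrt_pos.2 (by positivity)

theorem continuous_surfWeight : Continuous surfWeight := by unfold surfWeight; fun_prop

theorem surfWeight_le {ξ : Plane} {X : ℝ} (hX : 1 ≤ X) (hξ : ‖ξ‖ ≤ 2 * X) :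
    surfWeight ξ ≤ 5 * X := by
  refine Real.sqrt_le_iff.2 ⟨by positivity, ?_⟩
  nlinarith [norm_nonneg ξ]

theorem measurableEmbedding_parabPoint (s c : ℝ) : MeasurableEmbedding (parabPoint s c) := by
  refine (continuous_parabPoint s c).measurableEmbedding fun ξ η h => ?_
  exact congrArg Prod.fst h

theorem measurable_surfDensity :
    Measurable fun ξ : Plane => ENNReal.ofReal (Real.sqrt (1 + 4 * ‖ξ‖ ^ 2)) := by fun_prop

theorem lintegral_parabMeasure (s c : ℝ) (f : Freq → ENNReal) :
    ∫⁻ x, f x ∂(parabMeasure s c)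
      = ∫⁻ ξ, ENNReal.ofReal (surfWeight ξ) * f (parabPoint s c ξ) := by
  rw [parabMeasure, (measurableEmbedding_parabPoint s c).lintegral_map,
    lintegral_withDensity_eq_lintegral_mul_non_measurable _ measurable_surfDensity
      (ae_of_all _ fun _ => ENNReal.ofReal_lt_top)]
  rfl

theorem integral_parabMeasure (s c : ℝ) (f : Freq → ℂ) :
    ∫ x, f x ∂(parabMeasure s c) = ∫ ξ, (surfWeight ξ : ℂ) * f (parabPoint s c ξ) := by
  rw [parabMeasure, (measurableEmbedding_parabPoint s c).integral_map,
    integral_withDensity_eq_integral_toReal_smul measurable_surfDensity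
      (ae_of_all _ fun _ => ENNReal.ofReal_lt_top)]
  refine integral_congr_ae (ae_of_all _ fun ξ => ?_)
  simp only [ENNReal.toReal_ofReal (Real.sqrt_nonneg _), Complex.real_smul]
  rfl

theorem ae_parabMeasure_iff (s c : ℝ) {p : Freq → Prop} :
    (∀ᵐ x ∂(parabMeasure s c), p x) ↔ ∀ᵐ ξ, p (parabPoint s c ξ) := by
  rw [parabMeasure, (measurableEmbedding_parabPoint s c).ae_map_iff,
    ae_withDensity_iff measurable_surfDensity]
  have : ∀ ξ : Plane, ENNReal.ofReal (Real.sqrt (1 + 4 * ‖ξ‖ ^ 2)) ≠ 0 := fun ξ =>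
    (ENNReal.ofReal_pos.2 (surfWeight_pos ξ)).ne'
  simp [this]

theorem aestronglyMeasurable_comp_parabPoint {s c : ℝ} {f : Freq → ℂ}
    (hf : AEStronglyMeasurable f (parabMeasure s c)) :
    AEStronglyMeasurable (fun ξ => f (parabPoint s c ξ)) volume := by
  rw [parabMeasure, (measurableEmbedding_parabPoint s c).aestronglyMeasurable_map_iff] at hf
  refine AEStronglyMeasurable.mono_ac ?_ hf
  exact withDensity_absolutelyContinuous' measurable_surfDensity.aemeasurable
    (ae_of_all _ fun ξ => (ENNReal.ofReal_pos.2 (surfWeight_pos ξ)).ne')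

theorem convPairing_parabMeasure (s₁ s₂ : ℝ) (f g h : Freq → ℂ) {F G : Plane → ℂ}
    (hF : F =ᵐ[volume] fun η => (surfWeight η : ℂ) * f (parabPoint s₁ 0 η))
    (hG : G =ᵐ[volume] fun η => (surfWeight η : ℂ) * g (parabPoint s₂ 0 η)) :
    convPairing (parabMeasure s₁ 0) (parabMeasure s₂ 0) f g h
      = ∫ p : Plane × Plane, F p.1 * G p.2 * h (convPoint s₁ s₂ p) := by
  have e1 := (measurableEmbedding_parabPoint s₁ 0).prodMap (measurableEmbedding_parabPoint s₂ 0)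
  have hm : Measurable fun p : Plane × Plane => ENNReal.ofReal (Real.sqrt (1 + 4 * ‖p.1‖ ^ 2)) *
      ENNReal.ofReal (Real.sqrt (1 + 4 * ‖p.2‖ ^ 2)) := by fun_prop
  rw [convPairing, parabMeasure, parabMeasure, Measure.map_prod_map _ _
    (measurableEmbedding_parabPoint s₁ 0).measurable (measurableEmbedding_parabPoint s₂ 0).measurable,
    e1.integral_map, prod_withDensity measurable_surfDensity measurable_surfDensity,
    integral_withDensity_eq_integral_toReal_smul hm
      (ae_of_all _ fun _ => ENNReal.mul_lt_top ENNReal.ofReal_lt_top ENNReal.ofReal_lt_top),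
    ← Measure.volume_eq_prod]
  have hF' := Measure.quasiMeasurePreserving_fst (μ := (volume : Measure Plane))
    (ν := (volume : Measure Plane)) |>.ae_eq_comp hF
  have hG' := Measure.quasiMeasurePreserving_snd (μ := (volume : Measure Plane))
    (ν := (volume : Measure Plane)) |>.ae_eq_comp hG
  refine integral_congr_ae ?_
  filter_upwards [hF', hG'] with p h1 h2
  simp only [Function.comp_apply] at h1 h2
  rw [h1, h2, ENNReal.toReal_mul, ENNReal.toReal_ofReal (Real.sqrt_nonneg _),
    ENNReal.toReal_ofReal (Real.sqrt_nonneg _), Complex.real_smul]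
  simp only [Prod.map, convPoint, surfWeight]
  push_cast
  ring

/-- The function F may carry one power of the surface weight, so |F|² carries two, while the surface
measure supplies only one. The spare power is at most 5X on the support. -/
theorem eLpNorm_le_parabMeasure {s c X : ℝ} (hX : 1 ≤ X) {f : Freq → ℂ} {F : Plane → ℂ}
    (hF : ∀ η, F η ≠ 0 → ‖η‖ ≤ 2 * X)
    (hle : ∀ᵐ η, ‖F η‖ ≤ surfWeight η * ‖f (parabPoint s c η)‖) :
    eLpNorm F 2 volume ≤ ENNReal.ofReal √(5 * X) * eLpNorm f 2 (parabMeasure s c) := by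
  rw [← ENNReal.pow_le_pow_left_iff two_ne_zero, mul_pow, eLpNorm_two_sq, eLpNorm_two_sq,
    lintegral_parabMeasure, ← ENNReal.ofReal_pow (Real.sqrt_nonneg _),
    Real.sq_sqrt (by positivity), ← lintegral_const_mul' _ _ ENNReal.ofReal_ne_top]
  refine lintegral_mono_ae ?_
  filter_upwards [hle] with η h1
  by_cases hη : F η = 0
  · simp [hη]
  have h2 : ‖F η‖ₑ ≤ ENNReal.ofReal (surfWeight η) * ‖f (parabPoint s c η)‖ₑ := by
    rw [← ofReal_norm, ← ofReal_norm, ← ENNReal.ofReal_mul (surfWeight_pos η).le]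
    exact ENNReal.ofReal_le_ofReal h1
  refine (pow_le_pow_left' h2 2).trans ?_
  rw [mul_pow, ← mul_assoc]
  refine mul_le_mul' ?_ le_rfl
  rw [sq]
  exact mul_le_mul' (ENNReal.ofReal_le_ofReal (surfWeight_le hX (hF η hη))) le_rfl

theorem exists_planeDensity {s X : ℝ} (hX : 1 ≤ X) {f : Freq → ℂ}
    (hf : MemLp f 2 (parabMeasure s 0))
    (hloc : ∀ᵐ x ∂(parabMeasure s 0), f x ≠ 0 → X / 2 ≤ ‖x.1‖ ∧ ‖x.1‖ ≤ 2 * X) :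
    ∃ F : Plane → ℂ, Measurable F ∧ MemLp F 2 volume ∧
      (∀ η, F η ≠ 0 → X / 2 ≤ ‖η‖ ∧ ‖η‖ ≤ 2 * X) ∧
      eLpNorm F 2 volume ≤ ENNReal.ofReal √(5 * X) * eLpNorm f 2 (parabMeasure s 0) ∧
      F =ᵐ[volume] fun η => (surfWeight η : ℂ) * f (parabPoint s 0 η) := by
  have hm := aestronglyMeasurable_comp_parabPoint hf.1
  have hm' : AEStronglyMeasurable (fun η => (surfWeight η : ℂ) * f (parabPoint s 0 η)) volume :=
    (Complex.continuous_ofReal.comp continuous_surfWeight).aestronglyMeasurable.mul hm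
  set A : Set Plane := {η | X / 2 ≤ ‖η‖ ∧ ‖η‖ ≤ 2 * X}
  have hA : MeasurableSet A := by
    have a1 : MeasurableSet {η : Plane | X / 2 ≤ ‖η‖} :=
      measurableSet_le measurable_const (by fun_prop)
    have a2 : MeasurableSet {η : Plane | ‖η‖ ≤ 2 * X} :=
      measurableSet_le (by fun_prop) measurable_const
    exact a1.inter a2
  -- A measurable representative, truncated so that the annulus condition holds at every point and
  -- not only almost everywhere.
  set F : Plane → ℂ := A.indicator (hm'.mk _)
  have hFm : Measurable F := hm'.measurable_mk.indicator hA
  have hsupp : ∀ η, F η ≠ 0 → X / 2 ≤ ‖η‖ ∧ ‖η‖ ≤ 2 * X := fun η hη => by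
    by_contra h
    exact hη (Set.indicator_of_notMem (s := A) (by exact h) _)
  have hae : F =ᵐ[volume] fun η => (surfWeight η : ℂ) * f (parabPoint s 0 η) := by
    filter_upwards [hm'.ae_eq_mk, (ae_parabMeasure_iff s 0).1 hloc] with η h1 h2
    by_cases hη : η ∈ A
    · rw [h1]; exact Set.indicator_of_mem hη _
    · have : f (parabPoint s 0 η) = 0 := by
        by_contra h; exact hη (h2 h)
      rw [this, mul_zero]
      exact Set.indicator_of_notMem hη _
  have hnorm : eLpNorm F 2 volume ≤ ENNReal.ofReal √(5 * X) * eLpNorm f 2 (parabMeasure s 0) := by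
    refine eLpNorm_le_parabMeasure hX (fun η hη => (hsupp η hη).2) ?_
    filter_upwards [hae] with η h1
    rw [h1, norm_mul, Complex.norm_real, Real.norm_of_nonneg (surfWeight_pos η).le]
  refine ⟨F, hFm, ⟨hFm.aestronglyMeasurable, hnorm.trans_lt ?_⟩, hsupp, hnorm, hae⟩
  exact ENNReal.mul_lt_top ENNReal.ofReal_lt_top hf.eLpNorm_lt_top

theorem exists_conv_density {s₁ s₂ X Y : ℝ} (h₁ : s₁ = 1 ∨ s₁ = -1) (h₂ : s₂ = 1 ∨ s₂ = -1)
    (h₁₂ : ¬ (s₁ = -1 ∧ s₂ = -1)) (hX : 0 < X) (hY : 0 < Y) {F G : Plane → ℂ}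
    (hF : Measurable F) (hG : Measurable G) (hF2 : MemLp F 2 volume) (hG2 : MemLp G 2 volume)
    (hFs : ∀ η, F η ≠ 0 → X / 2 ≤ ‖η‖ ∧ ‖η‖ ≤ 2 * X)
    (hGs : ∀ ζ, G ζ ≠ 0 → Y / 2 ≤ ‖ζ‖ ∧ ‖ζ‖ ≤ 2 * Y) :
    ∃ l : Freq → ℂ, MemLp l 2 volume ∧
      eLpNorm l 2 volume ≤ ENNReal.ofReal (8 * √(min X Y / max X Y)) *
        (eLpNorm F 2 volume * eLpNorm G 2 volume) ∧
      ∀ h : Freq → ℂ, MemLp h 2 volume →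
        ∫ p : Plane × Plane, F p.1 * G p.2 * h (convPoint s₁ s₂ p) = ∫ x, l x * h x := by
  set N := (eLpNorm F 2 volume * eLpNorm G 2 volume).toReal
  have hN : ENNReal.ofReal N = eLpNorm F 2 volume * eLpNorm G 2 volume :=
    ENNReal.ofReal_toReal (ENNReal.mul_ne_top hF2.eLpNorm_lt_top.ne hG2.eLpNorm_lt_top.ne)
  have hr : 0 ≤ min X Y / max X Y := by positivity
  obtain ⟨l, hl, hlK, hlh⟩ := exists_L2_density_of_lintegral_bound
    (κ := (volume : Measure (Plane × Plane))) (ν := (volume : Measure Freq))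
    (W := fun p => F p.1 * G p.2) (Φ := convPoint s₁ s₂) (K := 8 * √(min X Y / max X Y) * N)
    (by fun_prop) (continuous_convPoint s₁ s₂).measurable (by positivity) (fun h hh => by
      have := lintegral_conv_sq_le h₁ h₂ h₁₂ hX hY hF.enorm hG.enorm hh
        (fun η hη => hFs η (by simpa using hη)) (fun η hη => hGs η (by simpa using hη))
      simp only [enorm_mul]
      refine this.trans (le_of_eq ?_)
      rw [← eLpNorm_two_sq, ← eLpNorm_two_sq, ← mul_pow, ← hN, mul_pow, mul_pow,
        Real.sq_sqrt hr, ← ENNReal.ofReal_pow (by positivity), ← mul_assoc,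
        ← ENNReal.ofReal_mul (by positivity)]
      norm_num)
  refine ⟨l, hl, hlK.trans (le_of_eq ?_), hlh⟩
  rw [ENNReal.ofReal_mul (by positivity), hN]

theorem isConvDensity_of_planeDensity {s₁ s₂ : ℝ} {f g l : Freq → ℂ} {F G : Plane → ℂ}
    (hF : F =ᵐ[volume] fun η => (surfWeight η : ℂ) * f (parabPoint s₁ 0 η))
    (hG : G =ᵐ[volume] fun η => (surfWeight η : ℂ) * g (parabPoint s₂ 0 η))
    (hl : MemLp l 2 volume) (hlh : ∀ h : Freq → ℂ, MemLp h 2 volume →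
        ∫ p : Plane × Plane, F p.1 * G p.2 * h (convPoint s₁ s₂ p) = ∫ x, l x * h x) :
    IsConvDensity (parabMeasure s₁ 0) (parabMeasure s₂ 0) f g l := by
  refine ⟨hl.locallyIntegrable (by norm_num), fun h hc hs => ?_⟩
  rw [convPairing_parabMeasure s₁ s₂ f g h hF hG]
  exact hlh h (hc.memLp_of_hasCompactSupport hs)

theorem two_pow_min (i j : ℕ) : min ((2 : ℝ) ^ i) (2 ^ j) = 2 ^ min i j :=
  ((pow_right_mono₀ (by norm_num : (1 : ℝ) ≤ 2)).map_min).symm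

theorem two_pow_max (i j : ℕ) : max ((2 : ℝ) ^ i) (2 ^ j) = 2 ^ max i j :=
  ((pow_right_mono₀ (by norm_num : (1 : ℝ) ≤ 2)).map_max).symm

theorem conv_global_estimate :
    ∃ C : ℝ, 0 < C ∧
      ∀ (i j : ℕ) (s₁ s₂ : ℝ),
        (s₁ = 1 ∨ s₁ = -1) → (s₂ = 1 ∨ s₂ = -1) → ¬ (s₁ = -1 ∧ s₂ = -1) →
      ∀ f g : Freq → ℂ,
        MemLp f 2 (parabMeasure s₁ 0) → MemLp g 2 (parabMeasure s₂ 0) →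
        LocalizedAt (parabMeasure s₁ 0) i f → LocalizedAt (parabMeasure s₂ 0) j g →
      ∃ l : Freq → ℂ,
        IsConvDensity (parabMeasure s₁ 0) (parabMeasure s₂ 0) f g l ∧
        MemLp l 2 volume ∧
        eLpNorm l 2 volume ≤
          ENNReal.ofReal (C * (2 : ℝ) ^ (min i j)) *
            eLpNorm f 2 (parabMeasure s₁ 0) * eLpNorm g 2 (parabMeasure s₂ 0) := by
  -- 40 = 8 · 5: the factor 8√(min/max) comes from the plane estimate, and √(5X) √(5Y) = 5√(min ·
  -- max) from the weights.
  refine ⟨40, by norm_num, fun i j s₁ s₂ h₁ h₂ h₁₂ f g hf hg hfl hgl => ?_⟩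
  have hX : (1 : ℝ) ≤ 2 ^ i := one_le_pow₀ (by norm_num)
  have hY : (1 : ℝ) ≤ 2 ^ j := one_le_pow₀ (by norm_num)
  obtain ⟨F, hFm, hF2, hFs, hFn, hFae⟩ := exists_planeDensity hX hf hfl
  obtain ⟨G, hGm, hG2, hGs, hGn, hGae⟩ := exists_planeDensity hY hg hgl
  obtain ⟨l, hl, hln, hlh⟩ := exists_conv_density h₁ h₂ h₁₂ (by positivity) (by positivity)
    hFm hGm hF2 hG2 hFs hGs
  refine ⟨l, isConvDensity_of_planeDensity hFae hGae hl hlh, hl, hln.trans ?_⟩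
  refine (mul_le_mul' le_rfl (mul_le_mul' hFn hGn)).trans (le_of_eq ?_)
  set X : ℝ := 2 ^ i
  set Y : ℝ := 2 ^ j
  have hc : 8 * √(min X Y / max X Y) * (√(5 * X) * √(5 * Y)) = 40 * min X Y := by
    rw [← Real.sqrt_mul (by positivity), mul_assoc, ← Real.sqrt_mul (by positivity)]
    have : min X Y / max X Y * (5 * X * (5 * Y)) = (5 * min X Y) ^ 2 := by
      have h1 : 5 * X * (5 * Y) = 25 * (min X Y * max X Y) := by rw [min_mul_max]; ring
      have : max X Y ≠ 0 := by positivity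
      rw [h1]; field_simp; norm_num
    rw [this, Real.sqrt_sq (by positivity)]
    ring
  rw [← two_pow_min, ← hc, ENNReal.ofReal_mul (p := 8 * √(min X Y / max X Y)) (by positivity),
    ENNReal.ofReal_mul (p := √(5 * X)) (by positivity)]
  ring

/-! ### Rotations and the pointwise angular bound -/

/-- The rotation of the plane by the angle `α`, as a linear map. -/
noncomputable def planeRotLin (α : ℝ) : Plane →ₗ[ℝ] Plane where
  toFun η := !₂[Real.cos α * η 0 - Real.sin α * η 1, Real.sin α * η 0 + Real.cos α * η 1]
  map_add' x y := by ext i; fin_cases i <;> simp <;> ring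
  map_smul' c x := by ext i; fin_cases i <;> simp <;> ring

/-- The rotation of the plane by the angle `α`. -/
noncomputable def planeRot (α : ℝ) : Plane ≃ₗᵢ[ℝ] Plane :=
  LinearIsometry.toLinearIsometryEquiv
    { planeRotLin α with
      norm_map' := fun η => by
        rw [← sq_eq_sq₀ (norm_nonneg _) (norm_nonneg _), norm_sq_plane, norm_sq_plane]
        simp only [planeRotLin, LinearMap.coe_mk, AddHom.coe_mk, Matrix.cons_val_zero,
          Matrix.cons_val_one]
        linear_combination (η 0 ^ 2 + η 1 ^ 2) * Real.sin_sq_add_cos_sq α } rfl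

theorem planeRot_apply (α : ℝ) (η : Plane) : planeRot α η
    = !₂[Real.cos α * η 0 - Real.sin α * η 1, Real.sin α * η 0 + Real.cos α * η 1] := rfl

theorem planeRot_neg_planeRot (α : ℝ) (η : Plane) : planeRot (-α) (planeRot α η) = η := by
  ext i
  fin_cases i <;> simp [planeRot_apply]
  · linear_combination η 0 * Real.sin_sq_add_cos_sq α
  · linear_combination η 1 * Real.sin_sq_add_cos_sq α

theorem continuous_toPlane : Continuous fun p : ℝ × ℝ => (!₂[p.1, p.2] : Plane) := by
  refine (PiLp.continuous_toLp 2 _).comp ?_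
  refine continuous_pi fun i => ?_
  fin_cases i <;> simp <;> fun_prop

theorem continuous_planeRot : Continuous fun p : ℝ × Plane => planeRot p.1 p.2 := by
  simp only [planeRot_apply]
  exact continuous_toPlane.comp (f := fun p : ℝ × Plane =>
    (Real.cos p.1 * p.2 0 - Real.sin p.1 * p.2 1, Real.sin p.1 * p.2 0 + Real.cos p.1 * p.2 1))
    (by fun_prop)

theorem measurePreserving_planeRot (α : ℝ) :
    MeasurePreserving (planeRot α) (volume : Measure Plane) volume :=
  (planeRot α).measurePreserving

/-- The rotation field at a point of the plane. -/
noncomputable def rotField (η : Plane) : Plane := !₂[-(η 1), η 0]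

theorem continuous_rotField : Continuous rotField :=
  continuous_toPlane.comp (f := fun η : Plane => (-(η 1), η 0)) (by fun_prop)

theorem planeRot_rotField (α : ℝ) (η : Plane) :
    planeRot α (rotField η) = rotField (planeRot α η) := by
  ext i
  fin_cases i <;> simp [planeRot_apply, rotField] <;> ring

theorem hasDerivAt_planeRot (η : Plane) (α : ℝ) :
    HasDerivAt (fun α => planeRot α η) (rotField (planeRot α η)) α := by
  rw [hasDerivAt_iff_hasFDerivAt, ← hasFDerivWithinAt_univ, hasFDerivWithinAt_euclidean]
  intro i
  rw [hasFDerivWithinAt_univ]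
  have h : HasDerivAt (fun α => planeRot α η i) (rotField (planeRot α η) i) α := by
    fin_cases i
    · simp only [planeRot_apply, rotField]
      refine (((Real.hasDerivAt_cos α).mul_const (η 0)).sub
        ((Real.hasDerivAt_sin α).mul_const (η 1))).congr_deriv ?_
      simp; ring
    · simp only [planeRot_apply, rotField]
      refine (((Real.hasDerivAt_sin α).mul_const (η 0)).add
        ((Real.hasDerivAt_cos α).mul_const (η 1))).congr_deriv ?_
      simp; ring
  refine h.hasFDerivAt.congr_fderiv ?_
  ext; simp

/-- The derivative of a function on the plane along the rotation field. -/
noncomputable def planeAngDeriv (ψ : Plane → ℂ) (η : Plane) : ℂ := fderiv ℝ ψ η (rotField η)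

theorem planeAngDeriv_comp_planeRot {ψ : Plane → ℂ} (hψ : ContDiff ℝ ∞ ψ) (α : ℝ) (η : Plane) :
    planeAngDeriv (fun z => ψ (planeRot α z)) η = planeAngDeriv ψ (planeRot α η) := by
  have hd : DifferentiableAt ℝ ψ (planeRot α η) := (hψ.differentiable (by simp)).differentiableAt
  have h := hd.hasFDerivAt.comp η (planeRot α).toContinuousLinearEquiv.hasFDerivAt
  have h' : HasFDerivAt (fun z => ψ (planeRot α z)) _ η := h
  rw [planeAngDeriv, h'.fderiv, planeAngDeriv, ← planeRot_rotField]
  rfl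

theorem continuous_planeAngDeriv {ψ : Plane → ℂ} (hψ : ContDiff ℝ ∞ ψ) :
    Continuous (planeAngDeriv ψ) :=
  (hψ.continuous_fderiv (by simp)).clm_apply continuous_rotField

theorem hasCompactSupport_planeAngDeriv {ψ : Plane → ℂ} (hψ : HasCompactSupport ψ) :
    HasCompactSupport (planeAngDeriv ψ) := by
  refine (hψ.fderiv ℝ).mono fun η hη => ?_
  rw [Function.mem_support] at hη ⊢
  intro h
  exact hη (by simp [planeAngDeriv, h])

theorem hasDerivAt_comp_planeRot_neg {ψ : Plane → ℂ} (hψ : ContDiff ℝ ∞ ψ) (η : Plane) (α : ℝ) :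
    HasDerivAt (fun α => ψ (planeRot (-α) η)) (-planeAngDeriv ψ (planeRot (-α) η)) α := by
  have hd : DifferentiableAt ℝ ψ (planeRot (-α) η) :=
    (hψ.differentiable (by simp)).differentiableAt
  have h1 : HasDerivAt (fun α => planeRot (-α) η) (-rotField (planeRot (-α) η)) α := by
    have := (hasDerivAt_planeRot η (-α)).scomp α (hasDerivAt_neg α)
    rw [neg_one_smul] at this
    exact this
  have := hd.hasFDerivAt.comp_hasDerivAt α h1
  rwa [map_neg] at this

section AngularBound

variable {F RF : Plane → ℂ}

/-- The integrand of the angular representation of a function with weak angular derivative. -/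
noncomputable def angKernel (F RF : Plane → ℂ) (p : ℝ × Plane) : ℂ :=
  (((2 * Real.pi)⁻¹ : ℝ) : ℂ) * F p.2 - ((1 - p.1 / (2 * Real.pi) : ℝ) : ℂ) * RF p.2

theorem measurePreserving_skew_planeRot :
    MeasurePreserving (fun p : ℝ × Plane => (p.1, planeRot p.1 p.2))
      ((volume.restrict (Set.Ioc 0 (2 * Real.pi))).prod volume)
      ((volume.restrict (Set.Ioc 0 (2 * Real.pi))).prod volume) :=
  (MeasurePreserving.id _).skew_product continuous_planeRot.measurable
    (ae_of_all _ fun α => (measurePreserving_planeRot α).map_eq)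

theorem integrable_angKernel (hFi : Integrable F) (hRi : Integrable RF) :
    Integrable (angKernel F RF)
      ((volume.restrict (Set.Ioc 0 (2 * Real.pi))).prod volume) := by
  refine Integrable.sub ?_ ?_
  · exact Integrable.mul_prod (f := fun _ : ℝ => (((2 * Real.pi)⁻¹ : ℝ) : ℂ))
      (integrable_const _) hFi
  · refine Integrable.mul_prod (f := fun α : ℝ => ((1 - α / (2 * Real.pi) : ℝ) : ℂ)) ?_ hRi
    have : IntegrableOn (fun α : ℝ => ((1 - α / (2 * Real.pi) : ℝ) : ℂ))
        (Set.Icc 0 (2 * Real.pi)) :=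
      ContinuousOn.integrableOn_compact isCompact_Icc (by fun_prop)
    exact this.mono_set Set.Ioc_subset_Icc_self

/-- The integrand is the derivative of -(1 - α/2π) ψ(R₋α z). The factor vanishes at α = 2π, so only
the endpoint α = 0 contributes, and it gives ψ(z). -/
theorem integral_angular_primitive {ψ : Plane → ℂ} (hψ : ContDiff ℝ ∞ ψ) (z : Plane) :
    ∫ α in Set.Ioc 0 (2 * Real.pi), ((((2 * Real.pi)⁻¹ : ℝ) : ℂ) * ψ (planeRot (-α) z)
      + ((1 - α / (2 * Real.pi) : ℝ) : ℂ) * planeAngDeriv ψ (planeRot (-α) z)) = ψ z := by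
  have hc : Continuous fun α => planeRot (-α) z :=
    continuous_planeRot.comp (f := fun α : ℝ => (-α, z)) (by fun_prop)
  have hd : ∀ α : ℝ, HasDerivAt
      (fun α => -(((1 - α / (2 * Real.pi) : ℝ) : ℂ) * ψ (planeRot (-α) z)))
      ((((2 * Real.pi)⁻¹ : ℝ) : ℂ) * ψ (planeRot (-α) z)
        + ((1 - α / (2 * Real.pi) : ℝ) : ℂ) * planeAngDeriv ψ (planeRot (-α) z)) α := fun α => by
    have h1 : HasDerivAt (fun α : ℝ => ((1 - α / (2 * Real.pi) : ℝ) : ℂ))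
        ((-(2 * Real.pi)⁻¹ : ℝ) : ℂ) α := by
      refine HasDerivAt.ofReal_comp ?_
      refine (((hasDerivAt_id α).div_const (2 * Real.pi)).const_sub 1).congr_deriv ?_
      simp
    refine (h1.mul (hasDerivAt_comp_planeRot_neg hψ z α)).neg.congr_deriv ?_
    push_cast; ring
  have hcont : Continuous fun α : ℝ => (((2 * Real.pi)⁻¹ : ℝ) : ℂ) * ψ (planeRot (-α) z)
        + ((1 - α / (2 * Real.pi) : ℝ) : ℂ) * planeAngDeriv ψ (planeRot (-α) z) := by
    have h1 := hψ.continuous.comp hc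
    have h2 := (continuous_planeAngDeriv hψ).comp hc
    simp only [Function.comp_def] at h1 h2
    fun_prop
  rw [← intervalIntegral.integral_of_le (by positivity),
    intervalIntegral.integral_eq_sub_of_hasDerivAt (fun α _ => hd α)
      (hcont.intervalIntegrable _ _)]
  have h2 : (1 - 2 * Real.pi / (2 * Real.pi) : ℝ) = 0 := by
    rw [div_self (by positivity), sub_self]
  rw [h2]
  have h3 : planeRot 0 z = z := by ext i; fin_cases i <;> simp [planeRot_apply]
  simp [h3]

/-- Dual form of `integral_angular_primitive`: Fubini and rotation invariance move the rotation onto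
ψ, and the weak derivative identity for the rotated test function moves the derivative from F to ψ.
-/
theorem integral_mul_angKernel {ψ : Plane → ℂ} (hψ : ContDiff ℝ ∞ ψ) (hψc : HasCompactSupport ψ)
    (hFi : Integrable F) (hRi : Integrable RF)
    (hweak : ∀ ψ : Plane → ℂ, ContDiff ℝ ∞ ψ → HasCompactSupport ψ →
      ∫ η, F η * planeAngDeriv ψ η = -∫ η, RF η * ψ η) :
    ∫ η, ψ η * ∫ α in Set.Ioc 0 (2 * Real.pi), angKernel F RF (α, planeRot α η)
      = ∫ η, F η * ψ η := by
  set μ : Measure ℝ := volume.restrict (Set.Ioc 0 (2 * Real.pi))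
  have hψcont := hψ.continuous
  obtain ⟨B, hB⟩ := hψcont.bounded_above_of_compact_support hψc
  obtain ⟨B', hB'⟩ := (continuous_planeAngDeriv hψ).bounded_above_of_compact_support
    (hasCompactSupport_planeAngDeriv hψc)
  have hB0 : 0 ≤ B := (norm_nonneg _).trans (hB 0)
  have hB0' : 0 ≤ B' := (norm_nonneg _).trans (hB' 0)
  have hcn : Continuous fun p : ℝ × Plane => planeRot (-p.1) p.2 :=
    continuous_planeRot.comp (f := fun p : ℝ × Plane => (-p.1, p.2)) (by fun_prop)
  set D : ℝ × Plane → ℂ := fun p => (((2 * Real.pi)⁻¹ : ℝ) : ℂ) * ψ (planeRot (-p.1) p.2)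
      + ((1 - p.1 / (2 * Real.pi) : ℝ) : ℂ) * planeAngDeriv ψ (planeRot (-p.1) p.2)
  have hDc : Continuous D := by
    have h1 := hψ.continuous.comp hcn
    have h2 := (continuous_planeAngDeriv hψ).comp hcn
    simp only [Function.comp_def] at h1 h2
    fun_prop
  have hI1 : Integrable (fun p : ℝ × Plane => ψ p.2 * angKernel F RF (p.1, planeRot p.1 p.2))
      (μ.prod volume) := by
    refine Integrable.bdd_mul (c := B) ?_ ?_ (ae_of_all _ fun p => hB p.2)
    · exact measurePreserving_skew_planeRot.integrable_comp_of_integrable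
        (integrable_angKernel hFi hRi)
    · exact (hψcont.comp continuous_snd).aestronglyMeasurable
  have hI2 : Integrable (fun p : ℝ × Plane => D p * F p.2) (μ.prod volume) := by
    have hF2 : Integrable (fun p : ℝ × Plane => F p.2) (μ.prod volume) := hFi.comp_snd μ
    refine Integrable.bdd_mul (c := (2 * Real.pi)⁻¹ * B + 1 * B') hF2 hDc.aestronglyMeasurable ?_
    have hmem : ∀ᵐ p : ℝ × Plane ∂(μ.prod volume), p.1 ∈ Set.Ioc 0 (2 * Real.pi) :=
      Measure.quasiMeasurePreserving_fst.ae (ae_restrict_mem measurableSet_Ioc)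
    filter_upwards [hmem] with p hp
    refine (norm_add_le _ _).trans ?_
    rw [norm_mul, norm_mul, Complex.norm_real, Complex.norm_real,
      Real.norm_of_nonneg (by positivity)]
    gcongr
    · exact hB _
    · rw [Real.norm_eq_abs, abs_le]
      have h1 : 0 ≤ p.1 / (2 * Real.pi) := div_nonneg hp.1.le (by positivity)
      have h2 : p.1 / (2 * Real.pi) ≤ 1 := (div_le_one (by positivity)).2 hp.2
      constructor <;> linarith
    · exact hB' _
  calc ∫ η, ψ η * ∫ α in Set.Ioc 0 (2 * Real.pi), angKernel F RF (α, planeRot α η)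
      = ∫ η, ∫ α, ψ η * angKernel F RF (α, planeRot α η) ∂μ := by
        simp only [integral_const_mul, μ]
    _ = ∫ α, (∫ η, ψ η * angKernel F RF (α, planeRot α η)) ∂μ :=
        (integral_integral_swap hI1).symm
    _ = ∫ α, (∫ z, D (α, z) * F z) ∂μ := by
        refine integral_congr_ae (ae_of_all _ fun α => ?_)
        simp only
        have e1 : ∫ η, ψ η * angKernel F RF (α, planeRot α η)
            = ∫ z, ψ (planeRot (-α) z) * angKernel F RF (α, z) := by
          have := (measurePreserving_planeRot α).integral_comp
            (planeRot α).toHomeomorph.measurableEmbedding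
            (fun z => ψ (planeRot (-α) z) * angKernel F RF (α, z))
          simpa only [planeRot_neg_planeRot] using this
        have hψα : ContDiff ℝ ∞ fun z => ψ (planeRot (-α) z) :=
          hψ.comp (planeRot (-α)).contDiff
        have hψαc : HasCompactSupport fun z => ψ (planeRot (-α) z) :=
          hψc.comp_homeomorph (planeRot (-α)).toHomeomorph
        have e2 := hweak _ hψα hψαc
        simp only [planeAngDeriv_comp_planeRot hψ] at e2
        have i1 : Integrable fun z => ψ (planeRot (-α) z) * F z :=
          hFi.bdd_mul hψα.continuous.aestronglyMeasurable (ae_of_all _ fun z => hB _)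
        have i2 : Integrable fun z => ψ (planeRot (-α) z) * RF z :=
          hRi.bdd_mul hψα.continuous.aestronglyMeasurable (ae_of_all _ fun z => hB _)
        have i3 : Integrable fun z => planeAngDeriv ψ (planeRot (-α) z) * F z :=
          hFi.bdd_mul ((continuous_planeAngDeriv hψ).comp
            (planeRot (-α)).continuous).aestronglyMeasurable (ae_of_all _ fun z => hB' _)
        rw [e1]
        calc ∫ z, ψ (planeRot (-α) z) * angKernel F RF (α, z)
            = ∫ z, ((((2 * Real.pi)⁻¹ : ℝ) : ℂ) * (ψ (planeRot (-α) z) * F z)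
              - ((1 - α / (2 * Real.pi) : ℝ) : ℂ) * (ψ (planeRot (-α) z) * RF z)) := by
              refine integral_congr_ae (ae_of_all _ fun z => ?_)
              simp only [angKernel]; ring
          _ = (((2 * Real.pi)⁻¹ : ℝ) : ℂ) * (∫ z, ψ (planeRot (-α) z) * F z)
              + ((1 - α / (2 * Real.pi) : ℝ) : ℂ) *
                ∫ z, planeAngDeriv ψ (planeRot (-α) z) * F z := by
              rw [integral_sub (i1.const_mul _) (i2.const_mul _), integral_const_mul,
                integral_const_mul]
              simp only [mul_comm (F _), mul_comm (RF _)] at e2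
              rw [e2]; ring
          _ = ∫ z, D (α, z) * F z := by
              rw [← integral_const_mul, ← integral_const_mul,
                ← integral_add (i1.const_mul _) (i3.const_mul _)]
              refine integral_congr_ae (ae_of_all _ fun z => ?_)
              simp only [D]; ring
    _ = ∫ z, ∫ α, D (α, z) * F z ∂μ := integral_integral_swap hI2
    _ = ∫ z, F z * ψ z := by
        refine integral_congr_ae (ae_of_all _ fun z => ?_)
        simp only
        rw [integral_mul_const, mul_comm]
        congr 1
        exact integral_angular_primitive hψ z

/-- The angular average which bounds a function with weak angular derivative pointwise. -/
noncomputable def angBound (m : Plane → ENNReal) (η : Plane) : ENNReal :=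
  ∫⁻ α in Set.Ioc 0 (2 * Real.pi), m (planeRot α η)

/-- The angular representation holds against every smooth test function, hence almost everywhere.
Its coefficients 1/2π and 1 - α/2π have size at most 1 on a period. -/
theorem enorm_le_angBound (hFi : Integrable F) (hRi : Integrable RF)
    (hweak : ∀ ψ : Plane → ℂ, ContDiff ℝ ∞ ψ → HasCompactSupport ψ →
      ∫ η, F η * planeAngDeriv ψ η = -∫ η, RF η * ψ η) :
    ∀ᵐ η, ‖F η‖ₑ ≤ angBound (fun z => ‖F z‖ₑ + ‖RF z‖ₑ) η := by
  set V : Plane → ℂ := fun η => ∫ α in Set.Ioc 0 (2 * Real.pi), angKernel F RF (α, planeRot α η)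
  have hVi : Integrable V := (measurePreserving_skew_planeRot.integrable_comp_of_integrable
    (integrable_angKernel hFi hRi)).integral_prod_right
  have h0 : ∀ᵐ η, (V η - F η) = 0 := by
    refine ae_eq_zero_of_integral_contDiff_smul_eq_zero (hVi.sub hFi).locallyIntegrable ?_
    intro g hg hgc
    have hψ : ContDiff ℝ ∞ fun η => (g η : ℂ) := Complex.ofRealCLM.contDiff.comp hg
    have hψc : HasCompactSupport fun η => (g η : ℂ) := hgc.comp_left (g := fun x : ℝ => (x : ℂ)) rfl
    obtain ⟨B, hB⟩ := hψ.continuous.bounded_above_of_compact_support hψc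
    have i1 : Integrable fun η => (g η : ℂ) * V η :=
      hVi.bdd_mul hψ.continuous.aestronglyMeasurable (ae_of_all _ hB)
    have i2 : Integrable fun η => (g η : ℂ) * F η :=
      hFi.bdd_mul hψ.continuous.aestronglyMeasurable (ae_of_all _ hB)
    simp only [Complex.real_smul, mul_sub]
    rw [integral_sub i1 i2, integral_mul_angKernel hψ hψc hFi hRi hweak, sub_eq_zero]
    simp only [mul_comm]
  filter_upwards [h0] with η hη
  rw [← sub_eq_zero.1 hη]
  refine (enorm_integral_le_lintegral_enorm _).trans ?_
  refine setLIntegral_mono' measurableSet_Ioc fun α hα => ?_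
  have h1 : ‖(((2 * Real.pi)⁻¹ : ℝ) : ℂ)‖ₑ ≤ 1 := by
    rw [← ofReal_norm, Complex.norm_real, Real.norm_of_nonneg (by positivity),
      ENNReal.ofReal_le_one]
    refine inv_le_one_of_one_le₀ ?_
    linarith [Real.two_le_pi]
  have h2 : ‖((1 - α / (2 * Real.pi) : ℝ) : ℂ)‖ₑ ≤ 1 := by
    rw [← ofReal_norm, Complex.norm_real, ENNReal.ofReal_le_one, Real.norm_eq_abs, abs_le]
    have h1 : 0 ≤ α / (2 * Real.pi) := div_nonneg hα.1.le (by positivity)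
    have h2 : α / (2 * Real.pi) ≤ 1 := (div_le_one (by positivity)).2 hα.2
    constructor <;> linarith
  refine (enorm_sub_le).trans (add_le_add ?_ ?_)
  · rw [enorm_mul]; exact mul_le_of_le_one_left' h1
  · rw [enorm_mul]; exact mul_le_of_le_one_left' h2

end AngularBound

/-! ### Transverse interactions near the resonant set -/

/-- The height of the sum of two points on the paraboloids above the paraboloid `P_c`. -/
noncomputable def phaseGap (s₁ s₂ c : ℝ) (p : Plane × Plane) : ℝ :=
  s₁ * ‖p.1‖ ^ 2 + s₂ * ‖p.2‖ ^ 2 - ‖p.1 + p.2‖ ^ 2 - c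

theorem continuous_phaseGap (s₁ s₂ c : ℝ) : Continuous (phaseGap s₁ s₂ c) := by
  unfold phaseGap; fun_prop

theorem phaseGap_swap (s₁ s₂ c : ℝ) (p : Plane × Plane) :
    phaseGap s₁ s₂ c p.swap = phaseGap s₂ s₁ c p := by
  simp only [phaseGap, Prod.fst_swap, Prod.snd_swap, add_comm p.2]
  ring

/-- The determinant of two vectors of the plane. -/
def planeCross (η ζ : Plane) : ℝ := η 0 * ζ 1 - η 1 * ζ 0

theorem planeCross_sq_add_inner_sq (η ζ : Plane) :
    planeCross η ζ ^ 2 + inner ℝ η ζ ^ 2 = ‖η‖ ^ 2 * ‖ζ‖ ^ 2 := by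
  rw [norm_sq_plane, norm_sq_plane, inner_plane, planeCross]; ring

theorem abs_planeCross_le (η ζ : Plane) : |planeCross η ζ| ≤ ‖η‖ * ‖ζ‖ := by
  refine abs_le_of_sq_le_sq ?_ (by positivity)
  rw [mul_pow, ← planeCross_sq_add_inner_sq]
  nlinarith [sq_nonneg (inner ℝ η ζ)]

/-- The gap equals -2⟨a, b⟩ - c with (a, b) = (η, ζ) for equal signs, and with the vector on P̄
paired with that of P replaced by a suitable sum otherwise: (η + ζ, ζ) for (+, -), (η, η + ζ) for
(-, +). In all cases a × b = ±η × ζ, and |a||b| has size XY, using |η + ζ| ≥ max(X, Y)/2 in the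
mixed cases. A small gap and small c keep ⟨a, b⟩ well below |a||b|, so the cross product is large.
-/
theorem le_abs_planeCross {s₁ s₂ c ε X Y : ℝ} (h₁ : s₁ = 1 ∨ s₁ = -1) (h₂ : s₂ = 1 ∨ s₂ = -1)
    (h₁₂ : ¬ (s₁ = -1 ∧ s₂ = -1)) (hX : 0 < X) (hY : 0 < Y) (hc : |c| ≤ X * Y / 4)
    (hε : ε ≤ X * Y / 16) {η ζ : Plane} (hη : 7 / 16 * X ≤ ‖η‖) (hζ : 7 / 16 * Y ≤ ‖ζ‖)
    (hξ : max X Y / 2 ≤ ‖η + ζ‖) (hQ : |phaseGap s₁ s₂ c (η, ζ)| < ε) :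
    X * Y / 10 ≤ |planeCross η ζ| := by
  have main : ∀ a b : Plane, 7 / 16 * (7 / 16) * (X * Y) ≤ ‖a‖ * ‖b‖ →
      |2 * inner ℝ a b + c| < ε → |planeCross a b| = |planeCross η ζ| →
      X * Y / 10 ≤ |planeCross η ζ| := by
    intro a b h3 h4 h5
    rw [← h5]
    refine abs_le_of_sq_le_sq' ?_ (abs_nonneg _) |>.2
    have hxy : 0 < X * Y := by positivity
    have h6 := planeCross_sq_add_inner_sq a b
    have h7 : (7 / 16 * (7 / 16) * (X * Y)) ^ 2 ≤ (‖a‖ * ‖b‖) ^ 2 := by gcongr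
    -- Here 5/32 = (1/4 + 1/16)/2. The final comparison is (49/256)² - (5/32)² ≥ (1/10)².
    have h8 : |inner ℝ a b| ≤ 5 / 32 * (X * Y) := by
      rw [abs_le] at hc ⊢
      rw [abs_lt] at h4
      constructor <;> linarith [h4.1, h4.2, hc.1, hc.2]
    have h9 : inner ℝ a b ^ 2 ≤ (5 / 32 * (X * Y)) ^ 2 := by
      rw [← sq_abs]; gcongr
    rw [sq_abs]
    rw [mul_pow] at h7 h9
    nlinarith [sq_nonneg (X * Y)]
  have hXM : X ≤ max X Y := le_max_left _ _
  have hYM : Y ≤ max X Y := le_max_right _ _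
  have hs : ‖η + ζ‖ ^ 2 = ‖η‖ ^ 2 + 2 * inner ℝ η ζ + ‖ζ‖ ^ 2 := norm_add_sq_real η ζ
  rcases h₁ with rfl | rfl <;> rcases h₂ with rfl | rfl
  · refine main η ζ ?_ ?_ rfl
    · calc 7 / 16 * (7 / 16) * (X * Y) = (7 / 16 * X) * (7 / 16 * Y) := by ring
        _ ≤ _ := by gcongr
    · rw [← abs_neg]
      convert hQ using 2
      simp only [phaseGap, hs]; ring
  · refine main (η + ζ) ζ ?_ ?_ ?_
    · calc 7 / 16 * (7 / 16) * (X * Y) ≤ (X / 2) * (7 / 16 * Y) := by nlinarith [mul_pos hX hY]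
        _ ≤ _ := by gcongr; linarith
    · rw [← abs_neg]
      convert hQ using 2
      simp only [phaseGap, hs, inner_add_left, real_inner_self_eq_norm_sq]; ring
    · simp only [planeCross, PiLp.add_apply]; ring_nf
  · refine main η (η + ζ) ?_ ?_ ?_
    · calc 7 / 16 * (7 / 16) * (X * Y) ≤ (7 / 16 * X) * (Y / 2) := by nlinarith [mul_pos hX hY]
        _ ≤ _ := by gcongr; linarith
    · rw [← abs_neg]
      convert hQ using 2
      simp only [phaseGap, hs, inner_add_right, real_inner_self_eq_norm_sq]; ring
    · simp only [planeCross, PiLp.add_apply]; ring_nf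
  · exact absurd ⟨rfl, rfl⟩ h₁₂

/-- Pairs of bounded, quantitatively transverse frequencies with small phase gap. -/
def transverseSet (s₁ s₂ c ε m R₁ R₂ : ℝ) : Set (Plane × Plane) :=
  {p | |phaseGap s₁ s₂ c p| < ε ∧ m ≤ |planeCross p.1 p.2| ∧ ‖p.1‖ ≤ R₁ ∧ ‖p.2‖ ≤ R₂}

theorem measurableSet_transverseSet (s₁ s₂ c ε m R₁ R₂ : ℝ) :
    MeasurableSet (transverseSet s₁ s₂ c ε m R₁ R₂) := by
  have hQ := continuous_phaseGap s₁ s₂ c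
  have a1 : MeasurableSet {p : Plane × Plane | |phaseGap s₁ s₂ c p| < ε} :=
    measurableSet_lt (by fun_prop) measurable_const
  have a2 : MeasurableSet {p : Plane × Plane | m ≤ |planeCross p.1 p.2|} :=
    measurableSet_le measurable_const (by unfold planeCross; fun_prop)
  have a3 : MeasurableSet {p : Plane × Plane | ‖p.1‖ ≤ R₁} :=
    measurableSet_le (by fun_prop) measurable_const
  have a4 : MeasurableSet {p : Plane × Plane | ‖p.2‖ ≤ R₂} :=
    measurableSet_le (by fun_prop) measurable_const
  exact a1.inter (a2.inter (a3.inter a4))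

theorem swap_mem_transverseSet {s₁ s₂ c ε m R₁ R₂ : ℝ} {p : Plane × Plane} :
    p.swap ∈ transverseSet s₁ s₂ c ε m R₁ R₂ ↔ p ∈ transverseSet s₂ s₁ c ε m R₂ R₁ := by
  have : |planeCross p.2 p.1| = |planeCross p.1 p.2| := by
    rw [← abs_neg]; congr 1; simp only [planeCross]; ring
  simp only [transverseSet, Set.mem_ofPred_eq, phaseGap_swap, Prod.fst_swap, Prod.snd_swap, this]
  tauto

theorem lintegral_indicator_abs_sub_lt (a ε : ℝ) :
    ∫⁻ t : ℝ, {t : ℝ | |t - a| < ε}.indicator 1 t = ENNReal.ofReal (2 * ε) := by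
  have : {t : ℝ | |t - a| < ε} = Metric.ball a ε := by
    ext t; simp [Real.dist_eq]
  rw [this, lintegral_indicator_one Metric.isOpen_ball.measurableSet, Real.volume_ball]

theorem measurable_indicator_abs_sub_lt (a ε : ℝ) :
    Measurable ({t : ℝ | |t - a| < ε}.indicator (1 : ℝ → ENNReal)) :=
  measurable_one.indicator (measurableSet_lt (by fun_prop) measurable_const)

/-- With q the expression inside the first absolute value and d the one inside the second, q' = -2d.
The value of q fixes u cos α + v sin α, hence d²; where d has a fixed sign it therefore fixes the
angle on a period. So q is injective there with |q'| ≥ 2m, and the image has length at most 2ε. The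
two signs give 2 · ε/m. -/
theorem volume_angular_sublevel_le (A u v : ℝ) {ε m : ℝ} (hm : 0 < m) :
    volume {α ∈ Set.Ioc 0 (2 * Real.pi) | |A - 2 * (u * Real.cos α + v * Real.sin α)| < ε ∧
      m ≤ |v * Real.cos α - u * Real.sin α|} ≤ ENNReal.ofReal (2 * ε / m) := by
  set q : ℝ → ℝ := fun α => A - 2 * (u * Real.cos α + v * Real.sin α)
  set d : ℝ → ℝ := fun α => v * Real.cos α - u * Real.sin α
  have hq : Continuous q := by fun_prop
  have hd : Continuous d := by fun_prop
  have hder : ∀ α, HasDerivAt q (-2 * d α) α := fun α => by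
    have := ((((Real.hasDerivAt_cos α).const_mul u).add
      ((Real.hasDerivAt_sin α).const_mul v)).const_mul 2).const_sub A
    refine this.congr_deriv ?_
    simp only [d]; ring
  have hpd : ∀ α, d α ^ 2 + (u * Real.cos α + v * Real.sin α) ^ 2 = u ^ 2 + v ^ 2 := fun α => by
    simp only [d]
    linear_combination (u ^ 2 + v ^ 2) * Real.sin_sq_add_cos_sq α
  have hcos : ∀ α, (u ^ 2 + v ^ 2) * Real.cos α
      = u * (u * Real.cos α + v * Real.sin α) + v * d α := fun α => by simp only [d]; ring
  have hsin : ∀ α, (u ^ 2 + v ^ 2) * Real.sin α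
      = v * (u * Real.cos α + v * Real.sin α) - u * d α := fun α => by simp only [d]; ring
  have key : ∀ S : Set ℝ, MeasurableSet S → S ⊆ Set.Ioc 0 (2 * Real.pi) →
      (∀ α ∈ S, m ≤ |d α|) → (∀ α ∈ S, ∀ β ∈ S, 0 < d α * d β) →
      (∀ α ∈ S, |q α| < ε) → volume S ≤ ENNReal.ofReal (ε / m) := by
    intro S hS hSI hSm hSd hSq
    have hinj : Set.InjOn q S := by
      intro α hα β hβ hαβ
      have e1 : u * Real.cos α + v * Real.sin α = u * Real.cos β + v * Real.sin β := by
        simp only [q] at hαβ; linarith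
      have e2 : d α = d β := by
        have h1 : d α ^ 2 = d β ^ 2 := by
          have h1 := hpd α
          have h2 := hpd β
          rw [e1] at h1; linarith
        rcases sq_eq_sq_iff_eq_or_eq_neg.1 h1 with h | h
        · exact h
        · have := hSd α hα β hβ
          rw [h] at this
          nlinarith [sq_nonneg (d β)]
      have hr : u ^ 2 + v ^ 2 ≠ 0 := by
        have h1 := hSd α hα α hα
        have h2 := hpd α
        nlinarith [sq_nonneg (u * Real.cos α + v * Real.sin α)]
      have hc : Real.cos α = Real.cos β := mul_left_cancel₀ hr (by rw [hcos, hcos, e1, e2])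
      have hs : Real.sin α = Real.sin β := mul_left_cancel₀ hr (by rw [hsin, hsin, e1, e2])
      obtain ⟨k, hk⟩ := Real.Angle.angle_eq_iff_two_pi_dvd_sub.1 (Real.Angle.cos_sin_inj hc hs)
      have hα' := hSI hα
      have hβ' := hSI hβ
      have hpi := Real.two_pi_pos
      have k1 : (k : ℝ) < 1 := by
        by_contra h
        push Not at h
        nlinarith [hα'.2, hβ'.1]
      have k2 : (-1 : ℝ) < k := by
        by_contra h
        push Not at h
        nlinarith [hα'.1, hβ'.2]
      have k0 : k = 0 := by
        have k1' : k < 1 := by exact_mod_cast k1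
        have k2' : -1 < k := by exact_mod_cast k2
        omega
      rw [k0] at hk
      simp at hk
      linarith
    have h1 : ENNReal.ofReal (2 * m) * volume S ≤ ENNReal.ofReal (2 * ε) := by
      calc ENNReal.ofReal (2 * m) * volume S = ∫⁻ _ in S, ENNReal.ofReal (2 * m) := by
            rw [setLIntegral_const]
        _ ≤ ∫⁻ α in S, ENNReal.ofReal |-2 * d α| := by
            refine setLIntegral_mono' hS fun α hα => ENNReal.ofReal_le_ofReal ?_
            rw [abs_mul, abs_neg, abs_two]
            linarith [hSm α hα]
        _ = volume (q '' S) := by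
            have := lintegral_image_eq_lintegral_abs_deriv_mul hS
              (fun α _ => (hder α).hasDerivWithinAt) hinj (fun _ => 1)
            simp only [mul_one] at this
            rw [← this, setLIntegral_one]
        _ ≤ volume (Set.Ioo (-ε) ε) := by
            refine measure_mono ?_
            rintro _ ⟨α, hα, rfl⟩
            exact abs_lt.1 (hSq α hα)
        _ = _ := by rw [Real.volume_Ioo]; congr 1; ring
    calc volume S = ENNReal.ofReal (1 / (2 * m)) * (ENNReal.ofReal (2 * m) * volume S) := by
          rw [← mul_assoc, ← ENNReal.ofReal_mul (by positivity),
            one_div_mul_cancel (by positivity), ENNReal.ofReal_one, one_mul]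
      _ ≤ ENNReal.ofReal (1 / (2 * m)) * ENNReal.ofReal (2 * ε) := by gcongr
      _ = _ := by
          rw [← ENNReal.ofReal_mul (by positivity)]
          congr 1; field_simp
  set P : Set ℝ := {α ∈ Set.Ioc 0 (2 * Real.pi) | |q α| < ε ∧ m ≤ d α}
  set N : Set ℝ := {α ∈ Set.Ioc 0 (2 * Real.pi) | |q α| < ε ∧ d α ≤ -m}
  have hqm : MeasurableSet {α | |q α| < ε} := measurableSet_lt (by fun_prop) measurable_const
  have hP : MeasurableSet P :=
    measurableSet_Ioc.inter (hqm.inter (measurableSet_le measurable_const hd.measurable))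
  have hN : MeasurableSet N :=
    measurableSet_Ioc.inter (hqm.inter (measurableSet_le hd.measurable measurable_const))
  calc _ ≤ volume (P ∪ N) := by
        refine measure_mono fun α hα => ?_
        rcases le_abs.1 hα.2.2 with h | h
        · exact Or.inl ⟨hα.1, hα.2.1, h⟩
        · exact Or.inr ⟨hα.1, hα.2.1, by linarith⟩
    _ ≤ volume P + volume N := measure_union_le _ _
    _ ≤ ENNReal.ofReal (ε / m) + ENNReal.ofReal (ε / m) := by
        refine add_le_add ?_ ?_
        · exact key P hP (fun α hα => hα.1) (fun α hα => hα.2.2.trans (le_abs_self _))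
            (fun α hα β hβ => mul_pos (hm.trans_le hα.2.2) (hm.trans_le hβ.2.2)) fun α hα => hα.2.1
        · exact key N hN (fun α hα => hα.1)
            (fun α hα => le_abs.2 (Or.inr (by linarith [hα.2.2])))
            (fun α hα β hβ => mul_pos_of_neg_of_neg (by linarith [hα.2.2]) (by linarith [hβ.2.2]))
            fun α hα => hα.2.1
    _ = _ := by
        rw [← two_mul, mul_div_assoc, ENNReal.ofReal_mul zero_le_two]
        norm_num

/-! ### Fibres of the transverse slab: circles, fixed first or second variable, fixed sum -/

section Fibers

variable {s₁ s₂ c ε m R₁ R₂ : ℝ}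

/-- Rotating η with ζ fixed changes the gap only through ⟨η, ζ⟩, whose angular derivative is ±η × ζ.
Transversality is thus exactly what bounds the time a circle spends in the slab. -/
theorem volume_rotation_transverse_le (hm : 0 < m) (z ζ : Plane) :
    volume {α ∈ Set.Ioc 0 (2 * Real.pi) |
      (planeRot (-α) z, ζ) ∈ transverseSet s₁ s₂ c ε m R₁ R₂} ≤ ENNReal.ofReal (2 * ε / m) := by
  refine le_trans (measure_mono ?_) (volume_angular_sublevel_le
    (s₁ * ‖z‖ ^ 2 + s₂ * ‖ζ‖ ^ 2 - ‖z‖ ^ 2 - ‖ζ‖ ^ 2 - c) (inner ℝ z ζ) (-planeCross z ζ) hm)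
  intro α hα
  refine ⟨hα.1, ?_, ?_⟩
  · convert hα.2.1 using 2
    have h1 : ‖planeRot (-α) z‖ = ‖z‖ := (planeRot (-α)).norm_map z
    simp only [phaseGap, norm_add_sq_real, h1]
    have h2 : inner ℝ (planeRot (-α) z) ζ
        = inner ℝ z ζ * Real.cos α + -planeCross z ζ * Real.sin α := by
      simp only [inner_plane, planeCross, planeRot_apply, Matrix.cons_val_zero,
        Matrix.cons_val_one, Real.cos_neg, Real.sin_neg]
      ring
    rw [h2]; ring
  · refine hα.2.2.1.trans (le_of_eq ?_)
    rw [← abs_neg]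
    congr 1
    simp only [inner_plane, planeCross, planeRot_apply, Matrix.cons_val_zero,
        Matrix.cons_val_one, Real.cos_neg, Real.sin_neg]
    ring_nf

/-- With η fixed, the gradient of the gap in ζ is 2((s₂ - 1)ζ - η). Its cross product with ζ is -2 η
× ζ, so its length is at least 2m/R₂, and the quadratic sublevel bound applies. -/
theorem volume_transverse_snd_fiber_le (hm : 0 < m) (hR₂ : 0 < R₂) (η : Plane) :
    volume {ζ | (η, ζ) ∈ transverseSet s₁ s₂ c ε m R₁ R₂}
      ≤ ENNReal.ofReal (16 * R₂ ^ 2 * ε / m) := by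
  set S : Set Plane := {ζ | (η, ζ) ∈ transverseSet s₁ s₂ c ε m R₁ R₂}
  have hS : MeasurableSet S :=
    (by fun_prop : Measurable fun ζ : Plane => (η, ζ)) (measurableSet_transverseSet ..)
  have hm' : 0 < 2 * (m / R₂) := by positivity
  have h := lintegral_comp_quadratic_plane_le (s₂ - 1) (-2 * η 0) (-2 * η 1)
    (s₁ * ‖η‖ ^ 2 - ‖η‖ ^ 2 - c) hm' hR₂.le (measurable_indicator_abs_sub_lt 0 ε) hS
    (fun ζ hζ => hζ.2.2.2) ?_
  · calc volume S = ∫⁻ ζ in S, 1 := by simp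
      _ = ∫⁻ ζ in S, {t : ℝ | |t - 0| < ε}.indicator 1
            ((s₂ - 1) * ‖ζ‖ ^ 2 + (-2 * η 0 * ζ 0 + -2 * η 1 * ζ 1)
              + (s₁ * ‖η‖ ^ 2 - ‖η‖ ^ 2 - c)) := by
          refine setLIntegral_congr_fun hS fun ζ hζ => ?_
          simp only
          rw [Set.indicator_of_mem, Pi.one_apply]
          rw [Set.mem_ofPred_eq, sub_zero]
          convert hζ.1 using 2
          simp only [phaseGap, norm_add_sq_real, inner_plane]; ring
      _ ≤ _ := h
      _ = _ := by
          rw [lintegral_indicator_abs_sub_lt, ← ENNReal.ofReal_mul (by positivity)]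
          congr 1; field_simp
  · intro ζ hζ
    have h1 : m ≤ ‖(s₂ - 1) • ζ - η‖ * R₂ := by
      calc m ≤ |planeCross η ζ| := hζ.2.1
        _ = |planeCross ((s₂ - 1) • ζ - η) ζ| := by
            rw [← abs_neg]; congr 1
            simp only [planeCross, PiLp.sub_apply, PiLp.smul_apply, smul_eq_mul]; ring
        _ ≤ ‖(s₂ - 1) • ζ - η‖ * ‖ζ‖ := abs_planeCross_le _ _
        _ ≤ _ := by gcongr; exact hζ.2.2.2
    have h2 : m / R₂ ≤ ‖(s₂ - 1) • ζ - η‖ := (div_le_iff₀ hR₂).2 h1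
    calc (2 * (m / R₂)) ^ 2 ≤ (2 * ‖(s₂ - 1) • ζ - η‖) ^ 2 := by gcongr
      _ = _ := by
        rw [mul_pow, norm_sq_plane]
        simp only [PiLp.sub_apply, PiLp.smul_apply, smul_eq_mul]; ring

theorem volume_transverse_fst_fiber_le (hm : 0 < m) (hR₁ : 0 < R₁) (ζ : Plane) :
    volume {η | (η, ζ) ∈ transverseSet s₁ s₂ c ε m R₁ R₂}
      ≤ ENNReal.ofReal (16 * R₁ ^ 2 * ε / m) := by
  have : {η | (η, ζ) ∈ transverseSet s₁ s₂ c ε m R₁ R₂}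
      = {η | (ζ, η) ∈ transverseSet s₂ s₁ c ε m R₂ R₁} := by
    ext η
    exact swap_mem_transverseSet (p := (ζ, η))
  rw [this]
  exact volume_transverse_snd_fiber_le hm hR₁ ζ

/-- With the sum fixed, half the gradient is s₁η - s₂ζ. Crossing it with either ζ or η returns ±η ×
ζ, so its length is at least both m/R₂ and m/R₁. Exchanging the roles of η and ζ afterwards also
replaces the disc radius R₁ by the smaller radius. -/
theorem volume_transverse_sum_fiber_le' (hm : 0 < m) (hR₁ : 0 < R₁) (hR₂ : 0 < R₂) (ξ : Plane)
    (h₁ : s₁ = 1 ∨ s₁ = -1) (h₂ : s₂ = 1 ∨ s₂ = -1) :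
    volume {η | (η, ξ - η) ∈ transverseSet s₁ s₂ c ε m R₁ R₂}
      ≤ ENNReal.ofReal (16 * R₁ * ε * min R₁ R₂ / m) := by
  set S : Set Plane := {η | (η, ξ - η) ∈ transverseSet s₁ s₂ c ε m R₁ R₂}
  have hS : MeasurableSet S :=
    (by fun_prop : Measurable fun η : Plane => (η, ξ - η)) (measurableSet_transverseSet ..)
  have hmin : 0 < min R₁ R₂ := lt_min hR₁ hR₂
  have h := setLIntegral_conv_fiber_le (s₁ := s₁) (s₂ := s₂) hR₁.le
    (m := m / min R₁ R₂) (by positivity) ξ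
    (measurable_indicator_abs_sub_lt (‖ξ‖ ^ 2 + c) ε) hS (fun η hη => hη.2.2.1) ?_
  · calc volume S = ∫⁻ ζ in S, 1 := by simp
      _ = ∫⁻ η in S, {t : ℝ | |t - (‖ξ‖ ^ 2 + c)| < ε}.indicator 1
            (s₁ * ‖η‖ ^ 2 + s₂ * ‖ξ - η‖ ^ 2) := by
          refine setLIntegral_congr_fun hS fun η hη => ?_
          rw [Set.indicator_of_mem, Pi.one_apply]
          rw [Set.mem_ofPred_eq]
          convert hη.1 using 2
          simp only [phaseGap, add_sub_cancel]; ring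
      _ ≤ _ := h
      _ = _ := by
          rw [lintegral_indicator_abs_sub_lt, ← ENNReal.ofReal_mul (by positivity)]
          congr 1; field_simp; ring
  · intro η hη
    have e1 : |planeCross (s₁ • η - s₂ • (ξ - η)) (ξ - η)| = |planeCross η (ξ - η)| := by
      have : planeCross (s₁ • η - s₂ • (ξ - η)) (ξ - η) = s₁ * planeCross η (ξ - η) := by
        simp only [planeCross, PiLp.sub_apply, PiLp.smul_apply, smul_eq_mul]; ring
      rw [this, abs_mul, abs_eq_one_of_sign h₁, one_mul]
    have e2 : |planeCross (s₁ • η - s₂ • (ξ - η)) η| = |planeCross η (ξ - η)| := by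
      have : planeCross (s₁ • η - s₂ • (ξ - η)) η = s₂ * planeCross η (ξ - η) := by
        simp only [planeCross, PiLp.sub_apply, PiLp.smul_apply, smul_eq_mul]; ring
      rw [this, abs_mul, abs_eq_one_of_sign h₂, one_mul]
    rw [div_le_iff₀ hmin]
    have a1 := abs_planeCross_le (s₁ • η - s₂ • (ξ - η)) (ξ - η)
    have a2 := abs_planeCross_le (s₁ • η - s₂ • (ξ - η)) η
    rw [e1] at a1
    rw [e2] at a2
    have hm1 : m ≤ |planeCross η (ξ - η)| := hη.2.1
    have b1 : ‖η‖ ≤ R₁ := hη.2.2.1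
    have b2 : ‖ξ - η‖ ≤ R₂ := hη.2.2.2
    rcases min_choice R₁ R₂ with h | h <;> rw [h]
    · exact (hm1.trans a2).trans (by gcongr)
    · exact (hm1.trans a1).trans (by gcongr)

theorem volume_transverse_sum_fiber_le (hm : 0 < m) (hR₁ : 0 < R₁) (hR₂ : 0 < R₂) (ξ : Plane)
    (h₁ : s₁ = 1 ∨ s₁ = -1) (h₂ : s₂ = 1 ∨ s₂ = -1) :
    volume {η | (η, ξ - η) ∈ transverseSet s₁ s₂ c ε m R₁ R₂}
      ≤ ENNReal.ofReal (16 * ε * min R₁ R₂ ^ 2 / m) := by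
  rcases le_total R₁ R₂ with h | h
  · refine (volume_transverse_sum_fiber_le' hm hR₁ hR₂ ξ h₁ h₂).trans (le_of_eq ?_)
    rw [min_eq_left h]; congr 1; ring
  · have e : volume {η | (η, ξ - η) ∈ transverseSet s₁ s₂ c ε m R₁ R₂}
        = volume {η | (η, ξ - η) ∈ transverseSet s₂ s₁ c ε m R₂ R₁} := by
      have hS : MeasurableSet {η | (η, ξ - η) ∈ transverseSet s₂ s₁ c ε m R₂ R₁} :=
        (by fun_prop : Measurable fun η : Plane => (η, ξ - η)) (measurableSet_transverseSet ..)
      rw [← (Measure.measurePreserving_sub_left volume ξ).measure_preimage hS.nullMeasurableSet]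
      congr 1
      ext η
      simp only [Set.preimage_ofPred_eq, Set.mem_ofPred_eq, sub_sub_cancel]
      exact swap_mem_transverseSet (p := (ξ - η, η))
    rw [e]
    refine (volume_transverse_sum_fiber_le' hm hR₂ hR₁ ξ h₂ h₁).trans (le_of_eq ?_)
    rw [min_eq_left h, min_eq_right h]; congr 1; ring

end Fibers

/-! ### Integral bounds over the transverse slab -/

section Bounds

variable {s₁ s₂ c ε m R₁ R₂ : ℝ}

theorem setLIntegral_prod_eq_fst {S : Set (Plane × Plane)} (hS : MeasurableSet S)
    {f : Plane × Plane → ENNReal} (hf : Measurable f) :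
    ∫⁻ p in S, f p = ∫⁻ η, ∫⁻ ζ in {ζ | (η, ζ) ∈ S}, f (η, ζ) := by
  rw [← lintegral_indicator hS, Measure.volume_eq_prod,
    lintegral_prod _ (hf.indicator hS).aemeasurable]
  refine lintegral_congr fun η => ?_
  have hS' : MeasurableSet {ζ | (η, ζ) ∈ S} := (by fun_prop : Measurable fun ζ : Plane => (η, ζ)) hS
  rw [← lintegral_indicator hS']
  rfl

theorem setLIntegral_prod_eq_snd {S : Set (Plane × Plane)} (hS : MeasurableSet S)
    {f : Plane × Plane → ENNReal} (hf : Measurable f) :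
    ∫⁻ p in S, f p = ∫⁻ ζ, ∫⁻ η in {η | (η, ζ) ∈ S}, f (η, ζ) := by
  rw [← lintegral_indicator hS, Measure.volume_eq_prod,
    lintegral_prod_symm _ (hf.indicator hS).aemeasurable]
  refine lintegral_congr fun ζ => ?_
  have hS' : MeasurableSet {η | (η, ζ) ∈ S} := (by fun_prop : Measurable fun η : Plane => (η, ζ)) hS
  rw [← lintegral_indicator hS']
  rfl

/-- A Schur-type bound: each of F and D is integrated over the fibres of the other variable. It
needs no angular regularity, and serves for convergence of slab means rather than for the trace
estimate. -/
theorem lintegral_transverse_mul_sq_le (hm : 0 < m) (hR₁ : 0 < R₁) (hR₂ : 0 < R₂)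
    {F D : Plane → ENNReal} (hF : Measurable F) (hD : Measurable D) :
    (∫⁻ p in transverseSet s₁ s₂ c ε m R₁ R₂, F p.1 * D p.2) ^ 2
      ≤ ENNReal.ofReal (16 * R₂ ^ 2 * ε / m) * ENNReal.ofReal (16 * R₁ ^ 2 * ε / m) *
        ((∫⁻ η, F η ^ 2) * ∫⁻ ζ, D ζ ^ 2) := by
  have hS := measurableSet_transverseSet s₁ s₂ c ε m R₁ R₂
  refine (lintegral_mul_sq_le _ (f := fun p : Plane × Plane => F p.1)
    (g := fun p => D p.2) (by fun_prop) (by fun_prop)).trans ?_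
  rw [mul_mul_mul_comm]
  refine mul_le_mul' ?_ ?_
  · rw [setLIntegral_prod_eq_fst hS (f := fun p => F p.1 ^ 2) (by fun_prop),
      ← lintegral_const_mul _ (by fun_prop)]
    refine lintegral_mono fun η => ?_
    simp only
    rw [setLIntegral_const, mul_comm]
    exact mul_le_mul' (volume_transverse_snd_fiber_le hm hR₂ η) le_rfl
  · rw [setLIntegral_prod_eq_snd hS (f := fun p => D p.2 ^ 2) (by fun_prop),
      ← lintegral_const_mul _ (by fun_prop)]
    refine lintegral_mono fun ζ => ?_
    simp only
    rw [setLIntegral_const, mul_comm]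
    exact mul_le_mul' (volume_transverse_fst_fiber_le hm hR₁ ζ) le_rfl

theorem angBound_sq_le {M : Plane → ENNReal} (hM : Measurable M) (η : Plane) :
    angBound M η ^ 2 ≤ ENNReal.ofReal (2 * Real.pi) *
      ∫⁻ α in Set.Ioc 0 (2 * Real.pi), M (planeRot α η) ^ 2 := by
  have hc : Measurable fun α => planeRot α η :=
    (continuous_planeRot.comp (f := fun α : ℝ => (α, η)) (by fun_prop)).measurable
  have := lintegral_mul_sq_le (volume.restrict (Set.Ioc 0 (2 * Real.pi)))
    (f := fun _ => 1) (g := fun α => M (planeRot α η)) measurable_const (hM.comp hc)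
  simpa [angBound] using this

/-- Cauchy–Schwarz in the angle, Fubini, and undoing the rotation turn the left side into the mass
of M², weighted by the set of angles for which the rotated point lies in S. -/
theorem setLIntegral_angBound_sq_le {M : Plane → ENNReal} (hM : Measurable M) {S : Set Plane}
    (hS : MeasurableSet S) {K : ENNReal}
    (hK : ∀ z, volume {α ∈ Set.Ioc 0 (2 * Real.pi) | planeRot (-α) z ∈ S} ≤ K) :
    ∫⁻ η in S, angBound M η ^ 2 ≤ ENNReal.ofReal (2 * Real.pi) * K * ∫⁻ z, M z ^ 2 := by
  have hrot : Measurable fun p : Plane × ℝ => planeRot p.2 p.1 :=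
    (continuous_planeRot.comp (f := fun p : Plane × ℝ => (p.2, p.1)) (by fun_prop)).measurable
  have hrot' : Measurable fun p : ℝ × Plane => planeRot (-p.1) p.2 :=
    (continuous_planeRot.comp (f := fun p : ℝ × Plane => (-p.1, p.2)) (by fun_prop)).measurable
  have hSi : Measurable (S.indicator (1 : Plane → ENNReal)) := measurable_one.indicator hS
  calc ∫⁻ η in S, angBound M η ^ 2
      ≤ ∫⁻ η in S, ENNReal.ofReal (2 * Real.pi) *
          ∫⁻ α in Set.Ioc 0 (2 * Real.pi), M (planeRot α η) ^ 2 :=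
        lintegral_mono fun η => angBound_sq_le hM η
    _ = ENNReal.ofReal (2 * Real.pi) * ∫⁻ η, ∫⁻ α in Set.Ioc 0 (2 * Real.pi),
          S.indicator 1 η * M (planeRot α η) ^ 2 := by
        rw [lintegral_const_mul' _ _ ENNReal.ofReal_ne_top, ← lintegral_indicator hS]
        congr 1
        refine lintegral_congr fun η => ?_
        by_cases hη : η ∈ S <;> simp [hη]
    _ = ENNReal.ofReal (2 * Real.pi) * ∫⁻ α in Set.Ioc 0 (2 * Real.pi), ∫⁻ z,
          S.indicator 1 (planeRot (-α) z) * M z ^ 2 := by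
        rw [lintegral_lintegral_swap]
        · congr 1
          refine lintegral_congr fun α => ?_
          have hr : Measurable fun z => planeRot (-α) z := (planeRot (-α)).continuous.measurable
          have := (measurePreserving_planeRot α).lintegral_comp
            (f := fun z => S.indicator 1 (planeRot (-α) z) * M z ^ 2)
            ((hSi.comp hr).mul (hM.pow_const 2))
          simpa only [planeRot_neg_planeRot] using this
        · refine Measurable.aemeasurable ?_
          exact (hSi.comp measurable_fst).mul ((hM.comp hrot).pow_const 2)
    _ = ENNReal.ofReal (2 * Real.pi) * ∫⁻ z, ∫⁻ α in Set.Ioc 0 (2 * Real.pi),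
          S.indicator 1 (planeRot (-α) z) * M z ^ 2 := by
        rw [lintegral_lintegral_swap]
        refine Measurable.aemeasurable ?_
        exact (hSi.comp hrot').mul ((hM.comp measurable_snd).pow_const 2)
    _ ≤ ENNReal.ofReal (2 * Real.pi) * ∫⁻ z, K * M z ^ 2 := by
        refine mul_le_mul_right (lintegral_mono fun z => ?_) _
        have hr : Measurable fun α => planeRot (-α) z :=
          (continuous_planeRot.comp (f := fun α : ℝ => (-α, z)) (by fun_prop)).measurable
        have hr' : Measurable fun α => S.indicator (1 : Plane → ENNReal) (planeRot (-α) z) :=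
          hSi.comp hr
        rw [lintegral_mul_const (M z ^ 2) hr']
        refine mul_le_mul_left (le_trans (le_of_eq ?_) (hK z)) _
        have hrS : MeasurableSet {α | planeRot (-α) z ∈ S} := hr hS
        have : (fun α => S.indicator (1 : Plane → ENNReal) (planeRot (-α) z))
            = {α | planeRot (-α) z ∈ S}.indicator 1 := by
          ext α
          by_cases h : planeRot (-α) z ∈ S
          · rw [Set.indicator_of_mem h, Set.indicator_of_mem (by exact h)]; rfl
          · rw [Set.indicator_of_notMem h, Set.indicator_of_notMem (by exact h)]
        rw [this, lintegral_indicator_one hrS, Measure.restrict_apply hrS, Set.inter_comm]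
        congr 1
    _ = ENNReal.ofReal (2 * Real.pi) * K * ∫⁻ z, M z ^ 2 := by
        rw [lintegral_const_mul _ (hM.pow_const 2), mul_assoc]

/-- This is where the angular derivative pays: for each fixed ζ the mass of F² in the fibre is
bounded through circles, by a multiple of ε/m independent of ζ. This leaves H in L², where
`lintegral_transverse_mul_sq_le` can only accommodate a bounded factor. -/
theorem lintegral_transverse_conv_sq_le (h₁ : s₁ = 1 ∨ s₁ = -1) (h₂ : s₂ = 1 ∨ s₂ = -1)
    (hm : 0 < m) (hR₁ : 0 < R₁) (hR₂ : 0 < R₂) {F G H M : Plane → ENNReal}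
    (hF : Measurable F) (hG : Measurable G) (hH : Measurable H) (hM : Measurable M)
    (hFM : ∀ᵐ η, F η ≤ angBound M η) :
    (∫⁻ p in transverseSet s₁ s₂ c ε m R₁ R₂, F p.1 * G p.2 * H (p.1 + p.2)) ^ 2
      ≤ ENNReal.ofReal (2 * Real.pi) * ENNReal.ofReal (2 * ε / m) *
          ENNReal.ofReal (16 * ε * min R₁ R₂ ^ 2 / m) *
        ((∫⁻ η, M η ^ 2) * (∫⁻ ζ, G ζ ^ 2) * ∫⁻ ξ, H ξ ^ 2) := by
  have hS := measurableSet_transverseSet s₁ s₂ c ε m R₁ R₂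
  refine (lintegral_mul_sq_le _ (f := fun p : Plane × Plane => F p.1 * G p.2)
    (g := fun p => H (p.1 + p.2)) (by fun_prop) (by fun_prop)).trans ?_
  have hA : ∫⁻ p in transverseSet s₁ s₂ c ε m R₁ R₂, (F p.1 * G p.2) ^ 2
      ≤ ENNReal.ofReal (2 * Real.pi) * ENNReal.ofReal (2 * ε / m) *
        (∫⁻ η, M η ^ 2) * ∫⁻ ζ, G ζ ^ 2 := by
    rw [setLIntegral_prod_eq_snd hS (f := fun p => (F p.1 * G p.2) ^ 2) (by fun_prop),
      ← lintegral_const_mul _ (by fun_prop)]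
    refine lintegral_mono fun ζ => ?_
    simp only [mul_pow]
    rw [lintegral_mul_const _ (by fun_prop)]
    refine mul_le_mul_left ?_ _
    have hS' : MeasurableSet {η | (η, ζ) ∈ transverseSet s₁ s₂ c ε m R₁ R₂} :=
      (by fun_prop : Measurable fun η : Plane => (η, ζ)) hS
    refine le_trans (lintegral_mono_ae ?_) (setLIntegral_angBound_sq_le hM hS'
      fun z => volume_rotation_transverse_le hm z ζ)
    exact ae_restrict_of_ae (hFM.mono fun η hη => by gcongr)
  have hB : ∫⁻ p in transverseSet s₁ s₂ c ε m R₁ R₂, H (p.1 + p.2) ^ 2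
      ≤ ENNReal.ofReal (16 * ε * min R₁ R₂ ^ 2 / m) * ∫⁻ ξ, H ξ ^ 2 := by
    have hHm : Measurable fun p : Plane × Plane => H (p.1 + p.2) ^ 2 := by fun_prop
    rw [← lintegral_indicator hS, lintegral_prod_sum (hHm.indicator hS),
      ← lintegral_const_mul _ (by fun_prop)]
    refine lintegral_mono fun ξ => ?_
    have hS' : MeasurableSet {η | (η, ξ - η) ∈ transverseSet s₁ s₂ c ε m R₁ R₂} :=
      (by fun_prop : Measurable fun η : Plane => (η, ξ - η)) hS
    calc ∫⁻ η, (transverseSet s₁ s₂ c ε m R₁ R₂).indicator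
          (fun p => H (p.1 + p.2) ^ 2) (η, ξ - η)
        = ∫⁻ η in {η | (η, ξ - η) ∈ transverseSet s₁ s₂ c ε m R₁ R₂}, H ξ ^ 2 := by
          rw [← lintegral_indicator hS']
          refine lintegral_congr fun η => ?_
          by_cases hη : (η, ξ - η) ∈ transverseSet s₁ s₂ c ε m R₁ R₂
          · rw [Set.indicator_of_mem hη, Set.indicator_of_mem (by exact hη)]
            simp
          · rw [Set.indicator_of_notMem hη, Set.indicator_of_notMem (by exact hη)]
      _ ≤ _ := by
          rw [setLIntegral_const, mul_comm]
          exact mul_le_mul' (volume_transverse_sum_fiber_le hm hR₁ hR₂ ξ h₁ h₂) le_rfl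
  refine (mul_le_mul' hA hB).trans (le_of_eq ?_)
  ring

end Bounds

/-! ### Convergence of slab averages -/

theorem integral_plane {f : Plane → ℂ} (hf : Integrable f) :
    ∫ z, f z = ∫ x : ℝ, ∫ y : ℝ, f !₂[x, y] := by
  have e1 := PiLp.volume_preserving_toLp (Fin 2)
  have e2 := (volume_preserving_finTwoArrow ℝ).symm
  have m1 : MeasurableEmbedding (WithLp.toLp 2 : (Fin 2 → ℝ) → Plane) :=
    (MeasurableEquiv.toLp 2 (Fin 2 → ℝ)).measurableEmbedding
  have m2 := (MeasurableEquiv.finTwoArrow (α := ℝ)).symm.measurableEmbedding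
  rw [← e1.integral_comp m1, ← e2.integral_comp m2, Measure.volume_eq_prod, integral_prod]
  · rfl
  · have h1 := (e1.integrable_comp_emb m1).2 hf
    exact (e2.integrable_comp_emb m2).2 h1

/-- The slab is an interval of half-width ε/r about -a/r, so the average is a difference quotient of
a primitive of g. -/
theorem tendsto_interval_average {g : ℝ → ℂ} (hg : Continuous g) {r : ℝ} (hr : 0 < r) (a : ℝ) :
    Tendsto (fun ε : ℝ => (((2 * ε)⁻¹ : ℝ) : ℂ) * ∫ x in {x : ℝ | |r * x + a| < ε}, g x)
      (𝓝[>] 0) (𝓝 (g (-a / r) / r)) := by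
  set x₀ : ℝ := -a / r
  have hset : ∀ ε : ℝ, {x : ℝ | |r * x + a| < ε} = Set.Ioo (x₀ - ε / r) (x₀ + ε / r) := by
    intro ε
    ext x
    have hx0 : r * x₀ = -a := by simp only [x₀]; field_simp
    rw [Set.mem_ofPred_eq, abs_lt, Set.mem_Ioo, ← mul_lt_mul_iff_right₀ hr (b := x₀ - ε / r),
      ← mul_lt_mul_iff_right₀ hr (c := x₀ + ε / r), mul_sub, mul_add, hx0, mul_div_cancel₀ _ hr.ne']
    constructor <;> rintro ⟨h1, h2⟩ <;> constructor <;> linarith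
  set Φ : ℝ → ℂ := fun t => ∫ x in x₀..t, g x
  have hΦ : ∀ t, HasDerivAt Φ (g t) t := fun t =>
    intervalIntegral.integral_hasDerivAt_right (hg.intervalIntegrable _ _)
      (hg.stronglyMeasurableAtFilter _ _) hg.continuousAt
  set Ψ : ℝ → ℂ := fun ε => Φ (x₀ + ε / r) - Φ (x₀ - ε / r)
  have hΨ : HasDerivAt Ψ (2 * (g x₀ / r)) 0 := by
    have d1 : HasDerivAt (fun ε : ℝ => x₀ + ε / r) (1 / r) 0 :=
      ((hasDerivAt_id (0 : ℝ)).div_const r).const_add x₀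
    have d2 : HasDerivAt (fun ε : ℝ => x₀ - ε / r) (-(1 / r)) 0 :=
      ((hasDerivAt_id (0 : ℝ)).div_const r).const_sub x₀
    have h1 := (hΦ (x₀ + 0 / r)).scomp (0 : ℝ) d1
    have h2 := (hΦ (x₀ - 0 / r)).scomp (0 : ℝ) d2
    refine (h1.sub h2).congr_deriv ?_
    simp only [zero_div, add_zero, sub_zero, Complex.real_smul]
    push_cast
    ring
  have hslope := hΨ.tendsto_slope_zero_right
  have hlim : Tendsto (fun ε : ℝ => (1 / 2 : ℂ) * (ε⁻¹ • (Ψ (0 + ε) - Ψ 0))) (𝓝[>] 0)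
      (𝓝 ((1 / 2 : ℂ) * (2 * (g x₀ / r)))) := hslope.const_mul _
  have h2 : (1 / 2 : ℂ) * (2 * (g x₀ / r)) = g x₀ / r := by ring
  rw [h2] at hlim
  refine hlim.congr' ?_
  filter_upwards [self_mem_nhdsWithin] with ε hε
  have hε' : 0 < ε := hε
  have hle : x₀ - ε / r ≤ x₀ + ε / r := by
    have : 0 < ε / r := by positivity
    linarith
  have h0 : Ψ 0 = 0 := by simp [Ψ]
  rw [hset, ← integral_Ioc_eq_integral_Ioo, ← intervalIntegral.integral_of_le hle, h0, zero_add,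
    sub_zero, ← intervalIntegral.integral_interval_sub_left (a := x₀)
      (hg.intervalIntegrable _ _) (hg.intervalIntegrable _ _), Complex.real_smul]
  simp only [Ψ, Φ]
  push_cast
  rw [mul_inv]
  ring

theorem continuous_integral_line {B : Plane → ℂ} (hB : Continuous B) (hBc : HasCompactSupport B) :
    Continuous fun x : ℝ => ∫ y : ℝ, B !₂[x, y] := by
  obtain ⟨ρ, hρ⟩ := hBc.isCompact.isBounded.subset_closedBall (0 : Plane)
  have h : ∀ x : ℝ, ∫ y : ℝ, B !₂[x, y] = ∫ y in Set.Icc (-ρ) ρ, B !₂[x, y] := fun x => by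
    refine (setIntegral_eq_integral_of_forall_compl_eq_zero fun y hy => ?_).symm
    by_contra hne
    have h1 := hρ (subset_tsupport _ hne)
    rw [mem_closedBall_zero_iff] at h1
    have h2 : |y| ≤ ‖(!₂[x, y] : Plane)‖ := PiLp.norm_apply_le (!₂[x, y] : Plane) 1
    exact hy (abs_le.1 (h2.trans h1))
  simp only [h]
  exact continuous_parametric_integral_of_continuous (f := fun x y => B !₂[x, y])
    (hB.comp continuous_toPlane) isCompact_Icc

/-- Rotating v onto the first axis makes the slab a vertical strip; the inner integral over vertical
lines is continuous, and the one-dimensional average applies. -/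
theorem exists_tendsto_slab_average {B : Plane → ℂ} (hB : Continuous B) (hBc : HasCompactSupport B)
    {v : Plane} (hv : v ≠ 0) (a : ℝ) :
    ∃ L : ℂ, Tendsto (fun ε : ℝ => (((2 * ε)⁻¹ : ℝ) : ℂ) *
      ∫ z in {z : Plane | |inner ℝ v z + a| < ε}, B z) (𝓝[>] 0) (𝓝 L) := by
  set w : ℂ := ⟨v 0, v 1⟩
  have hw : w ≠ 0 := by
    intro h
    refine hv ?_
    ext i
    fin_cases i
    · exact congrArg Complex.re h
    · exact congrArg Complex.im h
  have hr : 0 < ‖w‖ := norm_pos_iff.2 hw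
  set α : ℝ := Complex.arg w
  have hin : ∀ z, inner ℝ v (planeRot α z) = ‖w‖ * z 0 := fun z => by
    have h1 : ‖w‖ * Real.cos α = v 0 := Complex.norm_mul_cos_arg w
    have h2 : ‖w‖ * Real.sin α = v 1 := Complex.norm_mul_sin_arg w
    rw [inner_plane, planeRot_apply]
    simp only [Matrix.cons_val_zero, Matrix.cons_val_one]
    rw [← h1, ← h2]
    linear_combination ‖w‖ * z 0 * Real.sin_sq_add_cos_sq α
  set B' : Plane → ℂ := fun z => B (planeRot α z)
  have hB' : Continuous B' := hB.comp (planeRot α).continuous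
  have hBc' : HasCompactSupport B' := hBc.comp_homeomorph (planeRot α).toHomeomorph
  refine ⟨_, (tendsto_interval_average (continuous_integral_line hB' hBc') hr a).congr fun ε => ?_⟩
  congr 1
  have hS : MeasurableSet {z : Plane | |inner ℝ v z + a| < ε} :=
    measurableSet_lt (by fun_prop) measurable_const
  have hS' : MeasurableSet {z : Plane | |‖w‖ * z 0 + a| < ε} :=
    measurableSet_lt (by fun_prop) measurable_const
  have hT : MeasurableSet {x : ℝ | |‖w‖ * x + a| < ε} :=
    measurableSet_lt (by fun_prop) measurable_const
  have e := (measurePreserving_planeRot α).integral_comp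
    (planeRot α).toHomeomorph.measurableEmbedding
    ({z : Plane | |inner ℝ v z + a| < ε}.indicator B)
  have e' : ∀ z, {z : Plane | |inner ℝ v z + a| < ε}.indicator B (planeRot α z)
      = {z : Plane | |‖w‖ * z 0 + a| < ε}.indicator B' z := fun z => by
    by_cases hz : |‖w‖ * z 0 + a| < ε
    · rw [Set.indicator_of_mem (by rw [Set.mem_ofPred_eq, hin]; exact hz),
        Set.indicator_of_mem (by exact hz)]
    · rw [Set.indicator_of_notMem (by rw [Set.mem_ofPred_eq, hin]; exact hz),
        Set.indicator_of_notMem (by exact hz)]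
  rw [← integral_indicator hS, ← e]
  simp only [e']
  rw [integral_plane ((hB'.integrable_of_hasCompactSupport hBc').indicator hS'),
    ← integral_indicator hT]
  refine integral_congr_ae (ae_of_all _ fun x => ?_)
  by_cases hx : |‖w‖ * x + a| < ε
  · rw [Set.indicator_of_mem (by exact hx)]
    refine integral_congr_ae (ae_of_all _ fun y => ?_)
    exact (Set.indicator_of_mem (s := {z : Plane | |‖w‖ * z 0 + a| < ε})
      (a := !₂[x, y]) (by exact hx) B').symm
  · rw [Set.indicator_of_notMem (by exact hx)]
    refine (integral_eq_zero_of_ae (ae_of_all _ fun y => ?_)).symm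
    exact Set.indicator_of_notMem (s := {z : Plane | |‖w‖ * z 0 + a| < ε})
      (a := !₂[x, y]) (by exact hx) B'

/-- A function within any δ of convergent ones satisfies the Cauchy criterion. No relation between
the limits `L` for different δ is required. -/
theorem exists_tendsto_of_approx {ι : Type*} {l : Filter ι} [l.NeBot] {M : ι → ℂ}
    (h : ∀ δ > 0, ∃ (N : ι → ℂ) (L : ℂ), Tendsto N l (𝓝 L) ∧ ∀ᶠ x in l, ‖M x - N x‖ ≤ δ) :
    ∃ L, Tendsto M l (𝓝 L) := by
  rw [← cauchy_map_iff_exists_tendsto, Metric.cauchy_iff]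
  refine ⟨inferInstance, fun δ hδ => ?_⟩
  obtain ⟨N, L, hN, hMN⟩ := h (δ / 5) (by positivity)
  have hN' : ∀ᶠ x in l, dist (N x) L < δ / 5 := Metric.tendsto_nhds.1 hN _ (by positivity)
  refine ⟨M '' {x | ‖M x - N x‖ ≤ δ / 5 ∧ dist (N x) L < δ / 5},
    image_mem_map (hMN.and hN'), ?_⟩
  rintro _ ⟨x, ⟨hx1, hx2⟩, rfl⟩ _ ⟨y, ⟨hy1, hy2⟩, rfl⟩
  rw [← dist_eq_norm] at hx1 hy1
  have h1 := dist_triangle4 (M x) (N x) (N y) (M y)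
  have h2 := dist_triangle_right (N x) (N y) L
  rw [dist_comm (N y)] at h1
  linarith

/-- The mean over the slab of width `ε` around the resonant set. -/
noncomputable def slabMean (s₁ s₂ c : ℝ) (F G : Plane → ℂ) (k : Plane × Plane → ℂ) (ε : ℝ) : ℂ :=
  (((2 * ε)⁻¹ : ℝ) : ℂ) * ∫ p in {p | |phaseGap s₁ s₂ c p| < ε}, F p.1 * G p.2 * k p

theorem measurableSet_slab (s₁ s₂ c ε : ℝ) :
    MeasurableSet {p : Plane × Plane | |phaseGap s₁ s₂ c p| < ε} := by
  have := continuous_phaseGap s₁ s₂ c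
  exact measurableSet_lt (by fun_prop) measurable_const

theorem slabMean_swap (s₁ s₂ c : ℝ) (F G : Plane → ℂ) (k : Plane × Plane → ℂ) (ε : ℝ) :
    slabMean s₁ s₂ c F G k ε = slabMean s₂ s₁ c G F (fun p => k p.swap) ε := by
  unfold slabMean
  congr 1
  rw [← integral_indicator (measurableSet_slab ..), ← integral_indicator (measurableSet_slab ..),
    Measure.volume_eq_prod, ← integral_prod_swap]
  refine integral_congr_ae (ae_of_all _ fun p => ?_)
  beta_reduce
  by_cases hp : |phaseGap s₂ s₁ c p| < ε
  · rw [Set.indicator_of_mem (by rw [Set.mem_ofPred_eq, phaseGap_swap]; exact hp),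
      Set.indicator_of_mem (by exact hp)]
    simp only [Prod.fst_swap, Prod.snd_swap, mul_comm (F _)]
  · rw [Set.indicator_of_notMem (by rw [Set.mem_ofPred_eq, phaseGap_swap]; exact hp),
      Set.indicator_of_notMem (by exact hp)]

/-- The function is supported in a slight enlargement of the annulus `|ξ| ≈ X`. -/
def NearAnnulus (X : ℝ) (F : Plane → ℂ) : Prop :=
  ∀ η, F η ≠ 0 → 7 / 16 * X ≤ ‖η‖ ∧ ‖η‖ ≤ 4 * X

/-! ### Bounds for slab means uniform in the width -/

section SlabMean

variable {s₁ s₂ c X Y : ℝ}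

theorem lintegral_slab_le (h₁ : s₁ = 1 ∨ s₁ = -1) (h₂ : s₂ = 1 ∨ s₂ = -1)
    (h₁₂ : ¬ (s₁ = -1 ∧ s₂ = -1)) (hX : 0 < X) (hY : 0 < Y) (hc : |c| ≤ X * Y / 4)
    {F G : Plane → ℂ} (hF : NearAnnulus X F) (hG : NearAnnulus Y G) {k : Plane × Plane → ℂ}
    (hk : ∀ p, k p ≠ 0 → max X Y / 2 ≤ ‖p.1 + p.2‖) {ε : ℝ} (hε : ε ≤ X * Y / 16) :
    ∫⁻ p in {p | |phaseGap s₁ s₂ c p| < ε}, ‖F p.1 * G p.2 * k p‖ₑ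
      ≤ ∫⁻ p in transverseSet s₁ s₂ c ε (X * Y / 10) (4 * X) (4 * Y),
          ‖F p.1‖ₑ * ‖G p.2‖ₑ * {p | |phaseGap s₁ s₂ c p| < ε}.indicator (fun p => ‖k p‖ₑ) p := by
  rw [← lintegral_indicator (measurableSet_slab ..),
    ← lintegral_indicator (measurableSet_transverseSet ..)]
  refine lintegral_mono fun p => ?_
  by_cases hp : |phaseGap s₁ s₂ c p| < ε
  · rw [Set.indicator_of_mem (by exact hp)]
    by_cases h0 : F p.1 * G p.2 * k p = 0
    · simp [h0]
    · have hFG := left_ne_zero_of_mul h0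
      have hF' := hF _ (left_ne_zero_of_mul hFG)
      have hG' := hG _ (right_ne_zero_of_mul hFG)
      have hk' := hk _ (right_ne_zero_of_mul h0)
      have hmem : p ∈ transverseSet s₁ s₂ c ε (X * Y / 10) (4 * X) (4 * Y) :=
        ⟨hp, le_abs_planeCross h₁ h₂ h₁₂ hX hY hc hε hF'.1 hG'.1 hk' hp, hF'.2, hG'.2⟩
      rw [Set.indicator_of_mem hmem, Set.indicator_of_mem (by exact hp), enorm_mul, enorm_mul]
  · rw [Set.indicator_of_notMem (by exact hp)]
    exact zero_le

theorem enorm_slabMean_le {F G : Plane → ℂ} {k : Plane × Plane → ℂ} {ε : ℝ} (hε : 0 < ε)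
    {A : ENNReal} (hA : ∫⁻ p in {p | |phaseGap s₁ s₂ c p| < ε}, ‖F p.1 * G p.2 * k p‖ₑ ≤ A) :
    ‖slabMean s₁ s₂ c F G k ε‖ₑ ≤ ENNReal.ofReal ((2 * ε)⁻¹) * A := by
  rw [slabMean, enorm_mul, ← ofReal_norm, Complex.norm_real, Real.norm_of_nonneg (by positivity)]
  exact mul_le_mul' le_rfl ((enorm_integral_le_lintegral_enorm _).trans hA)

/-- With m = XY/10 and radii 4X, 4Y, the two fibre bounds multiply to (2560 ε)²: the frequencies
cancel, and so does ε once the slab mean divides by 2ε. -/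
theorem lintegral_slab_le_of_bound (h₁ : s₁ = 1 ∨ s₁ = -1) (h₂ : s₂ = 1 ∨ s₂ = -1)
    (h₁₂ : ¬ (s₁ = -1 ∧ s₂ = -1)) (hX : 0 < X) (hY : 0 < Y) (hc : |c| ≤ X * Y / 4)
    {F G : Plane → ℂ} (hFm : Measurable F) (hGm : Measurable G)
    (hF : NearAnnulus X F) (hG : NearAnnulus Y G) {k : Plane × Plane → ℂ}
    (hk : ∀ p, k p ≠ 0 → max X Y / 2 ≤ ‖p.1 + p.2‖) {ε : ℝ} (hε0 : 0 < ε) (hε : ε ≤ X * Y / 16)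
    {B : ℝ} (hkB : ∀ p, |phaseGap s₁ s₂ c p| < ε → ‖k p‖ ≤ B) :
    ∫⁻ p in {p | |phaseGap s₁ s₂ c p| < ε}, ‖F p.1 * G p.2 * k p‖ₑ
      ≤ ENNReal.ofReal (2560 * ε) * (eLpNorm F 2 volume * eLpNorm G 2 volume) *
        ENNReal.ofReal B := by
  refine (lintegral_slab_le h₁ h₂ h₁₂ hX hY hc hF hG hk hε).trans ?_
  calc _ ≤ ∫⁻ p in transverseSet s₁ s₂ c ε (X * Y / 10) (4 * X) (4 * Y),
          ‖F p.1‖ₑ * ‖G p.2‖ₑ * ENNReal.ofReal B := by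
        refine lintegral_mono fun p => mul_le_mul' le_rfl ?_
        by_cases hp : |phaseGap s₁ s₂ c p| < ε
        · rw [Set.indicator_of_mem (by exact hp), ← ofReal_norm]
          exact ENNReal.ofReal_le_ofReal (hkB p hp)
        · rw [Set.indicator_of_notMem (by exact hp)]
          exact zero_le
    _ = (∫⁻ p in transverseSet s₁ s₂ c ε (X * Y / 10) (4 * X) (4 * Y),
          ‖F p.1‖ₑ * ‖G p.2‖ₑ) * ENNReal.ofReal B :=
        lintegral_mul_const' _ _ ENNReal.ofReal_ne_top
    _ ≤ _ := by
        refine mul_le_mul_left ?_ _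
        rw [← ENNReal.pow_le_pow_left_iff two_ne_zero]
        refine (lintegral_transverse_mul_sq_le (by positivity) (by positivity) (by positivity)
          hFm.enorm hGm.enorm).trans (le_of_eq ?_)
        rw [← eLpNorm_two_sq, ← eLpNorm_two_sq, ← ENNReal.ofReal_mul (by positivity),
          mul_pow (ENNReal.ofReal _), mul_pow (eLpNorm F 2 volume),
          ← ENNReal.ofReal_pow (by positivity)]
        congr 2
        field_simp; norm_num

theorem enorm_slabMean_le_of_bound (h₁ : s₁ = 1 ∨ s₁ = -1) (h₂ : s₂ = 1 ∨ s₂ = -1)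
    (h₁₂ : ¬ (s₁ = -1 ∧ s₂ = -1)) (hX : 0 < X) (hY : 0 < Y) (hc : |c| ≤ X * Y / 4)
    {F G : Plane → ℂ} (hFm : Measurable F) (hGm : Measurable G)
    (hF : NearAnnulus X F) (hG : NearAnnulus Y G) {k : Plane × Plane → ℂ}
    (hk : ∀ p, k p ≠ 0 → max X Y / 2 ≤ ‖p.1 + p.2‖) {ε : ℝ} (hε0 : 0 < ε) (hε : ε ≤ X * Y / 16)
    {B : ℝ} (hkB : ∀ p, |phaseGap s₁ s₂ c p| < ε → ‖k p‖ ≤ B) :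
    ‖slabMean s₁ s₂ c F G k ε‖ₑ
      ≤ ENNReal.ofReal 1280 * (eLpNorm F 2 volume * eLpNorm G 2 volume) * ENNReal.ofReal B := by
  refine (enorm_slabMean_le hε0 (lintegral_slab_le_of_bound h₁ h₂ h₁₂ hX hY hc hFm hGm hF hG hk
    hε0 hε hkB)).trans (le_of_eq ?_)
  rw [← mul_assoc, ← mul_assoc, ← ENNReal.ofReal_mul (by positivity)]
  congr 3
  field_simp; norm_num

theorem integrableOn_slab (h₁ : s₁ = 1 ∨ s₁ = -1) (h₂ : s₂ = 1 ∨ s₂ = -1)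
    (h₁₂ : ¬ (s₁ = -1 ∧ s₂ = -1)) (hX : 0 < X) (hY : 0 < Y) (hc : |c| ≤ X * Y / 4)
    {F G : Plane → ℂ} (hFm : Measurable F) (hGm : Measurable G)
    (hF2 : MemLp F 2 volume) (hG2 : MemLp G 2 volume)
    (hF : NearAnnulus X F) (hG : NearAnnulus Y G) {k : Plane × Plane → ℂ} (hkm : Measurable k)
    (hk : ∀ p, k p ≠ 0 → max X Y / 2 ≤ ‖p.1 + p.2‖) {ε : ℝ} (hε0 : 0 < ε) (hε : ε ≤ X * Y / 16)
    {B : ℝ} (hkB : ∀ p, |phaseGap s₁ s₂ c p| < ε → ‖k p‖ ≤ B) :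
    IntegrableOn (fun p : Plane × Plane => F p.1 * G p.2 * k p)
      {p | |phaseGap s₁ s₂ c p| < ε} := by
  refine ⟨(by fun_prop : Measurable fun p : Plane × Plane => F p.1 * G p.2 * k p).aestronglyMeasurable,
    lt_of_le_of_lt (lintegral_slab_le_of_bound h₁ h₂ h₁₂ hX hY hc hFm hGm hF hG hk hε0 hε hkB) ?_⟩
  exact ENNReal.mul_lt_top (ENNReal.mul_lt_top ENNReal.ofReal_lt_top
    (ENNReal.mul_lt_top hF2.eLpNorm_lt_top hG2.eLpNorm_lt_top)) ENNReal.ofReal_lt_top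

end SlabMean

/-! ### Existence of the limit of slab means and its angular bound -/

section Convergence

variable {s₁ s₂ c X Y : ℝ}

theorem MeasureTheory.MemLp.integrable_of_bounded_support {F : Plane → ℂ} (hF2 : MemLp F 2 volume)
    {R : ℝ} (hF : ∀ η, F η ≠ 0 → ‖η‖ ≤ R) : Integrable F := by
  have h : IntegrableOn F (Metric.closedBall 0 R) :=
    (hF2.locallyIntegrable (by norm_num)).integrableOn_isCompact (isCompact_closedBall _ _)
  refine (integrableOn_iff_integrable_of_support_subset fun η hη => ?_).1 h
  rw [mem_closedBall_zero_iff]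
  exact hF η hη

/-- The slab mean in the second variable only. -/
noncomputable def fiberMean (s₁ s₂ c : ℝ) (G H : Plane → ℂ) (ε : ℝ) (η : Plane) : ℂ :=
  (((2 * ε)⁻¹ : ℝ) : ℂ) * ∫ ζ in {ζ | |phaseGap s₁ s₂ c (η, ζ)| < ε}, G ζ * H (η + ζ)

theorem measurableSet_slab_fiber (s₁ s₂ c ε : ℝ) (η : Plane) :
    MeasurableSet {ζ : Plane | |phaseGap s₁ s₂ c (η, ζ)| < ε} := by
  have h : Continuous fun ζ : Plane => phaseGap s₁ s₂ c (η, ζ) :=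
    (continuous_phaseGap s₁ s₂ c).comp (by fun_prop)
  exact measurableSet_lt h.abs.measurable measurable_const

theorem mul_fiberMean_eq (s₁ s₂ c : ℝ) (F G H : Plane → ℂ) (ε : ℝ) (η : Plane) :
    F η * fiberMean s₁ s₂ c G H ε η = (((2 * ε)⁻¹ : ℝ) : ℂ) *
      ∫ ζ, {p : Plane × Plane | |phaseGap s₁ s₂ c p| < ε}.indicator
        (fun p => F p.1 * G p.2 * H (p.1 + p.2)) (η, ζ) := by
  rw [fiberMean, mul_left_comm, ← integral_const_mul,
    ← integral_indicator (measurableSet_slab_fiber ..)]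
  congr 1
  refine integral_congr_ae (ae_of_all _ fun ζ => ?_)
  beta_reduce
  by_cases h : |phaseGap s₁ s₂ c (η, ζ)| < ε
  · rw [Set.indicator_of_mem (by exact h), Set.indicator_of_mem (by exact h), mul_assoc]
  · rw [Set.indicator_of_notMem (by exact h), Set.indicator_of_notMem (by exact h)]

theorem norm_fiberMean_le (h₁ : s₁ = 1 ∨ s₁ = -1) (h₂ : s₂ = 1 ∨ s₂ = -1)
    (h₁₂ : ¬ (s₁ = -1 ∧ s₂ = -1)) (hX : 0 < X) (hY : 0 < Y) (hc : |c| ≤ X * Y / 4)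
    {G H : Plane → ℂ} (hG : NearAnnulus Y G) (hH : ∀ ξ, H ξ ≠ 0 → max X Y / 2 ≤ ‖ξ‖)
    {A B : ℝ} (hGA : ∀ ζ, ‖G ζ‖ ≤ A) (hHB : ∀ ξ, ‖H ξ‖ ≤ B) {ε : ℝ} (hε0 : 0 < ε)
    (hε : ε ≤ X * Y / 16) {η : Plane} (hη : 7 / 16 * X ≤ ‖η‖ ∧ ‖η‖ ≤ 4 * X) :
    ‖fiberMean s₁ s₂ c G H ε η‖ ≤ 1280 * Y / X * (A * B) := by
  have hA : 0 ≤ A := (norm_nonneg _).trans (hGA 0)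
  have hB : 0 ≤ B := (norm_nonneg _).trans (hHB 0)
  have hT : MeasurableSet {ζ | (η, ζ) ∈ transverseSet s₁ s₂ c ε (X * Y / 10) (4 * X) (4 * Y)} :=
    (by fun_prop : Measurable fun ζ : Plane => (η, ζ)) (measurableSet_transverseSet ..)
  have hI : ‖∫ ζ in {ζ | |phaseGap s₁ s₂ c (η, ζ)| < ε}, G ζ * H (η + ζ)‖ₑ
      ≤ ENNReal.ofReal (2560 * Y / X * ε) * ENNReal.ofReal (A * B) := by
    refine (enorm_integral_le_lintegral_enorm _).trans ?_
    calc _ ≤ ∫⁻ ζ in {ζ | (η, ζ) ∈ transverseSet s₁ s₂ c ε (X * Y / 10) (4 * X) (4 * Y)},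
            ENNReal.ofReal (A * B) := by
          rw [← lintegral_indicator (measurableSet_slab_fiber ..), ← lintegral_indicator hT]
          refine lintegral_mono fun ζ => ?_
          by_cases hp : |phaseGap s₁ s₂ c (η, ζ)| < ε
          · rw [Set.indicator_of_mem (by exact hp)]
            by_cases h0 : G ζ * H (η + ζ) = 0
            · simp [h0]
            · have hG' := hG _ (left_ne_zero_of_mul h0)
              have hH' := hH _ (right_ne_zero_of_mul h0)
              have hmem : (η, ζ) ∈ transverseSet s₁ s₂ c ε (X * Y / 10) (4 * X) (4 * Y) :=
                ⟨hp, le_abs_planeCross h₁ h₂ h₁₂ hX hY hc hε hη.1 hG'.1 hH' hp, hη.2, hG'.2⟩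
              rw [Set.indicator_of_mem (by exact hmem), ← ofReal_norm, norm_mul]
              refine ENNReal.ofReal_le_ofReal ?_
              exact mul_le_mul (hGA _) (hHB _) (norm_nonneg _) hA
          · rw [Set.indicator_of_notMem (by exact hp)]
            exact zero_le
      _ ≤ _ := by
          rw [setLIntegral_const, mul_comm]
          refine mul_le_mul_left ((volume_transverse_snd_fiber_le (by positivity) (by positivity)
            η).trans (ENNReal.ofReal_le_ofReal (le_of_eq ?_))) _
          field_simp; norm_num
  rw [← ENNReal.ofReal_mul (by positivity), ← ofReal_norm,
    ENNReal.ofReal_le_ofReal_iff (by positivity)] at hI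
  rw [fiberMean, norm_mul, Complex.norm_real, Real.norm_of_nonneg (by positivity)]
  calc _ ≤ (2 * ε)⁻¹ * (2560 * Y / X * ε * (A * B)) := by gcongr
    _ = _ := by field_simp; ring

/-- When the second point lies on P the terms |ζ|² cancel: the gap is -2⟨η, ζ⟩ plus a constant, so
for η ≠ 0 the fibre of the slab is a strip around a line. -/
theorem exists_tendsto_fiberMean {G H : Plane → ℂ} (hGc : Continuous G) (hGs : HasCompactSupport G)
    (hHc : Continuous H) {η : Plane} (hη : η ≠ 0) :
    ∃ L, Tendsto (fun ε => fiberMean s₁ 1 c G H ε η) (𝓝[>] 0) (𝓝 L) := by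
  have hB : Continuous fun ζ => G ζ * H (η + ζ) := by fun_prop
  obtain ⟨L, hL⟩ := exists_tendsto_slab_average hB hGs.mul_right
    (v := (-2 : ℝ) • η) (smul_ne_zero (by norm_num) hη) (s₁ * ‖η‖ ^ 2 - ‖η‖ ^ 2 - c)
  refine ⟨L, hL.congr fun ε => ?_⟩
  have : {z : Plane | |inner ℝ ((-2 : ℝ) • η) z + (s₁ * ‖η‖ ^ 2 - ‖η‖ ^ 2 - c)| < ε}
      = {ζ | |phaseGap s₁ 1 c (η, ζ)| < ε} := by
    ext ζ
    simp only [Set.mem_ofPred_eq, phaseGap, norm_add_sq_real, inner_smul_left]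
    have : ∀ a b : ℝ, a = b → (|a| < ε ↔ |b| < ε) := fun a b h => by rw [h]
    refine this _ _ ?_
    simp only [conj_trivial]; ring
  rw [fiberMean, this]

/-- Fubini writes the slab mean as ∫ F(η) times the fibre mean at η. The fibre means converge
pointwise and are bounded uniformly by transversality, so dominated convergence applies; F only has
to be integrable. -/
theorem exists_tendsto_slabMean_of_continuous (h₁ : s₁ = 1 ∨ s₁ = -1)
    (hX : 0 < X) (hY : 0 < Y) (hc : |c| ≤ X * Y / 4) {F G H : Plane → ℂ}
    (hF2 : MemLp F 2 volume) (hF : NearAnnulus X F)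
    (hGc : Continuous G) (hGs : HasCompactSupport G) (hG : NearAnnulus Y G)
    (hHc : Continuous H) (hHs : HasCompactSupport H) (hH : ∀ ξ, H ξ ≠ 0 → max X Y / 2 ≤ ‖ξ‖) :
    ∃ L, Tendsto (slabMean s₁ 1 c F G fun p => H (p.1 + p.2)) (𝓝[>] 0) (𝓝 L) := by
  obtain ⟨A, hA⟩ := hGc.bounded_above_of_compact_support hGs
  obtain ⟨B, hB⟩ := hHc.bounded_above_of_compact_support hHs
  have hFi := hF2.integrable_of_bounded_support fun η hη => (hF η hη).2
  have hint : Integrable (fun p : Plane × Plane => F p.1 * G p.2 * H (p.1 + p.2))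
      (volume.prod volume) := by
    have h1 := hFi.mul_prod (hGc.integrable_of_hasCompactSupport hGs (μ := volume))
    have h2 : Integrable (fun p : Plane × Plane => H (p.1 + p.2) * (F p.1 * G p.2))
        (volume.prod volume) :=
      h1.bdd_mul (c := B) (by
        have : Continuous fun p : Plane × Plane => H (p.1 + p.2) := by fun_prop
        exact this.aestronglyMeasurable) (ae_of_all _ fun p => hB _)
    simpa only [mul_comm (H _)] using h2
  have hind := fun ε => hint.indicator (measurableSet_slab s₁ 1 c ε)
  have hcomp : ∀ ε, slabMean s₁ 1 c F G (fun p => H (p.1 + p.2)) ε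
      = ∫ η, F η * fiberMean s₁ 1 c G H ε η := fun ε => by
    simp only [mul_fiberMean_eq]
    rw [integral_const_mul, slabMean, ← integral_indicator (measurableSet_slab ..),
      Measure.volume_eq_prod, integral_prod _ (hind ε)]
  have hlim : ∀ η, ∃ L, Tendsto (fun ε => F η * fiberMean s₁ 1 c G H ε η) (𝓝[>] 0) (𝓝 L) :=
    fun η => by
    by_cases h0 : F η = 0
    · exact ⟨0, by simp [h0]⟩
    · have hη : η ≠ 0 := by
        rintro rfl
        have := (hF 0 h0).1
        rw [norm_zero] at this
        linarith
      obtain ⟨L, hL⟩ := exists_tendsto_fiberMean (s₁ := s₁) (c := c) hGc hGs hHc hη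
      exact ⟨F η * L, hL.const_mul _⟩
  choose L hL using hlim
  refine ⟨∫ η, L η, Tendsto.congr (fun ε => (hcomp ε).symm) ?_⟩
  refine tendsto_integral_filter_of_dominated_convergence
    (fun η => ‖F η‖ * (1280 * Y / X * (A * B))) ?_ ?_ (hFi.norm.mul_const _)
    (ae_of_all _ hL)
  · refine Eventually.of_forall fun ε => ?_
    simp only [mul_fiberMean_eq]
    exact ((hind ε).aestronglyMeasurable.integral_prod_right').const_mul _
  · have hev : ∀ᶠ ε : ℝ in 𝓝[>] 0, 0 < ε ∧ ε ≤ X * Y / 16 := by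
      have : Set.Ioc (0 : ℝ) (X * Y / 16) ∈ 𝓝[>] (0 : ℝ) := Ioc_mem_nhdsGT (by positivity)
      exact this
    filter_upwards [hev] with ε hε
    refine ae_of_all _ fun η => ?_
    rw [norm_mul]
    by_cases h0 : F η = 0
    · simp [h0]
    · gcongr
      exact norm_fiberMean_le h₁ (Or.inl rfl) (by norm_num) hX hY hc hG hH hA hB hε.1 hε.2 (hF η h0)

/-- A continuous cutoff to the annulus `|ξ| ≈ Y`. -/
noncomputable def annulusBump (Y : ℝ) (ζ : Plane) : ℝ :=
  max 0 (min 1 (16 / Y * ‖ζ‖ - 7)) * max 0 (min 1 (2 - ‖ζ‖ / (2 * Y)))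

theorem continuous_annulusBump (Y : ℝ) : Continuous (annulusBump Y) := by
  unfold annulusBump; fun_prop

theorem abs_annulusBump_le (Y : ℝ) (ζ : Plane) : |annulusBump Y ζ| ≤ 1 := by
  have h1 : ∀ x : ℝ, 0 ≤ max 0 (min 1 x) ∧ max 0 (min 1 x) ≤ 1 := fun x =>
    ⟨le_max_left _ _, max_le zero_le_one (min_le_left _ _)⟩
  rw [annulusBump, abs_mul, abs_of_nonneg (h1 _).1, abs_of_nonneg (h1 _).1]
  exact mul_le_one₀ (h1 _).2 (h1 _).1 (h1 _).2

theorem annulusBump_eq_one {Y : ℝ} (hY : 0 < Y) {ζ : Plane} (hζ : Y / 2 ≤ ‖ζ‖ ∧ ‖ζ‖ ≤ 2 * Y) :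
    annulusBump Y ζ = 1 := by
  have h1 : 1 ≤ 16 / Y * ‖ζ‖ - 7 := by
    have : 16 / Y * (Y / 2) ≤ 16 / Y * ‖ζ‖ := by gcongr; exact hζ.1
    have h2 : 16 / Y * (Y / 2) = 8 := by field_simp; norm_num
    linarith
  have h2 : 1 ≤ 2 - ‖ζ‖ / (2 * Y) := by
    have : ‖ζ‖ / (2 * Y) ≤ 1 := (div_le_one (by positivity)).2 hζ.2
    linarith
  simp [annulusBump, min_eq_left h1, min_eq_left h2]

theorem annulusBump_ne_zero {Y : ℝ} (hY : 0 < Y) {ζ : Plane} (hζ : annulusBump Y ζ ≠ 0) :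
    7 / 16 * Y ≤ ‖ζ‖ ∧ ‖ζ‖ ≤ 4 * Y := by
  have h0 : ∀ x : ℝ, max 0 (min 1 x) ≠ 0 → 0 < x := fun x hx => by
    by_contra h
    push Not at h
    exact hx (max_eq_left ((min_le_right _ _).trans h))
  have h1 := h0 _ (left_ne_zero_of_mul hζ)
  have h2 := h0 _ (right_ne_zero_of_mul hζ)
  constructor
  · have h3 : 7 < 16 / Y * ‖ζ‖ := by linarith
    rw [div_mul_eq_mul_div, lt_div_iff₀ hY] at h3
    linarith
  · have h3 : ‖ζ‖ / (2 * Y) < 2 := by linarith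
    rw [div_lt_iff₀ (by positivity)] at h3
    linarith

/-- Continuous approximants may leave the annulus, so they are multiplied by a bump equal to 1 on
it. The bump needs room, which is why `NearAnnulus` uses 7/16 and 4 instead of 1/2 and 2; (7/16)²
still exceeds the 5/32 of `le_abs_planeCross`. -/
theorem exists_continuous_nearAnnulus_approx (hY : 0 < Y) {G : Plane → ℂ} (hG2 : MemLp G 2 volume)
    (hG : ∀ ζ, G ζ ≠ 0 → Y / 2 ≤ ‖ζ‖ ∧ ‖ζ‖ ≤ 2 * Y) {δ : ENNReal} (hδ : δ ≠ 0) :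
    ∃ G' : Plane → ℂ, Continuous G' ∧ HasCompactSupport G' ∧ NearAnnulus Y G' ∧
      eLpNorm (G - G') 2 volume ≤ δ := by
  obtain ⟨G₀, hs, hn, hc, -⟩ := hG2.exists_hasCompactSupport_eLpNorm_sub_le (by norm_num) hδ
  refine ⟨fun ζ => (annulusBump Y ζ : ℂ) * G₀ ζ, ?_, hs.mul_left, ?_, ?_⟩
  · have := continuous_annulusBump Y
    fun_prop
  · intro ζ hζ
    refine annulusBump_ne_zero hY fun h => ?_
    exact left_ne_zero_of_mul hζ (by simp [h])
  · refine (eLpNorm_mono fun ζ => ?_).trans hn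
    have : G ζ = (annulusBump Y ζ : ℂ) * G ζ := by
      by_cases h : G ζ = 0
      · simp [h]
      · simp [annulusBump_eq_one hY (hG ζ h)]
    rw [Pi.sub_apply, Pi.sub_apply, this, ← mul_sub, norm_mul, Complex.norm_real, ← this]
    exact mul_le_of_le_one_left (norm_nonneg _) (abs_annulusBump_le Y ζ)

theorem NearAnnulus.of_annulus (hX : 0 < X) {F : Plane → ℂ}
    (hF : ∀ η, F η ≠ 0 → X / 2 ≤ ‖η‖ ∧ ‖η‖ ≤ 2 * X) : NearAnnulus X F := fun η hη => by
  have := hF η hη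
  constructor <;> linarith [this.1, this.2]

theorem NearAnnulus.sub {F G : Plane → ℂ} (hF : NearAnnulus X F) (hG : NearAnnulus X G) :
    NearAnnulus X (F - G) := fun η hη => by
  by_cases h : F η = 0
  · refine hG η fun h' => hη ?_
    simp [h, h']
  · exact hF η h

theorem exists_tendsto_slabMean_of_right (h₁ : s₁ = 1 ∨ s₁ = -1)
    (hX : 0 < X) (hY : 0 < Y) (hc : |c| ≤ X * Y / 4) {F G H : Plane → ℂ}
    (hFm : Measurable F) (hGm : Measurable G) (hF2 : MemLp F 2 volume) (hG2 : MemLp G 2 volume)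
    (hF : ∀ η, F η ≠ 0 → X / 2 ≤ ‖η‖ ∧ ‖η‖ ≤ 2 * X)
    (hG : ∀ ζ, G ζ ≠ 0 → Y / 2 ≤ ‖ζ‖ ∧ ‖ζ‖ ≤ 2 * Y)
    (hHc : Continuous H) (hHs : HasCompactSupport H) (hH : ∀ ξ, H ξ ≠ 0 → max X Y / 2 ≤ ‖ξ‖) :
    ∃ L, Tendsto (slabMean s₁ 1 c F G fun p => H (p.1 + p.2)) (𝓝[>] 0) (𝓝 L) := by
  obtain ⟨B, hB⟩ := hHc.bounded_above_of_compact_support hHs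
  have hB0 : 0 ≤ B := (norm_nonneg _).trans (hB 0)
  have hF' := NearAnnulus.of_annulus hX hF
  have hG' := NearAnnulus.of_annulus hY hG
  have hev : ∀ᶠ ε : ℝ in 𝓝[>] 0, 0 < ε ∧ ε ≤ X * Y / 16 := by
    have : Set.Ioc (0 : ℝ) (X * Y / 16) ∈ 𝓝[>] (0 : ℝ) := Ioc_mem_nhdsGT (by positivity)
    exact this
  refine exists_tendsto_of_approx fun δ hδ => ?_
  set a : ℝ := (eLpNorm F 2 volume).toReal
  have ha : eLpNorm F 2 volume = ENNReal.ofReal a :=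
    (ENNReal.ofReal_toReal hF2.eLpNorm_lt_top.ne).symm
  have ha0 : 0 ≤ a := ENNReal.toReal_nonneg
  -- The error in the slab mean is at most 1280 ‖F‖ δ' B; adding 1 to ‖F‖ and to B avoids division
  -- by zero.
  set δ' : ℝ := δ / (1280 * (a + 1) * (B + 1))
  have hδ' : 0 < δ' := by positivity
  obtain ⟨G₁, hGc₁, hGs₁, hG₁, hGn⟩ := exists_continuous_nearAnnulus_approx hY hG2 hG
    (δ := ENNReal.ofReal δ') (ENNReal.ofReal_pos.2 hδ').ne'
  obtain ⟨L, hL⟩ := exists_tendsto_slabMean_of_continuous h₁ hX hY hc hF2 hF' hGc₁ hGs₁ hG₁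
    hHc hHs hH
  refine ⟨_, L, hL, ?_⟩
  filter_upwards [hev] with ε hε
  have hkm : Measurable fun p : Plane × Plane => H (p.1 + p.2) := by fun_prop
  have hk : ∀ p : Plane × Plane, H (p.1 + p.2) ≠ 0 → max X Y / 2 ≤ ‖p.1 + p.2‖ := fun p => hH _
  have hkB : ∀ p : Plane × Plane, |phaseGap s₁ 1 c p| < ε → ‖H (p.1 + p.2)‖ ≤ B :=
    fun p _ => hB _
  have hne : ¬ (s₁ = -1 ∧ (1 : ℝ) = -1) := by norm_num
  have hd : slabMean s₁ 1 c F G (fun p => H (p.1 + p.2)) ε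
      - slabMean s₁ 1 c F G₁ (fun p => H (p.1 + p.2)) ε
      = slabMean s₁ 1 c F (G - G₁) (fun p => H (p.1 + p.2)) ε := by
    simp only [slabMean]
    rw [← mul_sub, ← integral_sub
      (integrableOn_slab h₁ (Or.inl rfl) hne hX hY hc hFm hGm hF2 hG2 hF' hG' hkm hk hε.1 hε.2 hkB)
      (integrableOn_slab h₁ (Or.inl rfl) hne hX hY hc hFm hGc₁.measurable hF2
        (hGc₁.memLp_of_hasCompactSupport hGs₁) hF' hG₁ hkm hk hε.1 hε.2 hkB)]
    congr 2
    ext p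
    simp only [Pi.sub_apply]; ring
  rw [hd]
  have hb := enorm_slabMean_le_of_bound h₁ (Or.inl rfl) hne hX hY hc hFm
    (hGm.sub hGc₁.measurable) hF' (hG'.sub hG₁) hk hε.1 hε.2 hkB
  have hb2 : ‖slabMean s₁ 1 c F (G - G₁) (fun p => H (p.1 + p.2)) ε‖ₑ
      ≤ ENNReal.ofReal (1280 * (a * δ') * B) := by
    refine hb.trans ?_
    rw [ENNReal.ofReal_mul (by positivity), ENNReal.ofReal_mul (by positivity),
      ENNReal.ofReal_mul ha0, ha]
    gcongr
  rw [← ofReal_norm, ENNReal.ofReal_le_ofReal_iff (by positivity)] at hb2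
  refine hb2.trans ?_
  calc 1280 * (a * δ') * B ≤ 1280 * ((a + 1) * δ') * (B + 1) := by gcongr <;> linarith
    _ = δ := by simp only [δ']; field_simp

/-- At least one of the two points lies on P, and the swap symmetry puts it in the second place,
where the gap is affine. -/
theorem exists_tendsto_slabMean (h₁ : s₁ = 1 ∨ s₁ = -1) (h₂ : s₂ = 1 ∨ s₂ = -1)
    (h₁₂ : ¬ (s₁ = -1 ∧ s₂ = -1)) (hX : 0 < X) (hY : 0 < Y) (hc : |c| ≤ X * Y / 4)
    {F G H : Plane → ℂ}
    (hFm : Measurable F) (hGm : Measurable G) (hF2 : MemLp F 2 volume) (hG2 : MemLp G 2 volume)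
    (hF : ∀ η, F η ≠ 0 → X / 2 ≤ ‖η‖ ∧ ‖η‖ ≤ 2 * X)
    (hG : ∀ ζ, G ζ ≠ 0 → Y / 2 ≤ ‖ζ‖ ∧ ‖ζ‖ ≤ 2 * Y)
    (hHc : Continuous H) (hHs : HasCompactSupport H) (hH : ∀ ξ, H ξ ≠ 0 → max X Y / 2 ≤ ‖ξ‖) :
    ∃ L, Tendsto (slabMean s₁ s₂ c F G fun p => H (p.1 + p.2)) (𝓝[>] 0) (𝓝 L) := by
  rcases h₂ with rfl | rfl
  · exact exists_tendsto_slabMean_of_right h₁ hX hY hc hFm hGm hF2 hG2 hF hG hHc hHs hH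
  · rcases h₁ with rfl | rfl
    · obtain ⟨L, hL⟩ := exists_tendsto_slabMean_of_right (s₁ := -1) (c := c) (Or.inr rfl) hY hX
        (by rwa [mul_comm]) hGm hFm hG2 hF2 hG hF hHc hHs (by simpa only [max_comm] using hH)
      refine ⟨L, hL.congr fun ε => ?_⟩
      rw [slabMean_swap]
      simp only [Prod.fst_swap, Prod.snd_swap, add_comm]
    · exact absurd ⟨rfl, rfl⟩ h₁₂

theorem enorm_slabMean_le_of_angBound (h₁ : s₁ = 1 ∨ s₁ = -1) (h₂ : s₂ = 1 ∨ s₂ = -1)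
    (h₁₂ : ¬ (s₁ = -1 ∧ s₂ = -1)) (hX : 0 < X) (hY : 0 < Y) (hc : |c| ≤ X * Y / 4)
    {F G H : Plane → ℂ} (hFm : Measurable F) (hGm : Measurable G) (hHm : Measurable H)
    (hF : NearAnnulus X F) (hG : NearAnnulus Y G) (hH : ∀ ξ, H ξ ≠ 0 → max X Y / 2 ≤ ‖ξ‖)
    {M : Plane → ENNReal} (hM : Measurable M) (hFM : ∀ᵐ η, ‖F η‖ₑ ≤ angBound M η)
    {N : ENNReal} (hN : ∫⁻ η, M η ^ 2 ≤ N ^ 2) {ε : ℝ} (hε0 : 0 < ε) (hε : ε ≤ X * Y / 16) :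
    ‖slabMean s₁ s₂ c F G (fun p => H (p.1 + p.2)) ε‖ₑ
      ≤ ENNReal.ofReal (320 / max X Y) * (N * eLpNorm G 2 volume * eLpNorm H 2 volume) := by
  have hXY : 0 < max X Y := lt_max_of_lt_left hX
  have hA : ∫⁻ p in {p | |phaseGap s₁ s₂ c p| < ε}, ‖F p.1 * G p.2 * H (p.1 + p.2)‖ₑ
      ≤ ENNReal.ofReal (640 * ε / max X Y) * (N * eLpNorm G 2 volume * eLpNorm H 2 volume) := by
    refine (lintegral_slab_le (k := fun p => H (p.1 + p.2)) h₁ h₂ h₁₂ hX hY hc hF hG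
      (fun p => hH _) hε).trans ?_
    calc _ ≤ ∫⁻ p in transverseSet s₁ s₂ c ε (X * Y / 10) (4 * X) (4 * Y),
          ‖F p.1‖ₑ * ‖G p.2‖ₑ * ‖H (p.1 + p.2)‖ₑ :=
          lintegral_mono fun p => mul_le_mul' le_rfl
            (Set.indicator_le_self _ (fun p : Plane × Plane => ‖H (p.1 + p.2)‖ₑ) p)
      _ ≤ ENNReal.ofReal (640 * ε / max X Y) *
          (N * eLpNorm G 2 volume * eLpNorm H 2 volume) := by
        rw [← ENNReal.pow_le_pow_left_iff two_ne_zero]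
        refine (lintegral_transverse_conv_sq_le (H := fun ξ => ‖H ξ‖ₑ) h₁ h₂ (by positivity)
          (by positivity) (by positivity) hFm.enorm hGm.enorm hHm.enorm hM hFM).trans ?_
        rw [← eLpNorm_two_sq, ← eLpNorm_two_sq, ← ENNReal.ofReal_mul (by positivity),
          ← ENNReal.ofReal_mul (by positivity), mul_pow (ENNReal.ofReal _),
          mul_pow (N * eLpNorm G 2 volume), mul_pow N, ← ENNReal.ofReal_pow (by positivity)]
        refine mul_le_mul' (ENNReal.ofReal_le_ofReal ?_) (by gcongr)
        -- Rewriting the minimum as XY/max cancels the transversality constant XY/10, leaving π ·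
        -- 102400 (ε/max)² ≤ (640 ε/max)² because π ≤ 4.
        have hmin : min (4 * X) (4 * Y) = 4 * (X * Y) / max X Y := by
          rw [← mul_min_of_nonneg _ _ (by norm_num : (0 : ℝ) ≤ 4), ← min_mul_max X Y]
          field_simp
        rw [hmin]
        have : 2 * Real.pi * (2 * ε / (X * Y / 10)) *
            (16 * ε * (4 * (X * Y) / max X Y) ^ 2 / (X * Y / 10))
            = Real.pi * 102400 * (ε / max X Y) ^ 2 := by
          field_simp; norm_num
        rw [this, mul_div_assoc, mul_pow]
        gcongr
        linarith [Real.pi_le_four]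
  refine (enorm_slabMean_le hε0 hA).trans (le_of_eq ?_)
  rw [← mul_assoc, ← ENNReal.ofReal_mul (by positivity)]
  congr 2
  field_simp; norm_num

end Convergence

/-- A functional on compactly supported continuous functions that is bounded in `L²(ν)` is given by
an `L²(ν)` function. -/
theorem exists_L2_density_of_compactSupport {ν : Measure Plane} [ν.Regular] {K : ℝ} (hK : 0 ≤ K)
    (T : (Plane → ℂ) → ℂ)
    (hadd : ∀ h₁ h₂ : Plane → ℂ, Continuous h₁ → HasCompactSupport h₁ → Continuous h₂ →
      HasCompactSupport h₂ → T (h₁ + h₂) = T h₁ + T h₂)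
    (hsmul : ∀ (a : ℂ) (h : Plane → ℂ), Continuous h → HasCompactSupport h → T (a • h) = a * T h)
    (hb : ∀ h : Plane → ℂ, Continuous h → HasCompactSupport h →
      ‖T h‖ₑ ≤ ENNReal.ofReal K * eLpNorm h 2 ν) :
    ∃ G : Plane → ℂ, MemLp G 2 ν ∧ eLpNorm G 2 ν ≤ ENNReal.ofReal K ∧
      ∀ h : Plane → ℂ, Continuous h → HasCompactSupport h → T h = ∫ x, G x * h x ∂ν := by
  have hmem : ∀ h : CompactlySupportedContinuousMap Plane ℂ, MemLp h 2 ν := fun h =>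
    h.continuous.memLp_of_hasCompactSupport h.hasCompactSupport
  set e : CompactlySupportedContinuousMap Plane ℂ →ₗ[ℂ] Lp ℂ 2 ν :=
    { toFun := fun h => (hmem h).toLp h
      map_add' := fun h₁ h₂ => (hmem h₁).toLp_add (hmem h₂)
      map_smul' := fun a h => (hmem h).toLp_const_smul a }
  set t : CompactlySupportedContinuousMap Plane ℂ →ₗ[ℂ] ℂ :=
    { toFun := fun h => T h
      map_add' := fun h₁ h₂ =>
        hadd h₁ h₂ h₁.continuous h₁.hasCompactSupport h₂.continuous h₂.hasCompactSupport
      map_smul' := fun a h => hsmul a h h.continuous h.hasCompactSupport }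
  -- Density of compactly supported continuous functions in L²(ν) lets the bounded functional extend
  -- before Riesz is applied.
  have hdense : DenseRange e := fun u => by
    rw [EMetric.mem_closure_iff]
    intro ε hε
    obtain ⟨δ, hδ0, hδ⟩ := exists_between hε
    obtain ⟨g, hgs, hg, hgc, hg2⟩ :=
      (Lp.memLp u).exists_hasCompactSupport_eLpNorm_sub_le (by norm_num) hδ0.ne'
    refine ⟨_, ⟨⟨⟨g, hgc⟩, hgs⟩, rfl⟩, lt_of_le_of_lt ?_ hδ⟩
    rw [Lp.edist_def]
    refine (le_of_eq (eLpNorm_congr_ae ?_)).trans hg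
    exact (EventuallyEq.refl _ _).sub hg2.coeFn_toLp
  have hnorm : ∀ h, ‖t h‖ ≤ K * ‖e h‖ := fun h => by
    have h1 := hb h h.continuous h.hasCompactSupport
    rw [← ENNReal.ofReal_toReal (hmem h).eLpNorm_lt_top.ne, ← ENNReal.ofReal_mul hK,
      ← ofReal_norm, ENNReal.ofReal_le_ofReal_iff (by positivity)] at h1
    rw [show ‖e h‖ = (eLpNorm h 2 ν).toReal from Lp.norm_toLp _ (hmem h)]
    exact h1
  obtain ⟨G, hG2, hGn, hG⟩ := exists_L2_density_of_linearMap (t.extendOfNorm e)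
    (LinearMap.opNorm_extendOfNorm_le hdense hK hnorm)
  refine ⟨G, hG2, hGn, fun h hc hs => ?_⟩
  have h1 := LinearMap.extendOfNorm_eq hdense ⟨K, hnorm⟩ ⟨⟨h, hc⟩, hs⟩
  rw [hG] at h1
  refine h1.symm.trans (integral_congr_ae ?_)
  filter_upwards [(hmem ⟨⟨h, hc⟩, hs⟩).coeFn_toLp] with x hx
  exact congrArg _ hx

/-! ### The angular derivative in the coordinate `ξ` -/

theorem rot_mul_snd {ψ : Plane → ℂ} {b : ℝ → ℝ} (hψ : ContDiff ℝ ∞ ψ) (hb : ContDiff ℝ ∞ b)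
    (x : Freq) : rot (fun x => ψ x.1 * (b x.2 : ℂ)) x = planeAngDeriv ψ x.1 * (b x.2 : ℂ) := by
  have h1 : HasFDerivAt (fun x : Freq => ψ x.1)
      ((fderiv ℝ ψ x.1).comp (ContinuousLinearMap.fst ℝ Plane ℝ)) x :=
    ((hψ.differentiable (by simp)) x.1).hasFDerivAt.comp x hasFDerivAt_fst
  have h2 : HasFDerivAt (fun x : Freq => (b x.2 : ℂ))
      ((fderiv ℝ (fun t => (b t : ℂ)) x.2).comp (ContinuousLinearMap.snd ℝ Plane ℝ)) x :=
    (((Complex.ofRealCLM.contDiff.comp hb).differentiable (by simp)) x.2).hasFDerivAt.comp x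
      hasFDerivAt_snd
  rw [rot, (h1.fun_mul h2).fderiv, planeAngDeriv, rotField]
  simp [mul_comm]

/-- The weak angular derivative of a localized function, in the coordinate `ξ`. -/
theorem exists_planeDensity_weakRot {s X : ℝ} (hs : s = 1 ∨ s = -1) (hX : 1 ≤ X)
    {f Rf : Freq → ℂ} {F : Plane → ℂ} (hRf : MemLp Rf 2 (parabMeasure s 0))
    (hweak : IsWeakRot (parabMeasure s 0) f Rf) (hF : ∀ η, F η ≠ 0 → ‖η‖ ≤ 2 * X)
    (hFae : F =ᵐ[volume] fun η => (surfWeight η : ℂ) * f (parabPoint s 0 η)) :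
    ∃ RF : Plane → ℂ, Measurable RF ∧ Integrable RF ∧
      eLpNorm RF 2 volume ≤ ENNReal.ofReal √(8 * X) * eLpNorm Rf 2 (parabMeasure s 0) ∧
      ∀ ψ : Plane → ℂ, ContDiff ℝ ∞ ψ → HasCompactSupport ψ →
        ∫ η, F η * planeAngDeriv ψ η = -∫ η, RF η * ψ η := by
  have hX0 : 0 < X := by linarith
  -- Test functions on the paraboloid are built as ψ(ξ) b(τ). Since |τ| = |ξ|² ≤ 4X² on the support
  -- of F, b equals 1 there, and rotations do not act on τ, so b adds no derivative term.
  let b : ContDiffBump (0 : ℝ) := ⟨4 * X ^ 2, 8 * X ^ 2, by positivity, by nlinarith⟩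
  have habs : ∀ η : Plane, |s * ‖η‖ ^ 2| = ‖η‖ ^ 2 := fun η => by
    rcases hs with rfl | rfl <;> simp
  have hb1 : ∀ η : Plane, ‖η‖ ≤ 2 * X → b (s * ‖η‖ ^ 2) = 1 := fun η hη => by
    refine b.one_of_mem_closedBall ?_
    rw [mem_closedBall_zero_iff, Real.norm_eq_abs, habs]
    have : ‖η‖ ^ 2 ≤ (2 * X) ^ 2 := by gcongr
    change ‖η‖ ^ 2 ≤ 4 * X ^ 2
    linarith
  have hb0 : ∀ t : ℝ, 8 * X ^ 2 ≤ |t| → b t = 0 := fun t ht => by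
    refine b.zero_of_le_dist ?_
    rwa [dist_zero_right, Real.norm_eq_abs]
  -- Nothing is assumed about the support of `Rf`; the factor b supplies the localization, to |ξ|² <
  -- 8X², hence to |ξ| ≤ 3X.
  set R₀ : Plane → ℂ := fun η =>
    (b (s * ‖η‖ ^ 2) : ℂ) * ((surfWeight η : ℂ) * Rf (parabPoint s 0 η))
  have hbc : Continuous fun η : Plane => (b (s * ‖η‖ ^ 2) : ℂ) :=
    Complex.continuous_ofReal.comp (b.continuous.comp (by fun_prop))
  have hm : AEStronglyMeasurable R₀ volume :=
    hbc.aestronglyMeasurable.mul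
      ((Complex.continuous_ofReal.comp continuous_surfWeight).aestronglyMeasurable.mul
        (aestronglyMeasurable_comp_parabPoint hRf.1))
  set A : Set Plane := Metric.closedBall 0 (3 * X)
  set RF : Plane → ℂ := A.indicator (hm.mk _)
  have hRm : Measurable RF := hm.measurable_mk.indicator measurableSet_closedBall
  have hRs : ∀ η, RF η ≠ 0 → ‖η‖ ≤ 3 * X := fun η hη => by
    rw [← mem_closedBall_zero_iff]
    exact Set.mem_of_indicator_ne_zero hη
  have hRae : RF =ᵐ[volume] R₀ := by
    filter_upwards [hm.ae_eq_mk] with η h1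
    by_cases hη : η ∈ A
    · rw [h1]; exact Set.indicator_of_mem hη _
    · have hη' := hη
      rw [mem_closedBall_zero_iff, not_le] at hη'
      have : b (s * ‖η‖ ^ 2) = 0 := hb0 _ (by rw [habs]; nlinarith)
      rw [show RF η = 0 from Set.indicator_of_notMem hη _]
      simp [R₀, this]
  have hRn : eLpNorm RF 2 volume
      -- The scale 8X/5 is admissible because 3X ≤ 2 · (8X/5).
      ≤ ENNReal.ofReal √(5 * (8 / 5 * X)) * eLpNorm Rf 2 (parabMeasure s 0) := by
    refine eLpNorm_le_parabMeasure (by linarith) (fun η hη => (hRs η hη).trans (by linarith)) ?_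
    filter_upwards [hRae] with η h1
    rw [h1, norm_mul, norm_mul, Complex.norm_real, Complex.norm_real,
      Real.norm_of_nonneg (surfWeight_pos η).le, Real.norm_of_nonneg b.nonneg]
    exact mul_le_of_le_one_left (mul_nonneg (surfWeight_pos η).le (norm_nonneg _)) b.le_one
  rw [show 5 * (8 / 5 * X) = 8 * X by ring] at hRn
  have hR2 : MemLp RF 2 volume := ⟨hRm.aestronglyMeasurable,
    hRn.trans_lt (ENNReal.mul_lt_top ENNReal.ofReal_lt_top hRf.eLpNorm_lt_top)⟩
  refine ⟨RF, hRm, hR2.integrable_of_bounded_support hRs, hRn, fun ψ hψ hψc => ?_⟩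
  have key := hweak (fun x => ψ x.1 * (b x.2 : ℂ)) ?_ ?_
  · simp only [rot_mul_snd hψ b.contDiff, integral_parabMeasure] at key
    calc _ = ∫ η, (surfWeight η : ℂ) * (f (parabPoint s 0 η) *
          (planeAngDeriv ψ (parabPoint s 0 η).1 * (b (parabPoint s 0 η).2 : ℂ))) := by
          refine integral_congr_ae ?_
          filter_upwards [hFae] with η h1
          simp only [parabPoint, add_zero] at h1 ⊢
          by_cases hη : F η = 0
          · rw [hη, ← mul_assoc, ← h1, hη, zero_mul, zero_mul]
          · rw [hb1 η (hF η hη), h1]; push_cast; ring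
      _ = _ := by
          rw [key]
          congr 1
          refine integral_congr_ae ?_
          filter_upwards [hRae] with η h1
          rw [h1]
          simp only [parabPoint, add_zero, R₀]
          ring
  · exact (hψ.comp contDiff_fst).mul
      (Complex.ofRealCLM.contDiff.comp (b.contDiff.comp contDiff_snd))
  · refine HasCompactSupport.intro (K := tsupport ψ ×ˢ Metric.closedBall 0 (8 * X ^ 2))
      (hψc.isCompact.prod (isCompact_closedBall _ _)) fun x hx => ?_
    by_cases h1 : x.1 ∈ tsupport ψ
    · have h2 : x.2 ∉ Metric.closedBall (0 : ℝ) (8 * X ^ 2) := fun h => hx ⟨h1, h⟩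
      rw [mem_closedBall_zero_iff, not_le, Real.norm_eq_abs] at h2
      rw [hb0 _ h2.le]; simp
    · rw [image_eq_zero_of_notMem_tsupport h1, zero_mul]

/-! ### The trace on the paraboloid -/

section Trace

variable {s₁ s₂ c X Y : ℝ}

theorem eventually_small_slab (hX : 0 < X) (hY : 0 < Y) :
    ∀ᶠ ε : ℝ in 𝓝[>] 0, 0 < ε ∧ ε ≤ X * Y / 16 := by
  have : Set.Ioc (0 : ℝ) (X * Y / 16) ∈ 𝓝[>] (0 : ℝ) := Ioc_mem_nhdsGT (by positivity)
  exact this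

theorem slabMean_add {F G : Plane → ℂ} {k₁ k₂ : Plane × Plane → ℂ} {ε : ℝ}
    (i₁ : IntegrableOn (fun p => F p.1 * G p.2 * k₁ p) {p | |phaseGap s₁ s₂ c p| < ε})
    (i₂ : IntegrableOn (fun p => F p.1 * G p.2 * k₂ p) {p | |phaseGap s₁ s₂ c p| < ε}) :
    slabMean s₁ s₂ c F G (fun p => k₁ p + k₂ p) ε
      = slabMean s₁ s₂ c F G k₁ ε + slabMean s₁ s₂ c F G k₂ ε := by
  simp only [slabMean, mul_add]
  rw [integral_add i₁ i₂, mul_add]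

theorem slabMean_const_mul {F G : Plane → ℂ} {k : Plane × Plane → ℂ} {ε : ℝ} (a : ℂ) :
    slabMean s₁ s₂ c F G (fun p => a * k p) ε = a * slabMean s₁ s₂ c F G k ε := by
  simp only [slabMean]
  rw [mul_left_comm a, ← integral_const_mul a]
  simp only [mul_left_comm a]

/-- Slab averages of the density of the convolution. -/
theorem slab_average_eq_slabMean {F G : Plane → ℂ} {l k : Freq → ℂ} (hk : Continuous k)
    (hks : HasCompactSupport k)
    (hlh : ∀ h : Freq → ℂ, MemLp h 2 volume →
      ∫ p : Plane × Plane, F p.1 * G p.2 * h (convPoint s₁ s₂ p) = ∫ x, l x * h x) (ε : ℝ) :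
    (((2 * ε)⁻¹ : ℝ) : ℂ) * ∫ x in {x : Freq | |x.2 - ‖x.1‖ ^ 2 - c| < ε}, l x * k x
      = slabMean s₁ s₂ c F G (fun p => k (convPoint s₁ s₂ p)) ε := by
  have hS : MeasurableSet {x : Freq | |x.2 - ‖x.1‖ ^ 2 - c| < ε} :=
    measurableSet_lt (by fun_prop) measurable_const
  have hmem : ∀ p : Plane × Plane,
      convPoint s₁ s₂ p ∈ {x : Freq | |x.2 - ‖x.1‖ ^ 2 - c| < ε}
        ↔ p ∈ {p | |phaseGap s₁ s₂ c p| < ε} := fun p => by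
    simp only [Set.mem_ofPred_eq, convPoint_eq, phaseGap]
  have h := hlh ({x : Freq | |x.2 - ‖x.1‖ ^ 2 - c| < ε}.indicator k)
    ((hk.memLp_of_hasCompactSupport hks).indicator hS)
  rw [slabMean, ← integral_indicator hS, ← integral_indicator (measurableSet_slab ..)]
  congr 1
  calc _ = ∫ x, l x * {x : Freq | |x.2 - ‖x.1‖ ^ 2 - c| < ε}.indicator k x :=
        integral_congr_ae (ae_of_all _ fun x => Set.indicator_mul_right _ l k)
    _ = _ := by
        rw [← h]
        refine integral_congr_ae (ae_of_all _ fun p => ?_)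
        beta_reduce
        by_cases hp : p ∈ {p | |phaseGap s₁ s₂ c p| < ε}
        · rw [Set.indicator_of_mem hp, Set.indicator_of_mem ((hmem p).2 hp)]
        · rw [Set.indicator_of_notMem hp, Set.indicator_of_notMem (mt (hmem p).1 hp), mul_zero]

theorem dist_convPoint_parabPoint (p : Plane × Plane) :
    dist (convPoint s₁ s₂ p) (parabPoint 1 c (p.1 + p.2)) = |phaseGap s₁ s₂ c p| := by
  rw [convPoint_eq, parabPoint, Prod.dist_eq, dist_self, max_eq_right dist_nonneg, Real.dist_eq,
    phaseGap]
  congr 1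
  ring

theorem continuous_comp_parabPoint {h : Freq → ℂ} (hh : Continuous h) :
    Continuous fun ξ => h (parabPoint 1 c ξ) := hh.comp (continuous_parabPoint 1 c)

theorem hasCompactSupport_comp_parabPoint {h : Freq → ℂ} (hh : HasCompactSupport h) :
    HasCompactSupport fun ξ => h (parabPoint 1 c ξ) := by
  refine HasCompactSupport.intro (hh.isCompact.image continuous_fst) fun ξ hξ => ?_
  exact image_eq_zero_of_notMem_tsupport fun h1 => hξ ⟨_, h1, rfl⟩

/-- In slab averages, a continuous function may be replaced by its values on the paraboloid. -/
theorem tendsto_slabMean_of_trace (h₁ : s₁ = 1 ∨ s₁ = -1) (h₂ : s₂ = 1 ∨ s₂ = -1)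
    (h₁₂ : ¬ (s₁ = -1 ∧ s₂ = -1)) (hX : 0 < X) (hY : 0 < Y) (hc : |c| ≤ X * Y / 4)
    {F G χ : Plane → ℂ} (hFm : Measurable F) (hGm : Measurable G)
    (hF2 : MemLp F 2 volume) (hG2 : MemLp G 2 volume)
    (hF : NearAnnulus X F) (hG : NearAnnulus Y G)
    (hχ : Continuous χ) (hχs : ∀ ξ, χ ξ ≠ 0 → max X Y / 2 ≤ ‖ξ‖) {B : ℝ} (hχB : ∀ ξ, ‖χ ξ‖ ≤ B)
    {h : Freq → ℂ} (hh : Continuous h) (hhs : HasCompactSupport h) {L : ℂ}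
    (hL : Tendsto (slabMean s₁ s₂ c F G fun p => χ (p.1 + p.2) * h (parabPoint 1 c (p.1 + p.2)))
      (𝓝[>] 0) (𝓝 L)) :
    Tendsto (slabMean s₁ s₂ c F G fun p => χ (p.1 + p.2) * h (convPoint s₁ s₂ p))
      (𝓝[>] 0) (𝓝 L) := by
  have hB : 0 ≤ B := (norm_nonneg _).trans (hχB 0)
  obtain ⟨D, hD⟩ := hh.bounded_above_of_compact_support hhs
  have hcp := continuous_convPoint s₁ s₂
  have hpp := continuous_parabPoint 1 c
  set k₁ : Plane × Plane → ℂ := fun p => χ (p.1 + p.2) * h (parabPoint 1 c (p.1 + p.2))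
  set k₂ : Plane × Plane → ℂ := fun p => χ (p.1 + p.2) * h (convPoint s₁ s₂ p)
  have hk₁ : Continuous k₁ := by fun_prop
  have hk₂ : Continuous k₂ := by fun_prop
  have hs₁ : ∀ p, k₁ p ≠ 0 → max X Y / 2 ≤ ‖p.1 + p.2‖ := fun p hp => hχs _ (left_ne_zero_of_mul hp)
  have hs₂ : ∀ p, k₂ p ≠ 0 → max X Y / 2 ≤ ‖p.1 + p.2‖ := fun p hp => hχs _ (left_ne_zero_of_mul hp)
  have hd : Tendsto (slabMean s₁ s₂ c F G fun p => k₂ p + -1 * k₁ p) (𝓝[>] 0) (𝓝 0) := by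
    set A := (eLpNorm F 2 volume * eLpNorm G 2 volume).toReal
    have hA : eLpNorm F 2 volume * eLpNorm G 2 volume = ENNReal.ofReal A :=
      (ENNReal.ofReal_toReal
        (ENNReal.mul_ne_top hF2.eLpNorm_lt_top.ne hG2.eLpNorm_lt_top.ne)).symm
    have hA0 : 0 ≤ A := ENNReal.toReal_nonneg
    rw [Metric.tendsto_nhds]
    intro δ hδ
    -- The two points over the same ξ are at distance |`phaseGap`| < ε, so uniform continuity of h
    -- makes the integrands differ by little, and the uniform slab bound absorbs the difference.
    obtain ⟨r, hr, hur⟩ := Metric.uniformContinuous_iff.1 (hhs.uniformContinuous_of_continuous hh)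
      (δ / (1280 * A * B + 1)) (by positivity)
    have hev : ∀ᶠ ε : ℝ in 𝓝[>] 0, ε ≤ r := by
      have : Set.Ioc (0 : ℝ) r ∈ 𝓝[>] (0 : ℝ) := Ioc_mem_nhdsGT hr
      filter_upwards [this] with ε hε using hε.2
    filter_upwards [hev, eventually_small_slab hX hY] with ε hεr hε
    have hb := enorm_slabMean_le_of_bound h₁ h₂ h₁₂ hX hY hc hFm hGm hF hG
      (k := fun p => k₂ p + -1 * k₁ p) (B := B * (δ / (1280 * A * B + 1)))
      (fun p hp => hχs _ fun h0 => hp (by simp [k₁, k₂, h0])) hε.1 hε.2 (fun p hp => by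
        have hu := hur ((dist_convPoint_parabPoint p).trans_lt (hp.trans_le hεr))
        rw [dist_eq_norm] at hu
        rw [show k₂ p + -1 * k₁ p = χ (p.1 + p.2) *
          (h (convPoint s₁ s₂ p) - h (parabPoint 1 c (p.1 + p.2))) by simp only [k₁, k₂]; ring,
          norm_mul]
        exact mul_le_mul (hχB _) hu.le (norm_nonneg _) hB)
    rw [hA, ← ENNReal.ofReal_mul (by norm_num), ← ENNReal.ofReal_mul (by positivity), ← ofReal_norm,
      ENNReal.ofReal_le_ofReal_iff (by positivity)] at hb
    rw [dist_zero_right]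
    refine hb.trans_lt ?_
    rw [show 1280 * A * (B * (δ / (1280 * A * B + 1)))
      = (1280 * A * B) * δ / (1280 * A * B + 1) by ring, div_lt_iff₀ (by positivity)]
    nlinarith
  have hsum := hd.add hL
  rw [zero_add] at hsum
  refine hsum.congr' ?_
  filter_upwards [eventually_small_slab hX hY] with ε hε
  have i₁ := integrableOn_slab h₁ h₂ h₁₂ hX hY hc hFm hGm hF2 hG2 hF hG hk₁.measurable hs₁ hε.1 hε.2
    (B := B * D) fun p _ => by
      rw [norm_mul]; exact mul_le_mul (hχB _) (hD _) (norm_nonneg _) hB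
  have i₂ := integrableOn_slab h₁ h₂ h₁₂ hX hY hc hFm hGm hF2 hG2 hF hG hk₂.measurable hs₂ hε.1 hε.2
    (B := B * D) fun p _ => by
      rw [norm_mul]; exact mul_le_mul (hχB _) (hD _) (norm_nonneg _) hB
  have i₃ : IntegrableOn (fun p => F p.1 * G p.2 * (-1 * k₁ p)) {p | |phaseGap s₁ s₂ c p| < ε} := by
    simp only [mul_left_comm _ (-1 : ℂ)]
    exact i₁.const_mul (-1)
  rw [slabMean_add i₂ i₃, slabMean_const_mul]
  ring

/-- The density of the convolution, cut off near `|ξ| ≈ max X Y`, has a trace in `L²`. -/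
theorem exists_trace (h₁ : s₁ = 1 ∨ s₁ = -1) (h₂ : s₂ = 1 ∨ s₂ = -1)
    (h₁₂ : ¬ (s₁ = -1 ∧ s₂ = -1)) (hX : 0 < X) (hY : 0 < Y) (hc : |c| ≤ X * Y / 4)
    {F G χ : Plane → ℂ} (hFm : Measurable F) (hGm : Measurable G)
    (hF2 : MemLp F 2 volume) (hG2 : MemLp G 2 volume)
    (hF : ∀ η, F η ≠ 0 → X / 2 ≤ ‖η‖ ∧ ‖η‖ ≤ 2 * X)
    (hG : ∀ ζ, G ζ ≠ 0 → Y / 2 ≤ ‖ζ‖ ∧ ‖ζ‖ ≤ 2 * Y)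
    (hχ : Continuous χ) (hχs : ∀ ξ, χ ξ ≠ 0 → max X Y / 2 ≤ ‖ξ‖ ∧ ‖ξ‖ ≤ 2 * max X Y)
    {B : ℝ} (hχB : ∀ ξ, ‖χ ξ‖ ≤ B)
    {M : Plane → ENNReal} (hM : Measurable M) (hFM : ∀ᵐ η, ‖F η‖ₑ ≤ angBound M η)
    {N : ENNReal} (hN : ∫⁻ η, M η ^ 2 ≤ N ^ 2) (hNtop : N ≠ ⊤) {l : Freq → ℂ}
    (hlh : ∀ h : Freq → ℂ, MemLp h 2 volume →
      ∫ p : Plane × Plane, F p.1 * G p.2 * h (convPoint s₁ s₂ p) = ∫ x, l x * h x) :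
    ∃ G₀ : Plane → ℂ, AEStronglyMeasurable G₀ volume ∧ (∀ ξ, G₀ ξ ≠ 0 → ‖ξ‖ ≤ 2 * max X Y) ∧
      eLpNorm G₀ 2 volume ≤ ENNReal.ofReal (320 / max X Y * B) * (N * eLpNorm G 2 volume) ∧
      IsRestriction c (fun x => χ x.1 * l x) fun x => G₀ x.1 := by
  have hB : 0 ≤ B := (norm_nonneg _).trans (hχB 0)
  have hXY : 0 < max X Y := lt_max_of_lt_left hX
  have hF' := NearAnnulus.of_annulus hX hF
  have hG' := NearAnnulus.of_annulus hY hG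
  set ball : Set Plane := Metric.closedBall 0 (2 * max X Y)
  have hball : MeasurableSet ball := measurableSet_closedBall
  -- χ lives on this ball, so the functional sees h only there. Representing it over the restricted
  -- measure lets the trace be extended by zero, which provides its support.
  set ν : Measure Plane := volume.restrict ball
  have : IsFiniteMeasure ν := ⟨by
    rw [Measure.restrict_apply_univ]; exact (isCompact_closedBall _ _).measure_lt_top⟩
  set K : ℝ := 320 / max X Y * B * (N * eLpNorm G 2 volume).toReal
  have hNG : N * eLpNorm G 2 volume ≠ ⊤ := ENNReal.mul_ne_top hNtop hG2.eLpNorm_lt_top.ne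
  have hKof : ENNReal.ofReal K
      = ENNReal.ofReal (320 / max X Y * B) * (N * eLpNorm G 2 volume) := by
    rw [ENNReal.ofReal_mul (by positivity), ENNReal.ofReal_toReal hNG]
  -- The trace as a functional: the limit of the slab means of χh. Linearity follows from uniqueness
  -- of limits, and its L² bound from the angular estimate, which is uniform in ε.
  set T : (Plane → ℂ) → ℂ := fun h =>
    limUnder (𝓝[>] 0) (slabMean s₁ s₂ c F G fun p => χ (p.1 + p.2) * h (p.1 + p.2))
  have hT : ∀ h : Plane → ℂ, Continuous h → HasCompactSupport h →
      Tendsto (slabMean s₁ s₂ c F G fun p => χ (p.1 + p.2) * h (p.1 + p.2)) (𝓝[>] 0) (𝓝 (T h)) :=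
    fun h hh hhs => tendsto_nhds_limUnder (exists_tendsto_slabMean (H := fun ξ => χ ξ * h ξ)
      h₁ h₂ h₁₂ hX hY hc hFm hGm hF2 hG2 hF hG (hχ.mul hh) hhs.mul_left
      fun ξ hξ => (hχs ξ (left_ne_zero_of_mul hξ)).1)
  clear_value T
  have hint : ∀ h : Plane → ℂ, Continuous h → HasCompactSupport h → ∀ ε : ℝ, 0 < ε →
      ε ≤ X * Y / 16 → IntegrableOn
        (fun p : Plane × Plane => F p.1 * G p.2 * (χ (p.1 + p.2) * h (p.1 + p.2)))
        {p | |phaseGap s₁ s₂ c p| < ε} := fun h hh hhs ε hε0 hε => by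
    obtain ⟨D, hD⟩ := hh.bounded_above_of_compact_support hhs
    refine integrableOn_slab h₁ h₂ h₁₂ hX hY hc hFm hGm hF2 hG2 hF' hG'
      (k := fun p => χ (p.1 + p.2) * h (p.1 + p.2)) (B := B * D)
      (by fun_prop : Continuous fun p : Plane × Plane => χ (p.1 + p.2) * h (p.1 + p.2)).measurable
      (fun p hp => (hχs _ (left_ne_zero_of_mul hp)).1) hε0 hε fun p _ => ?_
    rw [norm_mul]
    exact mul_le_mul (hχB _) (hD _) (norm_nonneg _) hB
  obtain ⟨G₁, hG₁, hG₁n, hG₁T⟩ := exists_L2_density_of_compactSupport (ν := ν) (K := K)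
    (by positivity) T (fun a b ha has hb hbs => by
      refine tendsto_nhds_unique (hT _ (ha.add hb) (has.add hbs))
        (((hT a ha has).add (hT b hb hbs)).congr' ?_)
      filter_upwards [eventually_small_slab hX hY] with ε hε
      rw [← slabMean_add (hint a ha has ε hε.1 hε.2) (hint b hb hbs ε hε.1 hε.2)]
      simp only [Pi.add_apply, mul_add])
    (fun a h hh hhs => by
      refine tendsto_nhds_unique (hT _ (hh.const_smul a) (hhs.smul_left (f := fun _ => a)))
        (((hT h hh hhs).const_mul a).congr fun ε => ?_)
      rw [← slabMean_const_mul]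
      simp only [Pi.smul_apply, smul_eq_mul, mul_left_comm a])
    (fun h hh hhs => by
      have hn : eLpNorm (fun ξ => χ ξ * h ξ) 2 volume ≤ ENNReal.ofReal B * eLpNorm h 2 ν := by
        have hi : ball.indicator (fun ξ => χ ξ * h ξ) = fun ξ => χ ξ * h ξ :=
          Set.indicator_eq_self.2 fun ξ hξ =>
            mem_closedBall_zero_iff.2 (hχs ξ (left_ne_zero_of_mul hξ)).2
        rw [← hi, eLpNorm_indicator_eq_eLpNorm_restrict hball]
        refine eLpNorm_le_mul_eLpNorm_of_ae_le_mul (ae_of_all _ fun ξ => ?_) 2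
        rw [norm_mul]
        exact mul_le_mul_of_nonneg_right (hχB ξ) (norm_nonneg _)
      refine le_of_tendsto (hT h hh hhs).enorm ?_
      filter_upwards [eventually_small_slab hX hY] with ε hε
      refine (enorm_slabMean_le_of_angBound (H := fun ξ => χ ξ * h ξ) h₁ h₂ h₁₂ hX hY hc hFm hGm
        (hχ.mul hh).measurable hF' hG' (fun ξ hξ => (hχs ξ (left_ne_zero_of_mul hξ)).1) hM hFM hN
        hε.1 hε.2).trans ?_
      refine (mul_le_mul' le_rfl (mul_le_mul' le_rfl hn)).trans (le_of_eq ?_)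
      rw [hKof, ENNReal.ofReal_mul (by positivity)]
      ring)
  refine ⟨ball.indicator G₁, ?_, fun ξ hξ =>
    mem_closedBall_zero_iff.1 (Set.mem_of_indicator_ne_zero hξ), ?_, fun h hh hhs => ?_⟩
  · exact (aestronglyMeasurable_indicator_iff hball).2 hG₁.1
  · rw [eLpNorm_indicator_eq_eLpNorm_restrict hball]
    exact hG₁n.trans_eq hKof
  · have h0 := continuous_comp_parabPoint (c := c) hh
    have h0s := hasCompactSupport_comp_parabPoint (c := c) hhs
    have hlim : T (fun ξ => h (parabPoint 1 c ξ)) = ∫ ξ : Plane,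
        ball.indicator G₁ (parabPoint 1 c ξ).1 * h (parabPoint 1 c ξ) := by
      rw [hG₁T _ h0 h0s, ← integral_indicator hball]
      exact integral_congr_ae (ae_of_all _ fun ξ => Set.indicator_mul_left _ _ _)
    rw [← hlim]
    have hT0 := hT _ h0 h0s
    beta_reduce at hT0
    refine (tendsto_slabMean_of_trace h₁ h₂ h₁₂ hX hY hc hFm hGm hF2 hG2 hF' hG' hχ
      (fun ξ hξ => (hχs ξ hξ).1) hχB hh hhs hT0).congr fun ε => ?_
    have hk : Continuous fun x : Freq => χ x.1 * h x := by fun_prop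
    have hks : HasCompactSupport fun x : Freq => χ x.1 * h x :=
      HasCompactSupport.mul_left (f := fun x : Freq => χ x.1) hhs
    have := slab_average_eq_slabMean (c := c) hk hks hlh ε
    simp only [convPoint_eq] at this ⊢
    rw [← this]
    congr 2
    funext x
    ring

end Trace

/-! ### The dyadic cutoff -/

theorem IsCutoff.exists_bound {φ : ℝ → ℝ} (hφ : IsCutoff φ) :
    ∃ B, 0 < B ∧ ∀ k x, 0 ≤ x → |dyadicCutoff φ (k + 1) x| ≤ B := by
  -- A cutoff is not assumed to be at most 1 on [1, 2], so its bound comes from compactness of [0,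
  -- 2]; this is how the constant depends on φ.
  obtain ⟨A, hA⟩ := isCompact_Icc.exists_bound_of_continuousOn (s := Set.Icc (0 : ℝ) 2)
    (hφ.smooth.continuousOn.mono fun x hx => hx.1)
  have h : ∀ x, 0 ≤ x → |φ x| ≤ |A| := fun x hx => by
    rcases le_total x 2 with h2 | h2
    · exact (hA x ⟨hx, h2⟩).trans (le_abs_self A)
    · rw [hφ.eq_zero x h2, abs_zero]; exact abs_nonneg A
  refine ⟨2 * |A| + 1, by positivity, fun k x hx => ?_⟩
  have h1 := h (x / 2 ^ (k + 1)) (by positivity)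
  have h2 := h (x / 2 ^ k) (by positivity)
  have h3 := abs_sub (φ (x / 2 ^ (k + 1))) (φ (x / 2 ^ k))
  rw [dyadicCutoff]
  linarith

/-- Below 2^k both terms equal 1, and above 2^(k+2) both vanish. A positive index is essential: the
function of index 0 is 1 near the origin. -/
theorem IsCutoff.dyadicCutoff_ne_zero {φ : ℝ → ℝ} (hφ : IsCutoff φ) {k : ℕ} {x : ℝ} (hx : 0 ≤ x)
    (h : dyadicCutoff φ (k + 1) x ≠ 0) : 2 ^ (k + 1) / 2 ≤ x ∧ x ≤ 2 * 2 ^ (k + 1) := by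
  have hp : (0 : ℝ) < 2 ^ k := by positivity
  rw [dyadicCutoff] at h
  constructor
  · by_contra! h1
    rw [pow_succ] at h1
    refine h ?_
    rw [hφ.eq_one _ (by positivity) ((div_le_one (by positivity)).2 (by rw [pow_succ]; linarith)),
      hφ.eq_one _ (by positivity) ((div_le_one (by positivity)).2 (by linarith)), sub_self]
  · by_contra! h1
    refine h ?_
    rw [hφ.eq_zero _ ((le_div_iff₀ (by positivity)).2 h1.le),
      hφ.eq_zero _ ((le_div_iff₀ (by positivity)).2 (by rw [pow_succ] at h1; linarith)), sub_self]

theorem IsCutoff.continuous_dyadicCutoff_norm {φ : ℝ → ℝ} (hφ : IsCutoff φ) (k : ℕ) :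
    Continuous fun ξ : Plane => (dyadicCutoff φ (k + 1) ‖ξ‖ : ℂ) := by
  have h : ∀ n : ℕ, Continuous fun ξ : Plane => φ (‖ξ‖ / 2 ^ n) := fun n =>
    hφ.smooth.continuousOn.comp_continuous (by fun_prop) fun ξ => by
      rw [Set.mem_Ici]; positivity
  exact Complex.continuous_ofReal.comp ((h (k + 1)).sub (h k))

theorem lintegral_enorm_add_sq_le {α : Type*} [MeasurableSpace α] {μ : Measure α} {F R : α → ℂ}
    (hF : AEStronglyMeasurable F μ) (hR : AEStronglyMeasurable R μ) :
    ∫⁻ z, (‖F z‖ₑ + ‖R z‖ₑ) ^ 2 ∂μ ≤ (eLpNorm F 2 μ + eLpNorm R 2 μ) ^ 2 := by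
  have h := eLpNorm_add_le hF.norm hR.norm (p := 2) (by norm_num)
  rw [eLpNorm_norm, eLpNorm_norm] at h
  refine le_trans (le_of_eq ?_) (pow_le_pow_left' h 2)
  rw [eLpNorm_two_sq]
  refine lintegral_congr fun z => ?_
  rw [Pi.add_apply, Real.enorm_of_nonneg (by positivity),
    ENNReal.ofReal_add (norm_nonneg _) (norm_nonneg _), ofReal_norm, ofReal_norm]

/-- A function of `ξ` supported in a disc, as a function on a paraboloid. -/
theorem eLpNorm_comp_fst_parabMeasure_le {s c X : ℝ} (hX : 1 ≤ X) {G₀ : Plane → ℂ}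
    (hG : ∀ ξ, G₀ ξ ≠ 0 → ‖ξ‖ ≤ 2 * X) :
    eLpNorm (fun x : Freq => G₀ x.1) 2 (parabMeasure s c)
      ≤ ENNReal.ofReal √(5 * X) * eLpNorm G₀ 2 volume := by
  rw [← ENNReal.pow_le_pow_left_iff two_ne_zero, mul_pow, eLpNorm_two_sq, eLpNorm_two_sq,
    lintegral_parabMeasure, ← ENNReal.ofReal_pow (Real.sqrt_nonneg _),
    Real.sq_sqrt (by positivity), ← lintegral_const_mul' _ _ ENNReal.ofReal_ne_top]
  refine lintegral_mono fun ξ => ?_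
  simp only [parabPoint]
  by_cases hξ : G₀ ξ = 0
  · simp [hξ]
  · exact mul_le_mul' (ENNReal.ofReal_le_ofReal (surfWeight_le hX (hG ξ hξ))) le_rfl

theorem aestronglyMeasurable_comp_fst_parabMeasure {s c : ℝ} {G₀ : Plane → ℂ}
    (hG : AEStronglyMeasurable G₀ volume) :
    AEStronglyMeasurable (fun x : Freq => G₀ x.1) (parabMeasure s c) := by
  rw [parabMeasure, (measurableEmbedding_parabPoint s c).aestronglyMeasurable_map_iff]
  exact hG.mono_ac (withDensity_absolutelyContinuous _ _)

/-- Bookkeeping of the weights: √max √X √Y = max √min cancels the 1/max of the slab estimate.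
Numerically √200 ≤ 15 and 320 · 15 = 4800. -/
theorem trace_constant_le {X Y B : ℝ} (hX : 0 < X) (hY : 0 < Y) (hB : 0 ≤ B) :
    √(5 * max X Y) * (320 / max X Y * B) * (√(8 * X) * √(5 * Y)) ≤ 4800 * B * √(min X Y) := by
  set M := max X Y
  set m := min X Y
  have hM : 0 < M := lt_max_of_lt_left hX
  have hm : 0 < m := lt_min hX hY
  have hXY : X * Y = m * M := (min_mul_max X Y).symm
  have h : √(5 * M) * (√(8 * X) * √(5 * Y)) ≤ 15 * M * √m := by
    rw [← Real.sqrt_mul (by positivity), ← Real.sqrt_mul (by positivity)]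
    refine Real.sqrt_le_iff.2 ⟨by positivity, ?_⟩
    rw [mul_pow, mul_pow, Real.sq_sqrt hm.le]
    have : 5 * M * (8 * X * (5 * Y)) = 200 * M * (X * Y) := by ring
    rw [this, hXY]
    nlinarith [mul_pos (mul_pos hM hM) hm]
  calc _ = 320 / M * B * (√(5 * M) * (√(8 * X) * √(5 * Y))) := by ring
    _ ≤ 320 / M * B * (15 * M * √m) := by gcongr
    _ = 4800 * B * √m := by field_simp; ring

theorem conv_trace_estimate (φ : ℝ → ℝ) (hφ : IsCutoff φ) : ∃ C : ℝ, 0 < C ∧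
    ∀ (i j : ℕ) (s₁ s₂ : ℝ), 1 ≤ min i j →
      (s₁ = 1 ∨ s₁ = -1) → (s₂ = 1 ∨ s₂ = -1) → ¬ (s₁ = -1 ∧ s₂ = -1) →
    ∀ f Rf g : Freq → ℂ,
      MemLp f 2 (parabMeasure s₁ 0) → MemLp Rf 2 (parabMeasure s₁ 0) →
      IsWeakRot (parabMeasure s₁ 0) f Rf →
      MemLp g 2 (parabMeasure s₂ 0) →
      LocalizedAt (parabMeasure s₁ 0) i f → LocalizedAt (parabMeasure s₂ 0) j g →
    ∃ l : Freq → ℂ,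
      IsConvDensity (parabMeasure s₁ 0) (parabMeasure s₂ 0) f g l ∧
      ∀ c : ℝ, |c| ≤ (2 : ℝ) ^ (i + j) / 4 →
        ∃ G : Freq → ℂ, MemLp G 2 (parabMeasure 1 c) ∧
          IsRestriction c (freqLocalize φ (max i j) l) G ∧
          eLpNorm G 2 (parabMeasure 1 c) ≤
            ENNReal.ofReal (C * (2 : ℝ) ^ (((min i j : ℕ) : ℝ) / 2)) *
              (eLpNorm f 2 (parabMeasure s₁ 0) + eLpNorm Rf 2 (parabMeasure s₁ 0)) *
              eLpNorm g 2 (parabMeasure s₂ 0) := by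
  obtain ⟨B, hB0, hB⟩ := hφ.exists_bound
  refine ⟨4800 * B, by positivity, fun i j s₁ s₂ hij h₁ h₂ h₁₂ f Rf g hf hRf hweak hg hfl hgl => ?_⟩
  have hX : (1 : ℝ) ≤ 2 ^ i := one_le_pow₀ (by norm_num)
  have hY : (1 : ℝ) ≤ 2 ^ j := one_le_pow₀ (by norm_num)
  obtain ⟨F, hFm, hF2, hFs, hFn, hFae⟩ := exists_planeDensity hX hf hfl
  obtain ⟨G, hGm, hG2, hGs, hGn, hGae⟩ := exists_planeDensity hY hg hgl
  obtain ⟨l, hl, -, hlh⟩ := exists_conv_density h₁ h₂ h₁₂ (by positivity) (by positivity)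
    hFm hGm hF2 hG2 hFs hGs
  obtain ⟨RF, hRm, hRi, hRn, hRw⟩ :=
    exists_planeDensity_weakRot h₁ hX hRf hweak (fun η hη => (hFs η hη).2) hFae
  refine ⟨l, isConvDensity_of_planeDensity hFae hGae hl hlh, fun c hc => ?_⟩
  have hmax := two_pow_max i j
  have hmin : √(min ((2 : ℝ) ^ i) (2 ^ j)) = (2 : ℝ) ^ (((min i j : ℕ) : ℝ) / 2) := by
    rw [two_pow_min, Real.sqrt_eq_rpow, ← Real.rpow_natCast, ← Real.rpow_mul (by norm_num)]
    congr 1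
    ring
  rw [pow_add] at hc
  rw [← hmin]
  -- Since min(i, j) ≥ 1, the cutoff has positive index and keeps |ξ| ≥ max(X, Y)/2, as
  -- transversality requires.
  obtain ⟨k, hk⟩ : ∃ k, max i j = k + 1 := ⟨max i j - 1, by omega⟩
  set X : ℝ := 2 ^ i
  set Y : ℝ := 2 ^ j
  have hM1 : 1 ≤ max X Y := hX.trans (le_max_left _ _)
  set a := eLpNorm f 2 (parabMeasure s₁ 0)
  set r := eLpNorm Rf 2 (parabMeasure s₁ 0)
  have har : a + r ≠ ⊤ := ENNReal.add_ne_top.2 ⟨hf.eLpNorm_lt_top.ne, hRf.eLpNorm_lt_top.ne⟩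
  have hN : eLpNorm F 2 volume + eLpNorm RF 2 volume ≤ ENNReal.ofReal √(8 * X) * (a + r) := by
    rw [mul_add]
    refine add_le_add (hFn.trans (mul_le_mul' (ENNReal.ofReal_le_ofReal ?_) le_rfl)) hRn
    exact Real.sqrt_le_sqrt (by linarith)
  obtain ⟨G₀, hG₀m, hG₀s, hG₀n, hG₀⟩ := exists_trace (c := c) (l := l) h₁ h₂ h₁₂
    (by positivity) (by positivity) hc hFm hGm hF2 hG2 hFs hGs
    (χ := fun ξ => (dyadicCutoff φ (max i j) ‖ξ‖ : ℂ)) (B := B)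
    (by rw [hk]; exact hφ.continuous_dyadicCutoff_norm k)
    (fun ξ hξ => by
      rw [hk] at hξ
      rw [hmax, hk]
      exact hφ.dyadicCutoff_ne_zero (norm_nonneg _) (by exact_mod_cast hξ))
    (fun ξ => by
      rw [Complex.norm_real, Real.norm_eq_abs, hk]
      exact hB k _ (norm_nonneg _))
    (hFm.enorm.add hRm.enorm)
    (enorm_le_angBound (hF2.integrable_of_bounded_support fun η hη => (hFs η hη).2) hRi hRw)
    ((lintegral_enorm_add_sq_le hFm.aestronglyMeasurable hRm.aestronglyMeasurable).trans
      (pow_le_pow_left' hN 2))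
    (ENNReal.mul_ne_top ENNReal.ofReal_ne_top har) hlh
  have hn : eLpNorm (fun x : Freq => G₀ x.1) 2 (parabMeasure 1 c)
      ≤ ENNReal.ofReal (4800 * B * √(min X Y)) * (a + r) * eLpNorm g 2 (parabMeasure s₂ 0) := by
    calc _ ≤ ENNReal.ofReal √(5 * max X Y) * (ENNReal.ofReal (320 / max X Y * B) *
          (ENNReal.ofReal √(8 * X) * (a + r) *
            (ENNReal.ofReal √(5 * Y) * eLpNorm g 2 (parabMeasure s₂ 0)))) :=
          (eLpNorm_comp_fst_parabMeasure_le hM1 hG₀s).trans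
            (mul_le_mul' le_rfl (hG₀n.trans (mul_le_mul' le_rfl (mul_le_mul' le_rfl hGn))))
      _ = ENNReal.ofReal (√(5 * max X Y) * (320 / max X Y * B) * (√(8 * X) * √(5 * Y))) *
          (a + r) * eLpNorm g 2 (parabMeasure s₂ 0) := by
          rw [ENNReal.ofReal_mul (p := √(5 * max X Y) * (320 / max X Y * B)) (by positivity),
            ENNReal.ofReal_mul (Real.sqrt_nonneg (5 * max X Y)),
            ENNReal.ofReal_mul (Real.sqrt_nonneg (8 * X))]
          ring
      _ ≤ _ := by
          refine mul_le_mul' (mul_le_mul' (ENNReal.ofReal_le_ofReal ?_) le_rfl) le_rfl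
          exact trace_constant_le (by positivity) (by positivity) hB0.le
  refine ⟨fun x => G₀ x.1, ⟨aestronglyMeasurable_comp_fst_parabMeasure hG₀m, hn.trans_lt ?_⟩,
    hG₀, hn⟩
  exact ENNReal.mul_lt_top (ENNReal.mul_lt_top ENNReal.ofReal_lt_top har.lt_top) hg.eLpNorm_lt_top

theorem mainTheorem7 :
    -- (a) restriction of the convolution to `P_c`
    (∀ φ : ℝ → ℝ, IsCutoff φ → ∃ C : ℝ, 0 < C ∧
      ∀ (i j : ℕ) (s₁ s₂ : ℝ), 1 ≤ min i j →
        (s₁ = 1 ∨ s₁ = -1) → (s₂ = 1 ∨ s₂ = -1) → ¬ (s₁ = -1 ∧ s₂ = -1) →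
      ∀ f Rf g : Freq → ℂ,
        MemLp f 2 (parabMeasure s₁ 0) → MemLp Rf 2 (parabMeasure s₁ 0) →
        IsWeakRot (parabMeasure s₁ 0) f Rf →
        MemLp g 2 (parabMeasure s₂ 0) →
        LocalizedAt (parabMeasure s₁ 0) i f → LocalizedAt (parabMeasure s₂ 0) j g →
      ∃ l : Freq → ℂ,
        IsConvDensity (parabMeasure s₁ 0) (parabMeasure s₂ 0) f g l ∧
        ∀ c : ℝ, |c| ≤ (2 : ℝ) ^ (i + j) / 4 →
          ∃ G : Freq → ℂ, MemLp G 2 (parabMeasure 1 c) ∧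
            IsRestriction c (freqLocalize φ (max i j) l) G ∧
            eLpNorm G 2 (parabMeasure 1 c) ≤
              ENNReal.ofReal (C * (2 : ℝ) ^ (((min i j : ℕ) : ℝ) / 2)) *
                (eLpNorm f 2 (parabMeasure s₁ 0) + eLpNorm Rf 2 (parabMeasure s₁ 0)) *
                eLpNorm g 2 (parabMeasure s₂ 0)) ∧
    -- (b) global estimate
    (∃ C : ℝ, 0 < C ∧
      ∀ (i j : ℕ) (s₁ s₂ : ℝ),
        (s₁ = 1 ∨ s₁ = -1) → (s₂ = 1 ∨ s₂ = -1) → ¬ (s₁ = -1 ∧ s₂ = -1) →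
      ∀ f g : Freq → ℂ,
        MemLp f 2 (parabMeasure s₁ 0) → MemLp g 2 (parabMeasure s₂ 0) →
        LocalizedAt (parabMeasure s₁ 0) i f → LocalizedAt (parabMeasure s₂ 0) j g →
      ∃ l : Freq → ℂ,
        IsConvDensity (parabMeasure s₁ 0) (parabMeasure s₂ 0) f g l ∧
        MemLp l 2 volume ∧
        eLpNorm l 2 volume ≤
          ENNReal.ofReal (C * (2 : ℝ) ^ (min i j)) *
            eLpNorm f 2 (parabMeasure s₁ 0) * eLpNorm g 2 (parabMeasure s₂ 0)) :=
  ⟨conv_trace_estimate, conv_global_estimate⟩
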